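/- **Setting.** Let $Q=[0,1)^3$ and let $\mu$ be a $\mathbb{Z}^3$-periodic Borel measure on $\mathbb{R}^3$ with $\mu(Q)=1$ such that $\int_Q\partial_j\phi\,d\mu=0$ for all $\phi\in C^\infty_\#(Q)$ (smooth $Q$-periodic functions) and $j=1,2,3$. For $\varepsilon>0$ put $\mu^\varepsilon(B)=\varepsilon^3\mu(\varepsilon^{-1}B)$. Let $A$ be a continuously differentiable $Q$-periodic function with values in the real symmetric positive definite $3\times3$ matrices, and let $\widetilde A$ be a measurable $Q$-periodic function with values in the real symmetric $3\times 3$ matrices with $a|v|^2\le \widetilde A(y)v\cdot v\le b|v|^2$ for all $y,v\in\mathbb{R}^3$, where $a>0$. Write $e_\theta(x)=e^{i\theta\cdot x}$. **Whole-space problem.** $H^1_{\mathrm{curl} A^{1/2}}(\mathbb{R}^3,d\mu^\varepsilon)$ is the closure in $L^2(\mathbb{R}^3,d\mu^\varepsilon)\oplus L^2(\mathbb{R}^3,d\mu^\varepsilon)$ of the set of pairs $(\phi,\mathrm{curl}(A^{1/2}(\cdot/\varepsilon)\phi))$ with $A^{1/2}(\cdot/\varepsilon)\phi\in C_0^\infty(\mathbb{R}^3)$;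 its elements are written $(u,\mathrm{curl}(A^{1/2}u))$. For $g\in L^2(\mathbb{R}^3,d\mu^\varepsilon)$ with $\mathrm{div}\,g=0$, i.e. $\int g\cdot\overline{\nabla\phi}\,d\mu^\varepsilon=0$ for all $\phi\in C_0^\infty(\mathbb{R}^3)$, let $(D_\varepsilon,\mathrm{curl}(A^{1/2}D_\varepsilon))\in H^1_{\mathrm{curl} A^{1/2}}(\mathbb{R}^3,d\mu^\varepsilon)$ be the solution of $A^{1/2}\mathrm{curl}\,\widetilde A\,\mathrm{curl}\,A^{1/2}D_\varepsilon+D_\varepsilon=-A^{1/2}g$ with coefficients evaluated at $x/\varepsilon$, i.e. $$\int\widetilde A\,\mathrm{curl}(A^{1/2}D_\varepsilon)\cdot\overline{\mathrm{curl}(A^{1/2}\phi)}\,d\mu^\varepsilon+\int D_\varepsilon\cdot\overline\phi\,d\mu^\varepsilon=-\int A^{1/2}g\cdot\overline\phi\,d\mu^\varepsilon$$ for all $(\phi,\mathrm{curl}(A^{1/2}\phi))\in H^1_{\mathrm{curl} A^{1/2}}(\mathbb{R}^3,d\mu^\varepsilon)$. **Cell problems.** Let $C^\infty_{\#,0}(Q)$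 be the set of $\phi\in C^\infty_\#(Q)$ with $\int_Q\phi\,d\mu=0$, and let $H^1_{\#,0}(Q,d\mu)$ be the closure of $\{(\phi,\nabla\phi):\phi\in C^\infty_{\#,0}(Q)\}$ in $L^2(Q,d\mu)\oplus L^2(Q,d\mu)$. For every $\kappa\in\mathbb{R}^3$ let $\Psi_\kappa=((\Psi_\kappa)_1,(\Psi_\kappa)_2,(\Psi_\kappa)_3)$ with components in $H^1_{\#,0}(Q,d\mu)$ solve $$\int_Q A^{-1}\bigl(\overline{e_\kappa}\nabla(e_\kappa(\Psi_\kappa)_j)+\mathbf e_j\bigr)\cdot\overline{\overline{e_\kappa}\nabla(e_\kappa\phi)}\,d\mu=0\quad\forall\phi\in C^\infty_{\#,0}(Q),\ j=1,2,3,$$ where $\overline{e_\kappa}\nabla(e_\kappa\psi)=\nabla\psi+i\kappa\psi$ and $\mathbf e_j$ are the standard basis vectors, and let $\overline{e_\kappa}\nabla(e_\kappa\Psi_\kappa)$ be the matrix with columns $\overline{e_\kappa}\nabla(e_\kappa(\Psi_\kappa)_j)$. Put $$\widehat A^{\rm hom}_\kappa=\int_QA^{-1}\bigl(\overline{e_\kappa}\nabla(e_\kappa\Psi_\kappa)+I\bigr)d\mu.$$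 Let $H^1_{\mathrm{curl} A^{1/2}}(Q,d\mu)$ be the closure in $L^2(Q,d\mu)\oplus L^2(Q,d\mu)$ of the set of pairs $(\phi,\mathrm{curl}(A^{1/2}\phi))$ with $A^{1/2}\phi\in C^\infty_\#(Q)$. Let the matrix $\widetilde N$ have columns in $H^1_{\mathrm{curl} A^{1/2}}(Q,d\mu)$, with $\mathrm{div}(A^{-1/2}\widetilde N)=0$ (tested against gradients of $C^\infty_\#(Q)$ functions), $\int_QA^{1/2}\widetilde N\,d\mu=0$ and $$\int_Q\widetilde A\,\mathrm{curl}(A^{1/2}\widetilde N)\cdot\overline{\mathrm{curl}(A^{1/2}\phi)}\,d\mu=-\int_Q\widetilde A\,\overline{\mathrm{curl}(A^{1/2}\phi)}\,d\mu$$ for all $\phi\in H^1_{\mathrm{curl}A^{1/2}}(Q,d\mu)$ with $\int_QA^{1/2}\phi\,d\mu=0$. Put $$\widetilde A^{\rm hom}=\int_Q\widetilde A\bigl(\mathrm{curl}(A^{1/2}\widetilde N)+I\bigr)d\mu,\qquad \widetilde{\mathfrak A}^{\rm hom}_\theta= i\theta\times\widetilde A^{\rm hom}\,i\theta\times(\widehat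 A^{\rm hom}_{\varepsilon\theta})^{-1}.$$ **Statement.** The cell problems and the whole-space problem have solutions, the matrices $\widehat A^{\rm hom}_{\varepsilon\theta}$ and $\widetilde{\mathfrak A}^{\rm hom}_\theta+I$ are invertible for all $\varepsilon>0$ and $\theta\in\mathbb{R}^3$, and there is a constant $C>0$, depending only on $\mu$, $A$ and $\widetilde A$, such that for all $\varepsilon>0$ and all $g\in L^2(\mathbb{R}^3,d\mu^\varepsilon)$ with $\mathrm{div}\,g=0$, $$\Bigl\|D_\varepsilon+(2\pi)^{-3/2}\int_{\mathbb{R}^3}A^{-1/2}\bigl(\overline{e_{\varepsilon\theta}}\nabla(e_{\varepsilon\theta}\Psi_{\varepsilon\theta})+I\bigr)(\widehat A^{\rm hom}_{\varepsilon\theta})^{-1}\bigl(\widetilde{\mathfrak A}^{\rm hom}_\theta+I\bigr)^{-1}\widehat g(\theta)\,e_\theta\,d\theta\Bigr\|_{L^2(\mathbb{R}^3,d\mu^\varepsilon)}\le C\varepsilon\|g\|_{L^2(\mathbb{R}^3,d\mu^\varepsilon)}.$$ Here $A^{-1/2}$ and $\overline{e_{\varepsilon\theta}}\nabla(e_{\varepsilon\theta}\Psi_{\varepsilon\theta})$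 are evaluated at $x/\varepsilon$, $\widehat g(\theta)=(2\pi)^{-3/2}\int_{\mathbb{R}^3}g\,\overline{e_\theta}\,d\mu^\varepsilon$ is understood as the limit in $L^2_{\rm loc}(\mathbb{R}^3,d\theta)$ of the integrals over balls of radius $r\to\infty$ (this limit exists), and the $\theta$-integral is understood as an element of $L^2(\mathbb{R}^3,d\mu^\varepsilon)$, after pairing with test fields from $C_0^\infty(\mathbb{R}^3)$. -/

import Mathlib

open MeasureTheory Filter Topology
open scoped ContDiff ENNReal Matrix

noncomputable section

namespace PeriodicMaxwell

/-- Physical space, and the space of complex field values. -/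
abbrev R3 := EuclideanSpace ℝ (Fin 3)
abbrev C3 := EuclideanSpace ℂ (Fin 3)
abbrev RMat := Matrix (Fin 3) (Fin 3) ℝ
abbrev CMat := Matrix (Fin 3) (Fin 3) ℂ

/-! ### Algebra -/

/-- A real matrix regarded as a complex one. -/
def cm (M : RMat) : CMat := M.map Complex.ofReal

/-- A real vector regarded as a complex one. -/
def cv (x : R3) : C3 := WithLp.toLp 2 fun i => (x i : ℂ)

/-- Matrix times vector. -/
def app (M : CMat) (v : C3) : C3 := WithLp.toLp 2 (M *ᵥ v.ofLp)

/-- The product `a · conj b` of complex vectors. -/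
def cdot (a b : C3) : ℂ := ∑ i, a i * starRingEnd ℂ (b i)

/-- The matrix of the map `v ↦ iθ × v`. -/
def crossI (θ : R3) : CMat :=
  LinearMap.toMatrix' (crossProduct fun i => Complex.I * (θ i : ℂ))

open scoped MatrixOrder Matrix.Norms.L2Operator in
/-- The positive square root `A^{1/2}` of a positive definite matrix. -/
def msqrt (A : RMat) : RMat := CFC.sqrt A

/-- The plane wave `e_θ(x) = exp(i θ · x)`. -/
def pw (θ x : R3) : ℂ := Complex.exp (Complex.I * ((inner ℝ θ x : ℝ) : ℂ))

/-! ### Periodicity and the scaled measure -/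

/-- The unit cell `[0,1)^3`. -/
def Q : Set R3 := {y | ∀ i, 0 ≤ y i ∧ y i < 1}

/-- The lattice vector with integer coordinates `n`. -/
def latt (n : Fin 3 → ℤ) : R3 := WithLp.toLp 2 fun i => (n i : ℝ)

def Periodic {β : Type*} (f : R3 → β) : Prop := ∀ n x, f (x + latt n) = f x

def PeriodicMeasure (μ : Measure R3) : Prop := ∀ n, μ.map (fun x => x + latt n) = μ

/-- `μ^ε(B) = ε^3 μ(ε⁻¹ B)`. -/
def scaled (μ : Measure R3) (ε : ℝ) : Measure R3 :=
  ENNReal.ofReal (ε ^ 3) • μ.map (fun x => ε • x)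

/-! ### Differential operators on smooth functions -/

def pd (j : Fin 3) (f : R3 → ℂ) (x : R3) : ℂ := fderiv ℝ f x (EuclideanSpace.single j 1)

def grad (f : R3 → ℂ) (x : R3) : C3 := WithLp.toLp 2 fun j => pd j f x

def curl (F : R3 → C3) (x : R3) : C3 := WithLp.toLp 2
  ![pd 1 (fun y => F y 2) x - pd 2 (fun y => F y 1) x,
    pd 2 (fun y => F y 0) x - pd 0 (fun y => F y 2) x,
    pd 0 (fun y => F y 1) x - pd 1 (fun y => F y 0) x]

/-- `C_0^∞(ℝ³)`, for scalar or vector functions. -/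
def Test {E : Type*} [NormedAddCommGroup E] [NormedSpace ℝ E] (f : R3 → E) : Prop :=
  ContDiff ℝ ∞ f ∧ HasCompactSupport f

/-- `C_#^∞(Q)`: the smooth `Q`-periodic functions. -/
def PerTest {E : Type*} [NormedAddCommGroup E] [NormedSpace ℝ E] (f : R3 → E) : Prop :=
  ContDiff ℝ ∞ f ∧ Periodic f

/-- `C_{#,0}^∞(Q)`: the smooth `Q`-periodic functions with zero `μ`-mean over `Q`. -/
def PerTestZero (μ : Measure R3) (f : R3 → ℂ) : Prop :=
  PerTest f ∧ ∫ y in Q, f y ∂μ = 0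

/-! ### Sobolev spaces with respect to a measure -/

/-- `(u, v)` belongs to the closure, in `L²(ν) ⊕ L²(ν)`, of the set of pairs `(φ, curl (S φ))`
such that `S φ` is in the class `T` of smooth fields; `v` is then called a curl of `S u`. -/
def MemHCurl (T : (R3 → C3) → Prop) (S : R3 → RMat) (ν : Measure R3) (u v : R3 → C3) : Prop :=
  MemLp u 2 ν ∧ MemLp v 2 ν ∧ ∀ δ : ℝ, 0 < δ → ∃ φ : R3 → C3,
    T (fun x => app (cm (S x)) (φ x)) ∧
    eLpNorm (fun x => u x - φ x) 2 ν ≤ ENNReal.ofReal δ ∧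
    eLpNorm (fun x => v x - curl (fun z => app (cm (S z)) (φ z)) x) 2 ν ≤ ENNReal.ofReal δ

/-- `H^1_{curl A^{1/2}}(ℝ³, dμ^ε)`, for the rescaled coefficient `A(·/ε)`. -/
def MemHCurlWhole (μ : Measure R3) (A : R3 → RMat) (ε : ℝ) (u v : R3 → C3) : Prop :=
  MemHCurl Test (fun x => msqrt (A (ε⁻¹ • x))) (scaled μ ε) u v

/-- `H^1_{curl A^{1/2}}(Q, dμ)`. -/
def MemHCurlPer (μ : Measure R3) (A : R3 → RMat) (u v : R3 → C3) : Prop :=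
  MemHCurl PerTest (fun y => msqrt (A y)) (μ.restrict Q) u v

/-- `H^1_{#,0}(Q, dμ)`: `(ψ, p)` is in the closure, in `L²(Q,dμ) ⊕ L²(Q,dμ)`, of the set of
pairs `(φ, ∇φ)` with `φ` in `C_{#,0}^∞(Q)`; `p` is then called a gradient of `ψ`. -/
def MemHOneZero (μ : Measure R3) (ψ : R3 → ℂ) (p : R3 → C3) : Prop :=
  MemLp ψ 2 (μ.restrict Q) ∧ MemLp p 2 (μ.restrict Q) ∧ ∀ δ : ℝ, 0 < δ → ∃ φ : R3 → ℂ,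
    PerTestZero μ φ ∧
    eLpNorm (fun y => ψ y - φ y) 2 (μ.restrict Q) ≤ ENNReal.ofReal δ ∧
    eLpNorm (fun y => p y - grad φ y) 2 (μ.restrict Q) ≤ ENNReal.ofReal δ

/-- `conj(e_κ) ∇(e_κ ψ) = ∇ψ + iκψ`, where `p` is the gradient of `ψ`. -/
def gradK (κ : R3) (ψ : R3 → ℂ) (p : R3 → C3) (y : R3) : C3 :=
  p y + (Complex.I * ψ y) • cv κ

/-! ### The Maxwell problem in the whole space -/

/-- `div g = 0` in the sense of integral identities. -/
def DivFree (ν : Measure R3) (g : R3 → C3) : Prop :=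
  ∀ φ : R3 → ℂ, Test φ → ∫ x, cdot (g x) (grad φ x) ∂ν = 0

/-- `(D, B)`, with `B` a curl of `A^{1/2} D`, is the solution of
`A^{1/2} curl At curl A^{1/2} D + D = - A^{1/2} g` with coefficients `A(·/ε)`, `At(·/ε)`. -/
def IsMaxwellSolution (μ : Measure R3) (A At : R3 → RMat) (ε : ℝ) (g D B : R3 → C3) : Prop :=
  MemHCurlWhole μ A ε D B ∧ ∀ φ w : R3 → C3, MemHCurlWhole μ A ε φ w →
    ∫ x, cdot (app (cm (At (ε⁻¹ • x))) (B x)) (w x) ∂(scaled μ ε)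
      + ∫ x, cdot (D x) (φ x) ∂(scaled μ ε)
    = - ∫ x, cdot (app (cm (msqrt (A (ε⁻¹ • x)))) (g x)) (φ x) ∂(scaled μ ε)

/-! ### Cell problems and homogenised matrices -/

/-- `ψ = Ψ_κ · c` with gradient `p`: the (periodically extended) solution in `H^1_{#,0}(Q,dμ)` of
`conj(e_κ) div A⁻¹ (∇(e_κ ψ) + e_κ c) = 0`. -/
def IsCellSolution (μ : Measure R3) (A : R3 → RMat) (κ : R3) (c : C3)
    (ψ : R3 → ℂ) (p : R3 → C3) : Prop :=
  Periodic ψ ∧ Periodic p ∧ MemHOneZero μ ψ p ∧ ∀ φ : R3 → ℂ, PerTestZero μ φ →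
    ∫ y in Q, cdot (app (cm (A y)⁻¹) (gradK κ ψ p y + c)) (gradK κ φ (grad φ) y) ∂μ = 0

/-- `Ψ κ j` is the `j`-th component of the vector function `Ψ_κ`, for every `κ` in `ℝ³`, and
`P κ j` is its gradient. -/
def IsCellFamily (μ : Measure R3) (A : R3 → RMat)
    (Ψ : R3 → Fin 3 → R3 → ℂ) (P : R3 → Fin 3 → R3 → C3) : Prop :=
  ∀ κ j, IsCellSolution μ A κ (EuclideanSpace.single j 1) (Ψ κ j) (P κ j)

/-- The matrix `conj(e_κ) ∇(e_κ Ψ_κ) + I`, its `j`-th column being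
`conj(e_κ) ∇(e_κ (Ψ_κ)_j) + e_j`. -/
def corr (Ψ : R3 → Fin 3 → R3 → ℂ) (P : R3 → Fin 3 → R3 → C3) (κ y : R3) : CMat :=
  Matrix.of fun i j => gradK κ (Ψ κ j) (P κ j) y i + (1 : CMat) i j

/-- `Â^hom_κ = ∫_Q A⁻¹ (conj(e_κ) ∇(e_κ Ψ_κ) + I) dμ`. -/
def AhatHom (μ : Measure R3) (A : R3 → RMat)
    (Ψ : R3 → Fin 3 → R3 → ℂ) (P : R3 → Fin 3 → R3 → C3) (κ : R3) : CMat :=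
  Matrix.of fun i j => ∫ y in Q, (cm (A y)⁻¹ * corr Ψ P κ y) i j ∂μ

/-- The matrix with columns `N j` is the solution of
`A^{1/2} curl At curl A^{1/2} N = - A^{1/2} curl At`, `div A^{-1/2} N = 0`, `∫_Q A^{1/2} N = 0`,
and `R j` is the curl of `A^{1/2} N j`. -/
def IsMagneticCell (μ : Measure R3) (A At : R3 → RMat) (N R : Fin 3 → R3 → C3) : Prop :=
  ∀ j, MemHCurlPer μ A (N j) (R j) ∧
    (∀ φ : R3 → ℂ, PerTest φ →
      ∫ y in Q, cdot (app (cm (msqrt (A y))⁻¹) (N j y)) (grad φ y) ∂μ = 0) ∧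
    ∫ y in Q, app (cm (msqrt (A y))) (N j y) ∂μ = 0 ∧
    ∀ φ w : R3 → C3, MemHCurlPer μ A φ w → ∫ y in Q, app (cm (msqrt (A y))) (φ y) ∂μ = 0 →
      ∫ y in Q, cdot (app (cm (At y)) (R j y)) (w y) ∂μ
        = - ∫ y in Q, cdot (app (cm (At y)) (EuclideanSpace.single j 1)) (w y) ∂μ

/-- `At^hom = ∫_Q At (curl A^{1/2} N + I) dμ`. -/
def AtHom (μ : Measure R3) (At : R3 → RMat) (R : Fin 3 → R3 → C3) : CMat :=
  Matrix.of fun i j =>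
    ∫ y in Q, (cm (At y) * Matrix.of fun k l => R l y k + (1 : CMat) k l) i j ∂μ

/-- The quadratic symbol `iθ × At^hom iθ × (Â^hom_{εθ})⁻¹`. -/
def symb (μ : Measure R3) (A At : R3 → RMat) (Ψ : R3 → Fin 3 → R3 → ℂ)
    (P : R3 → Fin 3 → R3 → C3) (R : Fin 3 → R3 → C3) (ε : ℝ) (θ : R3) : CMat :=
  crossI θ * AtHom μ At R * crossI θ * (AhatHom μ A Ψ P (ε • θ))⁻¹

/-! ### The pseudo-differential operator -/

/-- `(2π)^{-3/2}` -/
def twoPiFactor : ℝ := (2 * Real.pi) ^ (-(3 / 2 : ℝ))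

/-- `ghat(θ) = (2π)^{-3/2} ∫ g conj(e_θ) dν` for `g ∈ L²(ν)`: the limit, in `L²_loc(ℝ³, dθ)`, of
the integrals over the balls of radius `r → ∞`. -/
def IsFourier (ν : Measure R3) (g ghat : R3 → C3) : Prop :=
  AEStronglyMeasurable ghat volume ∧ ∀ ρ : ℝ, 0 < ρ →
    Tendsto (fun r : ℝ => eLpNorm
      (fun θ => ghat θ
        - twoPiFactor • ∫ x in Metric.ball (0 : R3) r, starRingEnd ℂ (pw θ x) • g x ∂ν)
      2 (volume.restrict (Metric.ball (0 : R3) ρ))) atTop (𝓝 0)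

/-- `U(x) = ∫_{ℝ³} F(θ, x) dθ` as a locally integrable field on `(ℝ³, ν)`: the identity holds
after integration in `x` against every test field, with an absolutely convergent `θ`-integral. -/
def IsFieldIntegral (ν : Measure R3) (F : R3 → R3 → C3) (U : R3 → C3) : Prop :=
  (∀ θ, LocallyIntegrable (F θ) ν) ∧ LocallyIntegrable U ν ∧ ∀ φ : R3 → C3, Test φ →
    Integrable (fun θ => ∫ x, cdot (F θ x) (φ x) ∂ν) volume ∧
    ∫ x, cdot (U x) (φ x) ∂ν = ∫ θ, ∫ x, cdot (F θ x) (φ x) ∂ν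

/-- The integrand `(2π)^{-3/2} A^{-1/2}(x/ε) (conj(e_{εθ}) ∇(e_{εθ} Ψ_{εθ}) + I)(x/ε)
(Â^hom_{εθ})⁻¹ (symb_θ + I)⁻¹ ghat(θ) e_θ(x)`. -/
def homIntegrand (μ : Measure R3) (A At : R3 → RMat) (Ψ : R3 → Fin 3 → R3 → ℂ)
    (P : R3 → Fin 3 → R3 → C3) (R : Fin 3 → R3 → C3) (ε : ℝ) (ghat : R3 → C3)
    (θ x : R3) : C3 :=
  ((twoPiFactor : ℂ) * pw θ x) •
    app (cm (msqrt (A (ε⁻¹ • x)))⁻¹ * corr Ψ P (ε • θ) (ε⁻¹ • x)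
      * (AhatHom μ A Ψ P (ε • θ))⁻¹ * (symb μ A At Ψ P R ε θ + 1)⁻¹) (ghat θ)

end PeriodicMaxwell

end

open PeriodicMaxwell

noncomputable section

namespace PeriodicMaxwell

section TorusMeasure

/-! ### The unit cell and the flat torus -/

-- The hypotheses leave no freedom in `μ`. Tested on exponentials, they make every nontrivial
-- Fourier coefficient of `μ` on the flat torus vanish, so `μ` is Lebesgue measure
-- (`eq_volume_of_integral_pd`). Then `scaled μ ε` is Lebesgue measure too, and Plancherel's theorem
-- is available on the whole space.
--
-- With `u = A^{1/2} D` and `B = curl u` the equation reads `curl (At B) + A⁻¹ u = -g`. On the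
-- Fourier side curl is `2πiξ ×`, and multiplication by an `ε`-periodic matrix couples only the
-- frequencies `ε⁻¹ (τ + n)`, `n ∈ ℤ³`. Read as Fourier coefficients, the values on such a fibre
-- form a field on the unit cell, on which the matrix acts by multiplication
-- (`ae_exists_fibre_mulOp`). The problem thus splits into cell problems with quasimomentum `κ =
-- 2πτ`. A bound uniform over one period cell of quasimomenta, chosen so that `|κ + 2πn| ≥ 1` for `n
-- ≠ 0`, integrates to a bound on the whole space (`eLpNorm_le_of_fibre`).
--
-- The bound in a fibre is `fibre_estimate`. The zeroth mode `w` of the homogenised solution is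
-- completed to the electric corrector `Y` with mean `w`. The mean curl `c = iκ × w` is completed by
-- the magnetic corrector `r`, which has a vector potential `N`. The homogenised equation removes
-- the zeroth modes from the energy identity for `z = u + Y + N`. The terms left over are small for
-- three reasons. A divergence-free field pairs with `z` only through its curl `V`, which the energy
-- controls with weight `ε⁻²`. A curl-free periodic field without mean pairs with `V` with a gain
-- `|κ|`. Finally `div g = 0` gives `|κ| |c| ≲ ε² |g|` and `|c| ≲ ε |g|` (`IsMode.bounds`).
--
-- The global counterpart of `Y` is `X = W + gradient` with `A⁻¹ X` divergence-free, where `W` has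
-- Fourier transform `(iθ × At^hom iθ × + Â^hom)⁻¹ ĝ`. In a fibre `X - Y` is controlled by the modes
-- `n ≠ 0` of `W`, which are `O(ε)` because `|k| |w| ≲ ε |g|`.
--
-- That `A^{-1/2} X` is the claimed `θ`-integral is shown by duality (`isFieldIntegral`). Split
-- `A^{-1/2} φ`, for a test field `φ`, into `A⁻¹ q` with a gradient `q` and a divergence-free rest.
-- The first part does not see `X`, and the rest does not see the gradient `X - W`, so only `W`
-- remains. The same splitting in each fibre evaluates the pairing with the integrand.

local instance measureSpaceUnitAddCircle : MeasureSpace UnitAddCircle := ⟨AddCircle.haarAddCircle⟩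

local instance isProbabilityMeasure_unitAddCircle :
    IsProbabilityMeasure (volume : Measure UnitAddCircle) :=
  inferInstanceAs (IsProbabilityMeasure AddCircle.haarAddCircle)

abbrev Torus := UnitAddTorus (Fin 3)

/-- The projection onto the torus. -/
def toTorus (x : R3) : Torus := fun i => (x i : UnitAddCircle)

/-- The representative in the unit cell. -/
def ofTorus (t : Torus) : R3 :=
  WithLp.toLp 2 fun i => (AddCircle.equivIco (1 : ℝ) 0 (t i) : ℝ)

lemma measurable_toTorus : Measurable toTorus :=
  measurable_pi_lambda _ fun i => AddCircle.measurable_mk'.comp (by fun_prop)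

lemma measurable_ofTorus : Measurable ofTorus := by
  refine (WithLp.measurable_toLp 2 _).comp (measurable_pi_lambda _ fun i => ?_)
  exact measurable_subtype_coe.comp
    ((AddCircle.measurableEquivIco (1 : ℝ) 0).measurable.comp (measurable_pi_apply i))

lemma toTorus_ofTorus (t : Torus) : toTorus (ofTorus t) = t := by
  ext i
  exact AddCircle.coe_equivIco (p := (1 : ℝ)) (a := 0) (y := t i)

lemma ofTorus_toTorus {y : R3} (hy : y ∈ Q) : ofTorus (toTorus y) = y := by
  ext i
  have := AddCircle.equivIco_coe_eq (p := (1 : ℝ)) (a := 0) (x := y i)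
    ⟨(hy i).1, by linarith [(hy i).2]⟩
  exact congrArg Subtype.val this

lemma measurableSet_Q : MeasurableSet Q := by
  have : Q = ⋂ i : Fin 3, {y : R3 | 0 ≤ y i ∧ y i < 1} := by ext; simp [Q]
  rw [this]
  refine MeasurableSet.iInter fun i => ?_
  have h : Measurable fun y : R3 => y i := by fun_prop
  exact (measurableSet_le measurable_const h).inter (measurableSet_lt h measurable_const)

lemma map_toTorus_volume : (volume.restrict Q : Measure R3).map toTorus = volume := by
  have e1 : MeasurePreserving (fun x : R3 => x.ofLp) volume volume :=
    EuclideanSpace.volume_preserving_symm_measurableEquiv_toLp (Fin 3)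
  have hQ : Q = (fun x : R3 => x.ofLp) ⁻¹' (Set.univ.pi fun _ => Set.Ico (0 : ℝ) 1) := by
    ext; simp [Q]
  have e2 : MeasurePreserving (fun x : R3 => x.ofLp) (volume.restrict Q)
      (volume.restrict (Set.univ.pi fun _ => Set.Ico (0 : ℝ) 1)) := by
    rw [hQ]
    exact e1.restrict_preimage (MeasurableSet.univ_pi fun _ => measurableSet_Ico)
  have e3 : MeasurePreserving (fun (x : ℝ) => (x : UnitAddCircle))
      (volume.restrict (Set.Ico (0 : ℝ) 1)) AddCircle.haarAddCircle := by
    have := AddCircle.measurePreserving_mk (1 : ℝ) 0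
    rw [zero_add, ← Measure.restrict_congr_set Ico_ae_eq_Ioc] at this
    refine ⟨this.measurable, this.map_eq.trans ?_⟩
    simp [volume, AddCircle.haarAddCircle]
  have e4 := measurePreserving_pi (fun _ : Fin 3 => volume.restrict (Set.Ico (0 : ℝ) 1))
    (fun _ => AddCircle.haarAddCircle) (fun _ => e3)
  rw [← Measure.restrict_pi_pi] at e4
  exact (e4.comp e2).map_eq

/-- A measure on the half-open cell is recovered from its image on the torus, so uniqueness
questions on `Q` become questions about measures on a compact group. -/
lemma restrict_eq_map_ofTorus {ν : Measure R3}
    (h : (ν.restrict Q).map toTorus = (volume : Measure Torus)) :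
    ν.restrict Q = (volume : Measure Torus).map ofTorus := by
  rw [← h, Measure.map_map measurable_ofTorus measurable_toTorus]
  have : (ofTorus ∘ toTorus) =ᵐ[ν.restrict Q] id := by
    filter_upwards [ae_restrict_mem measurableSet_Q] with y hy using ofTorus_toTorus hy
  rw [Measure.map_congr this, Measure.map_id]

lemma measurePreserving_ofTorus :
    MeasurePreserving ofTorus (volume : Measure Torus) (volume.restrict Q) :=
  ⟨measurable_ofTorus, (restrict_eq_map_ofTorus map_toTorus_volume).symm⟩

/-- The dual lattice vector `2πn`. -/
def dual (n : Fin 3 → ℤ) : R3 := (2 * Real.pi) • latt n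

lemma pw_dual (n : Fin 3 → ℤ) (y : R3) :
    pw (dual n) y = UnitAddTorus.mFourier n (toTorus y) := by
  simp only [pw, dual, UnitAddTorus.mFourier, ContinuousMap.coe_mk, toTorus, fourier_coe_apply,
    latt]
  rw [← Complex.exp_sum]
  congr 1
  simp only [inner_smul_left, PiLp.inner_apply, RCLike.inner_apply, conj_trivial]
  push_cast
  rw [Finset.mul_sum, Finset.mul_sum]
  refine Finset.sum_congr rfl fun i _ => ?_
  ring

lemma integral_mFourier (n : Fin 3 → ℤ) (hn : n ≠ 0) :
    ∫ t : Torus, UnitAddTorus.mFourier n t = 0 := by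
  have h : inner ℂ (UnitAddTorus.mFourierLp (d := Fin 3) 2 0) (UnitAddTorus.mFourierLp 2 n) = 0 :=
    UnitAddTorus.orthonormal_mFourier.2 hn.symm
  rw [ContinuousMap.inner_toLp] at h
  simpa [UnitAddTorus.mFourier_zero] using h

lemma latt_apply (n : Fin 3 → ℤ) (i : Fin 3) : latt n i = n i := rfl

lemma dual_apply (n : Fin 3 → ℤ) (i : Fin 3) : dual n i = 2 * Real.pi * n i := rfl

lemma pw_add_left (θ η x : R3) : pw (θ + η) x = pw θ x * pw η x := by
  simp only [pw, inner_add_left, Complex.ofReal_add, mul_add, Complex.exp_add]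

lemma pw_add_right (θ x y : R3) : pw θ (x + y) = pw θ x * pw θ y := by
  simp only [pw, inner_add_right, Complex.ofReal_add, mul_add, Complex.exp_add]

lemma pw_neg_left (θ x : R3) : pw (-θ) x = starRingEnd ℂ (pw θ x) := by
  simp only [pw, inner_neg_left, ← Complex.exp_conj, map_mul, Complex.conj_I, Complex.conj_ofReal]
  congr 1
  push_cast
  ring

@[simp] lemma norm_pw (θ x : R3) : ‖pw θ x‖ = 1 := by
  rw [pw, mul_comm, Complex.norm_exp_ofReal_mul_I]

@[simp] lemma pw_zero_left (x : R3) : pw 0 x = 1 := by simp [pw]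

lemma contDiff_pw (θ : R3) : ContDiff ℝ ∞ (pw θ) := by
  have : ContDiff ℝ ∞ fun x : R3 => Complex.I * Complex.ofRealCLM (innerSL ℝ θ x) := by fun_prop
  exact this.cexp

lemma continuous_pw (θ : R3) : Continuous (pw θ) := (contDiff_pw θ).continuous

lemma hasFDerivAt_pw (θ x : R3) :
    HasFDerivAt (pw θ) ((Complex.I * pw θ x) •
      (Complex.ofRealCLM.comp (innerSL ℝ θ))) x := by
  have h1 : HasFDerivAt (fun x : R3 => Complex.I * ((inner ℝ θ x : ℝ) : ℂ))
      (Complex.I • (Complex.ofRealCLM.comp (innerSL ℝ θ))) x :=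
    (Complex.ofRealCLM.comp (innerSL ℝ θ)).hasFDerivAt.const_mul Complex.I
  have h2 := h1.cexp
  rw [smul_smul, mul_comm] at h2
  exact h2

lemma pd_pw (θ : R3) (j : Fin 3) (x : R3) : pd j (pw θ) x = Complex.I * θ j * pw θ x := by
  rw [pd, (hasFDerivAt_pw θ x).fderiv]
  simp [EuclideanSpace.inner_single_right]
  ring

lemma pw_dual_latt (n k : Fin 3 → ℤ) : pw (dual n) (latt k) = 1 := by
  have : (inner ℝ (dual n) (latt k) : ℝ) = ((∑ i, n i * k i : ℤ) : ℝ) * (2 * Real.pi) := by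
    simp only [PiLp.inner_apply, dual_apply, latt_apply, RCLike.inner_apply, conj_trivial]
    push_cast
    rw [Finset.sum_mul]
    exact Finset.sum_congr rfl fun i _ => by ring
  rw [pw, this]
  have := Complex.exp_int_mul_two_pi_mul_I (∑ i, n i * k i)
  rw [← this]
  congr 1
  push_cast
  ring

lemma perTest_pw (n : Fin 3 → ℤ) : PerTest (pw (dual n)) :=
  ⟨contDiff_pw _, fun k x => by rw [pw_add_right, pw_dual_latt, mul_one]⟩

/-- A probability measure on the torus whose nontrivial Fourier coefficients vanish is the
Haar measure. -/
lemma torus_measure_eq_volume {ν : Measure Torus} [IsProbabilityMeasure ν]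
    (h : ∀ n : Fin 3 → ℤ, n ≠ 0 → ∫ t, UnitAddTorus.mFourier n t ∂ν = 0) : ν = volume := by
  -- Both integrals are continuous in `F` for the uniform norm and agree on the span of the
  -- exponentials, which is dense.
  have key : ∀ F : C(Torus, ℂ), ∫ t, F t ∂ν = ∫ t, F t := by
    have hc : ∀ (ρ : Measure Torus) [IsProbabilityMeasure ρ],
        Continuous fun F : C(Torus, ℂ) => ∫ t, F t ∂ρ := by
      intro ρ _
      have := continuous_integral.comp
        (ContinuousMap.toLp (E := ℂ) 1 ρ ℂ).continuous
      refine this.congr fun F => integral_congr_ae (ContinuousMap.coeFn_toLp ρ F)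
    have hd : Dense (Submodule.span ℂ (Set.range (UnitAddTorus.mFourier (d := Fin 3))) :
        Set C(Torus, ℂ)) := by
      rw [dense_iff_closure_eq, ← Submodule.topologicalClosure_coe,
        UnitAddTorus.span_mFourier_closure_eq_top, Submodule.top_coe]
    refine fun F => hd.induction (P := fun F => ∫ t, F t ∂ν = ∫ t, F t) ?_
      (isClosed_eq (hc ν) (hc volume)) F
    intro F hF
    have hi : ∀ (ρ : Measure Torus) [IsProbabilityMeasure ρ] (F : C(Torus, ℂ)),
      Integrable F ρ := fun ρ _ F => F.continuous.integrable_of_hasCompactSupport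
        (HasCompactSupport.of_compactSpace _)
    induction hF using Submodule.span_induction with
    | mem F hF =>
      obtain ⟨n, rfl⟩ := hF
      by_cases hn : n = 0
      · subst hn; simp [UnitAddTorus.mFourier_zero]
      · rw [h n hn, integral_mFourier n hn]
    | zero => simp
    | add F G _ _ hF hG =>
      simp only [ContinuousMap.add_apply]
      rw [integral_add (hi ν F) (hi ν G), integral_add (hi _ F) (hi _ G), hF, hG]
    | smul c F _ hF =>
      simp only [ContinuousMap.coe_smul, Pi.smul_apply]
      rw [integral_smul, integral_smul, hF]
  refine ext_of_forall_integral_eq_of_IsFiniteMeasure fun f => ?_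
  have := key ⟨fun t => (f t : ℂ), by fun_prop⟩
  simp only [ContinuousMap.coe_mk] at this
  rw [integral_complex_ofReal, integral_complex_ofReal] at this
  exact_mod_cast this

/-- Since `∂_j e_{2πn} = 2πi n_j e_{2πn}`, the hypothesis with an index `j` such that `n_j ≠ 0`
kills the `n`-th Fourier coefficient. -/
theorem restrict_eq_volume_of_integral_pd {μ : Measure R3} (hμQ : μ Q = 1)
    (hμgrad : ∀ φ : R3 → ℂ, PerTest φ → ∀ j, ∫ y in Q, pd j φ y ∂μ = 0) :
    μ.restrict Q = volume.restrict Q := by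
  have hp : IsProbabilityMeasure (μ.restrict Q) := ⟨by simpa using hμQ⟩
  have hp' : IsProbabilityMeasure ((μ.restrict Q).map toTorus) :=
    Measure.isProbabilityMeasure_map measurable_toTorus.aemeasurable
  have : (μ.restrict Q).map toTorus = (volume : Measure Torus) := by
    refine torus_measure_eq_volume fun n hn => ?_
    rw [integral_map measurable_toTorus.aemeasurable
      (UnitAddTorus.mFourier n).continuous.aestronglyMeasurable]
    simp_rw [← pw_dual]
    obtain ⟨j, hj⟩ := Function.ne_iff.mp hn
    have h := hμgrad _ (perTest_pw n) j
    simp_rw [pd_pw] at h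
    rw [integral_const_mul] at h
    refine (mul_eq_zero.mp h).resolve_left ?_
    have hj' : (n j : ℂ) ≠ 0 := by exact_mod_cast hj
    simp [dual_apply, Real.pi_ne_zero, hj']
  rw [restrict_eq_map_ofTorus this, ← restrict_eq_map_ofTorus map_toTorus_volume]

/-! ### Decomposition of a periodic measure into cells -/

/-- A periodic measure is the sum of the translates of its restriction to the unit cell. -/
lemma PeriodicMeasure.eq_sum {μ : Measure R3} (h : PeriodicMeasure μ) :
    μ = Measure.sum fun n : Fin 3 → ℤ => (μ.restrict Q).map (fun x => x + latt n) := by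
  have hm : ∀ n : Fin 3 → ℤ, Measurable fun x : R3 => x + latt n := fun n => by fun_prop
  have hm' : ∀ n : Fin 3 → ℤ, Measurable fun x : R3 => x - latt n := fun n => by fun_prop
  have e : ∀ n : Fin 3 → ℤ, (μ.restrict Q).map (fun x => x + latt n)
      = μ.restrict ((fun x => x - latt n) ⁻¹' Q) := by
    intro n
    conv_rhs => rw [← h n]
    rw [Measure.restrict_map (hm n) (hm' n measurableSet_Q)]
    congr 2
    ext x; simp
  simp_rw [e]
  rw [← Measure.restrict_iUnion]
  · have : (⋃ n : Fin 3 → ℤ, (fun x : R3 => x - latt n) ⁻¹' Q) = Set.univ := by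
      refine Set.eq_univ_of_forall fun x => Set.mem_iUnion.mpr ⟨fun i => ⌊x i⌋, fun i => ?_⟩
      simp only [PiLp.sub_apply, latt_apply]
      exact ⟨Int.fract_nonneg _, Int.fract_lt_one _⟩
    rw [this, Measure.restrict_univ]
  · intro n m hnm
    refine Set.disjoint_left.mpr fun x hx hy => hnm ?_
    funext i
    have h1 := hx i
    have h2 := hy i
    simp only [PiLp.sub_apply, latt_apply] at h1 h2
    have e1 : ⌊x i⌋ = n i := Int.floor_eq_iff.mpr ⟨by linarith, by linarith⟩
    have e2 : ⌊x i⌋ = m i := Int.floor_eq_iff.mpr ⟨by linarith, by linarith⟩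
    rw [← e1, e2]
  · exact fun n => hm' n measurableSet_Q

lemma periodicMeasure_volume : PeriodicMeasure (volume : Measure R3) := fun n =>
  map_add_right_eq_self volume (latt n)

theorem eq_volume_of_integral_pd {μ : Measure R3} (hμper : PeriodicMeasure μ) (hμQ : μ Q = 1)
    (hμgrad : ∀ φ : R3 → ℂ, PerTest φ → ∀ j, ∫ y in Q, pd j φ y ∂μ = 0) : μ = volume := by
  rw [hμper.eq_sum, restrict_eq_volume_of_integral_pd hμQ hμgrad, ← periodicMeasure_volume.eq_sum]

lemma scaled_volume {ε : ℝ} (hε : 0 < ε) : scaled (volume : Measure R3) ε = volume := by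
  have h := Measure.map_addHaar_smul (volume : Measure R3) hε.ne'
  rw [scaled, show (fun x : R3 => ε • x) = (ε • ·) from rfl, h, smul_smul,
    ← ENNReal.ofReal_mul (by positivity)]
  simp only [finrank_euclideanSpace, Fintype.card_fin]
  rw [abs_of_pos (by positivity), mul_inv_cancel₀ (by positivity)]
  simp

/-! ### Fourier series of square integrable fields on the unit cell -/

/-- Lebesgue measure on the unit cell. -/
abbrev volQ : Measure R3 := volume.restrict Q

instance isProbabilityMeasure_volQ : IsProbabilityMeasure volQ := by
  refine ⟨?_⟩
  have h := congrArg (fun ν => ν Set.univ) map_toTorus_volume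
  simp only [Measure.map_apply measurable_toTorus MeasurableSet.univ, Set.preimage_univ] at h
  rw [h, measure_univ]

/-- The Hilbert space of square integrable fields on the unit cell. -/
abbrev L2Q := Lp C3 2 volQ

/-- Fourier coefficient of a function on the unit cell. -/
def fc {E : Type*} [NormedAddCommGroup E] [NormedSpace ℂ E] (f : R3 → E) (n : Fin 3 → ℤ) : E :=
  ∫ y in Q, starRingEnd ℂ (pw (dual n) y) • f y

lemma integral_pw_dual (n : Fin 3 → ℤ) : ∫ y in Q, pw (dual n) y = if n = 0 then 1 else 0 := by
  split_ifs with h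
  · subst h
    have : dual (0 : Fin 3 → ℤ) = 0 := by ext i; simp [dual_apply]
    simp [this]
  · rw [← integral_mFourier n h, ← map_toTorus_volume, integral_map
      measurable_toTorus.aemeasurable (UnitAddTorus.mFourier n).continuous.aestronglyMeasurable]
    simp_rw [pw_dual]

lemma dual_sub (n m : Fin 3 → ℤ) : dual n - dual m = dual (n - m) := by
  ext i; simp [dual_apply]; ring

lemma fc_pw (m n : Fin 3 → ℤ) : fc (pw (dual m)) n = if n = m then 1 else 0 := by
  have : ∀ y, starRingEnd ℂ (pw (dual n) y) • pw (dual m) y = pw (dual (m - n)) y := by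
    intro y
    rw [← dual_sub, sub_eq_neg_add, pw_add_left, pw_neg_left, smul_eq_mul]
  simp only [fc, this, integral_pw_dual, sub_eq_zero, eq_comm]

/-- Completeness of the exponentials, transported from the torus. A measurable representative is
needed to carry the almost everywhere statement back through `ofTorus`. -/
lemma ae_eq_zero_of_fc_eq_zero {f : R3 → ℂ} (hf : MemLp f 2 volQ) (h : ∀ n, fc f n = 0) :
    f =ᵐ[volQ] 0 := by
  have hg : MemLp (fun t => f (ofTorus t)) 2 (volume : Measure Torus) :=
    hf.comp_measurePreserving measurePreserving_ofTorus
  have h0 : hg.toLp _ = 0 := by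
    apply UnitAddTorus.mFourierBasis.repr.injective
    rw [map_zero]
    ext n
    rw [UnitAddTorus.mFourierBasis_repr]
    rw [UnitAddTorus.mFourierCoeff]
    have e := h n
    rw [fc, ← measurePreserving_ofTorus.map_eq, integral_map] at e
    · simp only [lp.coeFn_zero, Pi.zero_apply]
      rw [← e]
      refine integral_congr_ae ?_
      filter_upwards [hg.coeFn_toLp] with t ht
      rw [ht, pw_dual, toTorus_ofTorus, UnitAddTorus.mFourier_neg]
    · exact measurable_ofTorus.aemeasurable
    · rw [measurePreserving_ofTorus.map_eq]
      exact ((Complex.continuous_conj.comp (continuous_pw _)).aestronglyMeasurable).smul hf.1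
  have h1 := (Lp.eq_zero_iff_ae_eq_zero.mp h0)
  have h2 : (fun t => f (ofTorus t)) =ᵐ[volume] 0 := hg.coeFn_toLp.symm.trans h1
  have hq := hf.1.ae_eq_mk
  have h3 : (fun t => hf.1.mk f (ofTorus t)) =ᵐ[volume] 0 :=
    (measurePreserving_ofTorus.quasiMeasurePreserving.ae_eq_comp hq).symm.trans h2
  have h4 : hf.1.mk f =ᵐ[(volume : Measure Torus).map ofTorus] 0 :=
    (ae_map_iff measurable_ofTorus.aemeasurable
      (hf.1.stronglyMeasurable_mk.measurable (measurableSet_singleton 0))).mpr h3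
  rw [measurePreserving_ofTorus.map_eq] at h4
  exact hq.trans h4

end TorusMeasure

/-! ### Multiplication operators on square integrable fields -/

lemma cdot_eq_inner (a b : C3) : cdot a b = inner ℂ b a := by
  simp [cdot, PiLp.inner_apply, RCLike.inner_apply]

lemma app_apply (M : CMat) (v : C3) (i : Fin 3) : app M v i = ∑ j, M i j * v j := rfl

lemma app_add (M : CMat) (v w : C3) : app M (v + w) = app M v + app M w := by
  ext i; simp [app_apply, mul_add, Finset.sum_add_distrib]

lemma app_smul (M : CMat) (c : ℂ) (v : C3) : app M (c • v) = c • app M v := by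
  ext i; simp [app_apply, Finset.mul_sum, mul_left_comm]

lemma app_sub (M : CMat) (v w : C3) : app M (v - w) = app M v - app M w := by
  ext i; simp [app_apply, mul_sub, Finset.sum_sub_distrib]

lemma app_mul (M N : CMat) (v : C3) : app (M * N) v = app M (app N v) := by
  simp [app, Matrix.mulVec_mulVec]

@[simp] lemma app_one (v : C3) : app 1 v = v := by
  simp [app]

lemma app_add_left (M N : CMat) (v : C3) : app (M + N) v = app M v + app N v := by
  ext i; simp [app_apply, add_mul, Finset.sum_add_distrib]

/-- `M` has measurable entries and is bounded by `C`. -/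
structure IsBddMat (M : R3 → CMat) (C : ℝ) : Prop where
  meas : ∀ i j, Measurable fun y => M y i j
  nonneg : 0 ≤ C
  bound : ∀ y v, ‖app (M y) v‖ ≤ C * ‖v‖

section mulOp

variable {M : R3 → CMat} {C : ℝ} {ν : Measure R3} {f g : R3 → C3}

lemma aestronglyMeasurable_app (hM : ∀ i j, AEMeasurable (fun y => M y i j) ν)
    (hf : AEStronglyMeasurable f ν) :
    AEStronglyMeasurable (fun y => app (M y) (f y)) ν := by
  have h : AEMeasurable (fun y => app (M y) (f y)) ν := by
    refine (WithLp.measurable_toLp 2 (Fin 3 → ℂ)).comp_aemeasurable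
      (aemeasurable_pi_lambda _ fun i => ?_)
    change AEMeasurable (fun y => ∑ j, M y i j * f y j) ν
    refine Finset.aemeasurable_fun_sum _ fun j _ => (hM i j).mul ?_
    exact (EuclideanSpace.proj j : C3 →L[ℂ] ℂ).measurable.comp_aemeasurable hf.aemeasurable
  exact h.aestronglyMeasurable

lemma IsBddMat.memLp (hM : IsBddMat M C) (hf : MemLp f 2 ν) : MemLp (fun y => app (M y) (f y)) 2 ν :=
  hf.of_le_mul (aestronglyMeasurable_app (fun i j => (hM.meas i j).aemeasurable) hf.1)
    (Eventually.of_forall fun y => hM.bound y (f y))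

lemma IsBddMat.eLpNorm_le (hM : IsBddMat M C) (f : R3 → C3) :
    eLpNorm (fun y => app (M y) (f y)) 2 ν ≤ ENNReal.ofReal C * eLpNorm f 2 ν :=
  eLpNorm_le_mul_eLpNorm_of_ae_le_mul (Eventually.of_forall fun y => hM.bound y (f y)) 2

/-- Multiplication by a bounded matrix field. -/
def mulOp (hM : IsBddMat M C) (ν : Measure R3) : Lp C3 2 ν →L[ℂ] Lp C3 2 ν :=
  LinearMap.mkContinuous
    { toFun := fun f => (hM.memLp (Lp.memLp f)).toLp _
      map_add' := fun f g => by
        rw [← MemLp.toLp_add]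
        refine MemLp.toLp_congr _ _ ?_
        filter_upwards [Lp.coeFn_add f g] with y hy
        rw [hy, Pi.add_apply, app_add]
        rfl
      map_smul' := fun c f => by
        rw [RingHom.id_apply, ← MemLp.toLp_const_smul]
        refine MemLp.toLp_congr _ _ ?_
        filter_upwards [Lp.coeFn_smul c f] with y hy
        rw [hy, Pi.smul_apply, app_smul]
        rfl }
    C fun f => by
      refine Lp.norm_le_mul_norm_of_ae_le_mul ?_
      filter_upwards [MemLp.coeFn_toLp (hM.memLp (Lp.memLp f))] with y hy
      simpa only [LinearMap.coe_mk, AddHom.coe_mk, hy] using hM.bound y _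

lemma coeFn_mulOp (hM : IsBddMat M C) (f : Lp C3 2 ν) : mulOp hM ν f =ᵐ[ν] fun y => app (M y) (f y) :=
  MemLp.coeFn_toLp (hM.memLp (Lp.memLp f))

lemma mulOp_toLp (hM : IsBddMat M C) (hf : MemLp f 2 ν) : mulOp hM ν (hf.toLp f) = (hM.memLp hf).toLp _ := by
  refine MemLp.toLp_congr (hM.memLp (Lp.memLp _)) (hM.memLp hf) ?_
  filter_upwards [hf.coeFn_toLp] with y hy
  rw [hy]

lemma norm_mulOp_le (hM : IsBddMat M C) (f : Lp C3 2 ν) : ‖mulOp hM ν f‖ ≤ C * ‖f‖ :=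
  (mulOp hM ν).le_of_opNorm_le (LinearMap.mkContinuous_norm_le _ hM.nonneg _) f

lemma mulOp_coercive (hM : IsBddMat M C) {c : ℝ} (hc : ∀ y v, c * ‖v‖ ^ 2 ≤ (inner ℂ v (app (M y) v)).re)
    (f : Lp C3 2 ν) : c * ‖f‖ ^ 2 ≤ (inner ℂ f (mulOp hM ν f)).re := by
  have h1 : ‖f‖ ^ 2 = ∫ y, ‖f y‖ ^ 2 ∂ν := by
    have := congrArg Complex.re (inner_self_eq_norm_sq_to_K (𝕜 := ℂ) f)
    rw [L2.inner_def] at this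
    have e : (∫ y, inner ℂ (f y) (f y) ∂ν) = ((∫ y, ‖f y‖ ^ 2 ∂ν : ℝ) : ℂ) := by
      rw [← integral_complex_ofReal]
      refine integral_congr_ae (Eventually.of_forall fun y => ?_)
      simp [inner_self_eq_norm_sq_to_K]
    rw [e] at this
    have e2 : (((‖f‖ : ℝ) : ℂ) ^ 2).re = ‖f‖ ^ 2 := by
      rw [← Complex.ofReal_pow, Complex.ofReal_re]
    exact (e2.symm.trans this.symm).trans (Complex.ofReal_re _)
  have hi := L2.integrable_inner (𝕜 := ℂ) f (mulOp hM ν f)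
  rw [h1, ← integral_const_mul, L2.inner_def]
  rw [show (∫ y, inner ℂ (f y) (mulOp hM ν f y) ∂ν).re
    = ∫ y, (inner ℂ (f y) (mulOp hM ν f y)).re ∂ν from (integral_re hi).symm]
  refine integral_mono_ae ?_ hi.re ?_
  · exact ((memLp_two_iff_integrable_sq_norm (Lp.aestronglyMeasurable f)).mp
      (Lp.memLp f)).const_mul c
  · filter_upwards [coeFn_mulOp hM f] with y hy
    simpa only [hy] using hc y (f y)

lemma mulOp_symm (hM : IsBddMat M C) (hs : ∀ y v w, inner ℂ (app (M y) v) w = inner ℂ v (app (M y) w))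
    (f g : Lp C3 2 ν) : inner ℂ (mulOp hM ν f) g = inner ℂ f (mulOp hM ν g) := by
  rw [L2.inner_def, L2.inner_def]
  refine integral_congr_ae ?_
  filter_upwards [coeFn_mulOp hM f, coeFn_mulOp hM g] with y h1 h2
  rw [h1, h2, hs]

end mulOp


/-! ### Fourier coefficients as bounded functionals -/

lemma memLp_pw_smul (θ : R3) (v : C3) : MemLp (fun y => pw θ y • v) 2 volQ :=
  MemLp.of_bound ((continuous_pw θ).smul continuous_const).aestronglyMeasurable ‖v‖
    (Eventually.of_forall fun y => by rw [norm_smul, norm_pw, one_mul])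

/-- The exponential fields `e_{2πn} v`. -/
def ev (n : Fin 3 → ℤ) (v : C3) : L2Q := (memLp_pw_smul (dual n) v).toLp _

lemma inner_single_left' (i : Fin 3) (v : C3) :
    inner ℂ (EuclideanSpace.single i (1 : ℂ)) v = v i := by
  simp [EuclideanSpace.inner_single_left]

lemma MemLp.integrable_conj_pw_smul {E : Type*} [NormedAddCommGroup E] [NormedSpace ℂ E]
    {f : R3 → E} (hf : MemLp f 2 volQ) (θ : R3) :
    Integrable (fun y => starRingEnd ℂ (pw θ y) • f y) volQ := by
  refine (hf.integrable (by norm_num)).bdd_smul 1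
    ((Complex.continuous_conj.comp (continuous_pw _)).aestronglyMeasurable)
    (Eventually.of_forall fun y => ?_)
  simp

lemma inner_ev (n : Fin 3 → ℤ) (v : C3) (f : L2Q) :
    inner ℂ (ev n v) f = inner ℂ v (fc f n) := by
  rw [L2.inner_def, fc, ← integral_inner (MemLp.integrable_conj_pw_smul (Lp.memLp f) _)]
  refine integral_congr_ae ?_
  filter_upwards [(memLp_pw_smul (dual n) v).coeFn_toLp] with y hy
  rw [ev, hy, inner_smul_left, inner_smul_right]

lemma fc_congr {E : Type*} [NormedAddCommGroup E] [NormedSpace ℂ E] {f g : R3 → E}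
    (h : f =ᵐ[volQ] g) (n : Fin 3 → ℤ) : fc f n = fc g n := by
  refine integral_congr_ae ?_
  filter_upwards [h] with y hy
  rw [hy]

lemma fc_pw_smul (m n : Fin 3 → ℤ) (v : C3) :
    fc (fun y => pw (dual m) y • v) n = if n = m then v else 0 := by
  have := fc_pw m n
  rw [fc] at this ⊢
  simp_rw [smul_smul]
  rw [integral_smul_const]
  simp only [smul_eq_mul] at this
  rw [this]
  split_ifs <;> simp

lemma fc_ev (m n : Fin 3 → ℤ) (v : C3) : fc (ev m v) n = if n = m then v else 0 := by
  rw [← fc_pw_smul, ev]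
  exact fc_congr (MemLp.coeFn_toLp _) n

lemma fc_apply {f : R3 → C3} (hf : MemLp f 2 volQ) (n : Fin 3 → ℤ) (i : Fin 3) :
    fc f n i = fc (fun y => f y i) n := by
  have := (EuclideanSpace.proj i : C3 →L[ℂ] ℂ).integral_comp_comm
    (MemLp.integrable_conj_pw_smul hf (dual n))
  simpa [fc] using this.symm

/-- The Hilbert basis of exponential fields. -/
def expBasis : HilbertBasis ((Fin 3 → ℤ) × Fin 3) ℂ L2Q :=
  HilbertBasis.mkOfOrthogonalEqBot (v := fun p => ev p.1 (EuclideanSpace.single p.2 1))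
    (by
      rw [orthonormal_iff_ite]
      rintro ⟨n, i⟩ ⟨m, j⟩
      rw [inner_ev, fc_ev, inner_single_left']
      by_cases h : n = m
      · subst h
        simp
      · simp [h])
    (by
      rw [Submodule.eq_bot_iff]
      intro f hf
      have h0 : ∀ n i, fc f n i = 0 := by
        intro n i
        rw [← inner_single_left', ← inner_ev]
        exact (Submodule.mem_orthogonal _ _).mp hf _ (Submodule.subset_span ⟨(n, i), rfl⟩)
      rw [Lp.eq_zero_iff_ae_eq_zero]
      have h1 : ∀ i, (fun y => f y i) =ᵐ[volQ] 0 := by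
        intro i
        refine ae_eq_zero_of_fc_eq_zero
          ((Lp.memLp f).continuousLinearMap_comp (EuclideanSpace.proj i : C3 →L[ℂ] ℂ)) fun n => ?_
        rw [← fc_apply (Lp.memLp f), h0]
      filter_upwards [ae_all_iff.mpr h1] with y hy
      ext i
      exact hy i)

lemma expBasis_apply (p : (Fin 3 → ℤ) × Fin 3) :
    expBasis p = ev p.1 (EuclideanSpace.single p.2 1) := by
  simp [expBasis]

/-- The `n`-th Fourier coefficient. -/
def cf (n : Fin 3 → ℤ) : L2Q →L[ℂ] C3 :=
  ((EuclideanSpace.equiv (Fin 3) ℂ).symm : (Fin 3 → ℂ) →L[ℂ] C3).comp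
    (ContinuousLinearMap.pi fun i => innerSL ℂ (expBasis (n, i)))

lemma cf_eq_fc (n : Fin 3 → ℤ) (f : L2Q) : cf n f = fc f n := by
  ext i
  rw [← inner_single_left' i (fc f n), ← inner_ev, ← expBasis_apply (n, i)]
  rfl

lemma cf_apply (n : Fin 3 → ℤ) (f : L2Q) (i : Fin 3) : cf n f i = inner ℂ (expBasis (n, i)) f :=
  rfl

lemma cf_toLp (n : Fin 3 → ℤ) {f : R3 → C3} (hf : MemLp f 2 volQ) : cf n (hf.toLp f) = fc f n := by
  rw [cf_eq_fc]
  exact fc_congr hf.coeFn_toLp n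

lemma cf_ev (m n : Fin 3 → ℤ) (v : C3) : cf n (ev m v) = if n = m then v else 0 := by
  rw [cf_eq_fc, fc_ev]

lemma inner_ev_left (n : Fin 3 → ℤ) (v : C3) (f : L2Q) :
    inner ℂ (ev n v) f = inner ℂ v (cf n f) := by
  rw [inner_ev, cf_eq_fc]

lemma inner_ev_right (n : Fin 3 → ℤ) (v : C3) (f : L2Q) :
    inner ℂ f (ev n v) = inner ℂ (cf n f) v := by
  rw [← inner_conj_symm, inner_ev_left, inner_conj_symm]

/-- Parseval's identity. -/
lemma hasSum_inner_cf (f g : L2Q) :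
    HasSum (fun n => inner ℂ (cf n f) (cf n g)) (inner ℂ f g) := by
  refine (expBasis.hasSum_inner_mul_inner f g).prod_fiberwise fun n => ?_
  have : inner ℂ (cf n f) (cf n g)
      = ∑ i, inner ℂ f (expBasis (n, i)) * inner ℂ (expBasis (n, i)) g := by
    simp only [PiLp.inner_apply, RCLike.inner_apply, cf_apply, inner_conj_symm]
    exact Finset.sum_congr rfl fun i _ => mul_comm _ _
  rw [this]
  exact hasSum_fintype _

lemma hasSum_norm_sq_cf (f : L2Q) : HasSum (fun n => ‖cf n f‖ ^ 2) (‖f‖ ^ 2) := by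
  have h := hasSum_inner_cf f f
  simp only [inner_self_eq_norm_sq_to_K] at h
  refine Complex.hasSum_ofReal.mp ?_
  push_cast
  exact h

lemma summable_norm_sq_cf (f : L2Q) : Summable fun n => ‖cf n f‖ ^ 2 :=
  (hasSum_norm_sq_cf f).summable

lemma norm_cf_le (n : Fin 3 → ℤ) (f : L2Q) : ‖cf n f‖ ≤ ‖f‖ := by
  have := (hasSum_norm_sq_cf f).summable.le_tsum n fun _ _ => by positivity
  rw [(hasSum_norm_sq_cf f).tsum_eq] at this
  exact abs_le_of_sq_le_sq' this (norm_nonneg _) |>.2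

/-- The Riesz-Fischer theorem. -/
lemma exists_cf_eq {a : (Fin 3 → ℤ) → C3} (h : Summable fun n => ‖a n‖ ^ 2) :
    ∃ f : L2Q, ∀ n, cf n f = a n := by
  have hs : Summable fun p : (Fin 3 → ℤ) × Fin 3 => ‖a p.1 p.2‖ ^ 2 := by
    rw [summable_prod_of_nonneg (fun _ => by positivity)]
    refine ⟨fun n => Summable.of_finite, ?_⟩
    refine h.congr fun n => ?_
    rw [tsum_fintype, EuclideanSpace.norm_sq_eq]
  have hm : Memℓp (fun p : (Fin 3 → ℤ) × Fin 3 => a p.1 p.2) 2 := by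
    refine memℓp_gen ?_
    simpa using hs
  refine ⟨expBasis.repr.symm ⟨_, hm⟩, fun n => ?_⟩
  ext i
  rw [cf_apply, ← HilbertBasis.repr_apply_apply, LinearIsometryEquiv.apply_symm_apply]

lemma ext_cf {f g : L2Q} (h : ∀ n, cf n f = cf n g) : f = g := by
  have := hasSum_norm_sq_cf (f - g)
  simp only [map_sub, h, sub_self, norm_zero, ne_eq, OfNat.ofNat_ne_zero, not_false_eq_true,
    zero_pow] at this
  have h2 := this.unique hasSum_zero
  rw [← sub_eq_zero, ← norm_eq_zero]
  simpa using h2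

/-! ### Coercive variational problems -/

/-- Lax-Milgram on a closed subspace. -/
lemma exists_mem_forall_inner_eq_zero {H : Type*} [NormedAddCommGroup H] [InnerProductSpace ℂ H]
    [CompleteSpace H] (T : H →L[ℂ] H) {c : ℝ} (hc : 0 < c)
    (hT : ∀ x, c * ‖x‖ ^ 2 ≤ (inner ℂ x (T x)).re) (K : Submodule ℂ H) (hK : IsClosed (K : Set H))
    (f : H) : ∃ x ∈ K, ∀ k ∈ K, inner ℂ k (T x - f) = 0 := by
  have : CompleteSpace K := hK.completeSpace_coe
  let S : K →L[ℂ] K := K.orthogonalProjectionOnto.comp (T.comp K.subtypeL)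
  have hS : ∀ x y : K, inner ℂ x (S y) = inner ℂ (x : H) (T y) := fun x y => by
    simp [S]
  have hu : IsUnit S := by
    refine ContinuousLinearMap.isUnit_of_forall_le_norm_inner_map S (c := ⟨c, hc.le⟩) hc fun x => ?_
    rw [norm_inner_symm, hS]
    refine le_trans ?_ (Complex.re_le_norm _)
    rw [mul_comm]
    exact hT x
  obtain ⟨x, hx⟩ := (ContinuousLinearMap.isUnit_iff_bijective.mp hu).2 (K.orthogonalProjectionOnto f)
  refine ⟨x, x.2, fun k hk => ?_⟩
  have h1 := hS ⟨k, hk⟩ x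
  rw [hx] at h1
  rw [inner_sub_right, sub_eq_zero]
  simpa using h1.symm

/-! ### The symbol of the curl -/

/-- The vector `ik × v`. -/
def crI (k : R3) (v : C3) : C3 := app (crossI k) v

lemma crI_apply (k : R3) (v : C3) : crI k v = WithLp.toLp 2
    ![Complex.I * (k 1 * v 2 - k 2 * v 1), Complex.I * (k 2 * v 0 - k 0 * v 2),
      Complex.I * (k 0 * v 1 - k 1 * v 0)] := by
  rw [crI, app, crossI, LinearMap.toMatrix'_mulVec, cross_apply]
  congr 1
  funext i
  fin_cases i <;> simp <;> ring

lemma crI_add (k : R3) (v w : C3) : crI k (v + w) = crI k v + crI k w := app_add _ _ _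

lemma crI_sub (k : R3) (v w : C3) : crI k (v - w) = crI k v - crI k w := app_sub _ _ _

lemma crI_smul (k : R3) (c : ℂ) (v : C3) : crI k (c • v) = c • crI k v := app_smul _ _ _

@[simp] lemma crI_zero (k : R3) : crI k 0 = 0 := by
  simpa using crI_smul k 0 0

lemma crI_add_left (k l : R3) (v : C3) : crI (k + l) v = crI k v + crI l v := by
  simp only [crI_apply]
  ext i
  fin_cases i <;> simp <;> ring

lemma crI_smul_left (r : ℝ) (k : R3) (v : C3) : crI (r • k) v = (r : ℂ) • crI k v := by
  simp only [crI_apply]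
  ext i
  fin_cases i <;> simp <;> ring

lemma inner_C3 (a b : C3) : inner ℂ a b = starRingEnd ℂ (a 0) * b 0 + starRingEnd ℂ (a 1) * b 1
    + starRingEnd ℂ (a 2) * b 2 := by
  simp [PiLp.inner_apply, Fin.sum_univ_three, mul_comm]

/-- The real cross product with `k` is skew; the factor `i` makes it self-adjoint, as befits the
symbol of curl. -/
lemma inner_crI (k : R3) (a b : C3) : inner ℂ (crI k a) b = inner ℂ a (crI k b) := by
  simp only [inner_C3, crI_apply]
  simp
  ring

lemma cv_apply (k : R3) (i : Fin 3) : cv k i = k i := rfl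

lemma cv_add (k l : R3) : cv (k + l) = cv k + cv l := by
  ext i; simp [cv_apply]

lemma cv_smul (r : ℝ) (k : R3) : cv (r • k) = (r : ℂ) • cv k := by
  ext i; simp [cv_apply]

@[simp] lemma cv_zero : cv 0 = 0 := by
  ext i; simp [cv_apply]

lemma norm_cv (k : R3) : ‖cv k‖ = ‖k‖ := by
  simp [EuclideanSpace.norm_eq, cv_apply]

@[simp] lemma crI_cv (k : R3) : crI k (cv k) = 0 := by
  simp only [crI_apply, cv_apply]
  ext i
  fin_cases i <;> simp <;> ring

@[simp] lemma inner_cv_crI (k : R3) (v : C3) : inner ℂ (cv k) (crI k v) = 0 := by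
  rw [← inner_crI, crI_cv, inner_zero_left]

/-- The symbol form of `curl curl = ∇ div - Δ`, up to the usual signs. -/
lemma crI_crI (k : R3) (v : C3) :
    crI k (crI k v) = ((‖k‖ ^ 2 : ℝ) : ℂ) • v - inner ℂ (cv k) v • cv k := by
  simp only [crI_apply, EuclideanSpace.norm_sq_eq, inner_C3, Fin.sum_univ_three, cv_apply]
  have h : Complex.I * Complex.I = -1 := Complex.I_mul_I
  ext i
  fin_cases i <;> simp [cv_apply] <;> ring_nf <;> simp <;> ring

lemma norm_crI_sq (k : R3) (v : C3) :
    ‖crI k v‖ ^ 2 = ‖k‖ ^ 2 * ‖v‖ ^ 2 - ‖inner ℂ (cv k) v‖ ^ 2 := by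
  have h : inner ℂ (crI k v) (crI k v) = inner ℂ v (crI k (crI k v)) := inner_crI _ _ _
  rw [crI_crI, inner_sub_right, inner_smul_right, inner_smul_right, inner_self_eq_norm_sq_to_K,
    inner_self_eq_norm_sq_to_K, ← inner_conj_symm v (cv k), Complex.mul_conj,
    Complex.normSq_eq_norm_sq] at h
  apply Complex.ofReal_injective
  push_cast at h ⊢
  exact h

lemma norm_crI_le (k : R3) (v : C3) : ‖crI k v‖ ≤ ‖k‖ * ‖v‖ := by
  refine abs_le_of_sq_le_sq' ?_ (by positivity) |>.2
  rw [norm_crI_sq, mul_pow]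
  linarith [sq_nonneg ‖inner ℂ (cv k) v‖]

/-- `a` is parallel to `k`. -/
def Par (k : R3) (a : C3) : Prop := ∃ s : ℂ, a = s • cv k

lemma Par.crI_eq {k : R3} {a : C3} (h : Par k a) : crI k a = 0 := by
  obtain ⟨s, rfl⟩ := h
  rw [crI_smul, crI_cv, smul_zero]

/-- The case `k = 0` is excluded because `crI 0` kills everything while only `0` satisfies `Par 0`.
This asymmetry is why zeroth modes are treated separately throughout. -/
lemma par_of_crI_eq {k : R3} (hk : k ≠ 0) {a : C3} (h : crI k a = 0) : Par k a := by
  have h2 := crI_crI k a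
  rw [h, crI_zero, eq_comm, sub_eq_zero] at h2
  have hk' : ((‖k‖ ^ 2 : ℝ) : ℂ) ≠ 0 := by
    simpa using hk
  refine ⟨((‖k‖ ^ 2 : ℝ) : ℂ)⁻¹ * inner ℂ (cv k) a, ?_⟩
  rw [mul_smul, ← h2, smul_smul, inv_mul_cancel₀ hk', one_smul]

lemma Par.inner_eq {k : R3} {a b : C3} (h : Par k a) (hb : inner ℂ (cv k) b = 0) :
    inner ℂ a b = 0 := by
  obtain ⟨s, rfl⟩ := h
  rw [inner_smul_left, hb, mul_zero]

lemma Par.inner_eq' {k : R3} {a b : C3} (h : Par k a) (hb : inner ℂ (cv k) b = 0) :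
    inner ℂ b a = 0 := by
  rw [← inner_conj_symm, h.inner_eq hb, map_zero]

lemma Par.add {k : R3} {a b : C3} (ha : Par k a) (hb : Par k b) : Par k (a + b) := by
  obtain ⟨s, rfl⟩ := ha
  obtain ⟨t, rfl⟩ := hb
  exact ⟨s + t, (add_smul _ _ _).symm⟩

lemma Par.smul {k : R3} {a : C3} (c : ℂ) (ha : Par k a) : Par k (c • a) := by
  obtain ⟨s, rfl⟩ := ha
  exact ⟨c * s, (mul_smul _ _ _).symm⟩

lemma Par.sub {k : R3} {a b : C3} (ha : Par k a) (hb : Par k b) : Par k (a - b) := by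
  obtain ⟨s, rfl⟩ := ha
  obtain ⟨t, rfl⟩ := hb
  exact ⟨s - t, (sub_smul _ _ _).symm⟩

lemma par_zero (k : R3) : Par k 0 := ⟨0, (zero_smul _ _).symm⟩

lemma isClosed_par (k : R3) : IsClosed {a | Par k a} := by
  have : {a | Par k a} = ((Submodule.span ℂ {cv k} : Submodule ℂ C3) : Set C3) := by
    ext a
    simp only [Set.mem_ofPred_eq, SetLike.mem_coe, Submodule.mem_span_singleton, Par, eq_comm]
  rw [this]
  exact Submodule.closed_of_finiteDimensional _

/-- A field of divergence-free type is paired with `v` only through the curl of `v`. -/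
lemma norm_mul_norm_inner_le {k : R3} {q : C3} (hq : inner ℂ (cv k) q = 0) (v : C3) :
    ‖k‖ * ‖(inner ℂ v q : ℂ)‖ ≤ ‖q‖ * ‖crI k v‖ := by
  rcases eq_or_ne k 0 with rfl | hk
  · simp; positivity
  have h : inner ℂ (crI k v) (crI k q) = ((‖k‖ ^ 2 : ℝ) : ℂ) * inner ℂ v q := by
    rw [inner_crI, crI_crI, hq, zero_smul, sub_zero, inner_smul_right]
  have h1 : ‖k‖ ^ 2 * ‖(inner ℂ v q : ℂ)‖ ≤ ‖crI k v‖ * (‖k‖ * ‖q‖) := by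
    have := norm_inner_le_norm (𝕜 := ℂ) (crI k v) (crI k q)
    rw [h, norm_mul, Complex.norm_real, Real.norm_of_nonneg (by positivity)] at this
    exact this.trans (by gcongr; exact norm_crI_le k q)
  have hk' : 0 < ‖k‖ := norm_pos_iff.mpr hk
  refine le_of_mul_le_mul_left ?_ hk'
  calc ‖k‖ * (‖k‖ * ‖(inner ℂ v q : ℂ)‖) = ‖k‖ ^ 2 * ‖(inner ℂ v q : ℂ)‖ := by ring
    _ ≤ _ := h1
    _ = _ := by ring

/-! ### Modewise estimates -/

lemma dual_zero : dual 0 = 0 := by ext i; simp [dual_apply]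

lemma one_le_norm_dual {n : Fin 3 → ℤ} (hn : n ≠ 0) : 1 ≤ ‖dual n‖ := by
  obtain ⟨j, hj⟩ := Function.ne_iff.mp hn
  have h1 : (1 : ℝ) ≤ |(n j : ℝ)| := by exact_mod_cast Int.one_le_abs hj
  have h2 := PiLp.norm_apply_le (dual n) j
  rw [dual_apply, Real.norm_eq_abs, abs_mul, abs_of_pos Real.two_pi_pos] at h2
  nlinarith [Real.pi_gt_three]

lemma dual_ne_zero {n : Fin 3 → ℤ} (hn : n ≠ 0) : dual n ≠ 0 := fun h => by
  have := one_le_norm_dual hn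
  rw [h, norm_zero] at this
  linarith

lemma norm_le_of_cf_le {x f : L2Q} {C : ℝ} (hC : 0 ≤ C) (h : ∀ n, ‖cf n x‖ ≤ C * ‖cf n f‖) :
    ‖x‖ ≤ C * ‖f‖ := by
  refine abs_le_of_sq_le_sq' ?_ (by positivity) |>.2
  rw [mul_pow]
  refine hasSum_le (fun n => ?_) (hasSum_norm_sq_cf x) ((hasSum_norm_sq_cf f).mul_left (C ^ 2))
  rw [← mul_pow]
  exact pow_le_pow_left₀ (norm_nonneg _) (h n) 2

lemma exists_cf_of_le (a : (Fin 3 → ℤ) → C3) (f : L2Q) {C : ℝ} (hC : 0 ≤ C)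
    (h : ∀ n, ‖a n‖ ≤ C * ‖cf n f‖) : ∃ x : L2Q, (∀ n, cf n x = a n) ∧ ‖x‖ ≤ C * ‖f‖ := by
  have hs : Summable fun n => ‖a n‖ ^ 2 := by
    refine Summable.of_nonneg_of_le (fun _ => by positivity) (fun n => ?_)
      ((summable_norm_sq_cf f).mul_left (C ^ 2))
    rw [← mul_pow]
    exact pow_le_pow_left₀ (norm_nonneg _) (h n) 2
  obtain ⟨x, hx⟩ := exists_cf_eq hs
  exact ⟨x, hx, norm_le_of_cf_le hC fun n => by rw [hx]; exact h n⟩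

/-- Cauchy–Schwarz for the sequences of norms. These are realised as Fourier coefficients of two
fields `X`, `Y` along one fixed unit vector, so that the inequality in `L2Q` can be used. -/
lemma norm_inner_le_of_cf {x y x' y' : L2Q} {C : ℝ} (hC : 0 ≤ C)
    (h : ∀ n, ‖(inner ℂ (cf n x) (cf n y) : ℂ)‖ ≤ C * (‖cf n x'‖ * ‖cf n y'‖)) :
    ‖(inner ℂ x y : ℂ)‖ ≤ C * (‖x'‖ * ‖y'‖) := by
  let e : C3 := EuclideanSpace.single 0 1
  have he : ‖e‖ = 1 := by simp [e]
  obtain ⟨X, hX, hX'⟩ := exists_cf_of_le (fun n => (‖cf n x'‖ : ℂ) • e) x' zero_le_one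
    (fun n => by simp [norm_smul, he])
  obtain ⟨Y, hY, hY'⟩ := exists_cf_of_le (fun n => (‖cf n y'‖ : ℂ) • e) y' zero_le_one
    (fun n => by simp [norm_smul, he])
  rw [one_mul] at hX' hY'
  have h1 := Complex.hasSum_re (hasSum_inner_cf X Y)
  have e1 : ∀ n, (inner ℂ (cf n X) (cf n Y)).re = ‖cf n x'‖ * ‖cf n y'‖ := by
    intro n
    rw [hX, hY, inner_smul_left, inner_smul_right, inner_self_eq_norm_sq_to_K, he]
    simp
  simp_rw [e1] at h1
  have h2 := tsum_of_norm_bounded (h1.mul_left C) h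
  rw [(hasSum_inner_cf x y).tsum_eq] at h2
  refine h2.trans (mul_le_mul_of_nonneg_left ?_ hC)
  calc (inner ℂ X Y).re ≤ ‖(inner ℂ X Y : ℂ)‖ := Complex.re_le_norm _
    _ ≤ ‖X‖ * ‖Y‖ := norm_inner_le_norm _ _
    _ ≤ _ := by gcongr

lemma inner_eq_zero_of_cf {x y : L2Q} (h : ∀ n, inner ℂ (cf n x) (cf n y) = 0) :
    inner ℂ x y = 0 := by
  have := hasSum_inner_cf x y
  simp_rw [h] at this
  exact this.unique hasSum_zero

lemma norm_ev (n : Fin 3 → ℤ) (v : C3) : ‖ev n v‖ = ‖v‖ := by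
  have h : inner ℂ (ev n v) (ev n v) = inner ℂ v v := by
    rw [inner_ev_left, cf_ev, if_pos rfl]
  rw [inner_self_eq_norm_sq_to_K, inner_self_eq_norm_sq_to_K] at h
  have h2 : ‖ev n v‖ ^ 2 = ‖v‖ ^ 2 := by
    apply Complex.ofReal_injective
    push_cast
    exact h
  exact (pow_left_inj₀ (norm_nonneg _) (norm_nonneg _) two_ne_zero).mp h2

/-! ### Correctors at the level of Fourier coefficients -/

/-- `r + c` is the periodic field with mean `c` such that `r` is a curl and `s (r + c)` is
curl-free. -/
structure IsMagCorr (s : L2Q →L[ℂ] L2Q) (c : C3) (r : L2Q) : Prop where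
  mean : cf 0 r = 0
  perp : ∀ n, inner ℂ (cv (dual n)) (cf n r) = 0
  curl : ∀ n, crI (dual n) (cf n (s (r + ev 0 c))) = 0

/-- `Y - c` is a `κ`-quasiperiodic gradient without zeroth mode and `m Y` is divergence-free, up
to its zeroth mode. -/
structure IsElCorr (m : L2Q →L[ℂ] L2Q) (κ : R3) (c : C3) (Y : L2Q) : Prop where
  mean : cf 0 Y = c
  par : ∀ n, n ≠ 0 → Par (κ + dual n) (cf n Y)
  perp : ∀ n, n ≠ 0 → inner ℂ (cv (κ + dual n)) (cf n (m Y)) = 0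

/-- Coercive bounded operators. -/
structure IsCoerc (T : L2Q →L[ℂ] L2Q) (a b : ℝ) : Prop where
  pos : 0 < a
  lower : ∀ x, a * ‖x‖ ^ 2 ≤ (inner ℂ x (T x)).re
  nonneg : 0 ≤ b
  upper : ∀ x, ‖T x‖ ≤ b * ‖x‖

/-- Céa's argument: `a ‖x‖² ≤ Re ⟨x, T x⟩ = Re ⟨w, T x⟩ ≤ b ‖w‖ ‖x‖`. All corrector bounds and the
comparison of `X` with `Y` come from it. -/
lemma IsCoerc.norm_le {T : L2Q →L[ℂ] L2Q} {a b : ℝ} (hT : IsCoerc T a b) {x w : L2Q}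
    (h : inner ℂ (x - w) (T x) = 0) : ‖x‖ ≤ b / a * ‖w‖ := by
  rw [inner_sub_left, sub_eq_zero] at h
  have h1 := hT.lower x
  rw [h] at h1
  have h2 : (inner ℂ w (T x)).re ≤ ‖w‖ * (b * ‖x‖) :=
    (Complex.re_le_norm _).trans ((norm_inner_le_norm _ _).trans
      (mul_le_mul_of_nonneg_left (hT.upper x) (norm_nonneg _)))
  rw [div_mul_eq_mul_div, le_div_iff₀ hT.pos]
  rcases (norm_nonneg x).eq_or_lt with h0 | h0
  · rw [← h0, zero_mul]
    exact mul_nonneg hT.nonneg (norm_nonneg _)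
  · refine le_of_mul_le_mul_right ?_ h0
    nlinarith

section Corr

variable {m s : L2Q →L[ℂ] L2Q} {α β a b : ℝ} {κ : R3} {c : C3} {r Y : L2Q}

/-- Orthogonality of divergence-free and curl-free fields, mode by mode; at the zeroth mode it is
the vanishing mean of `r'` that helps. -/
lemma IsMagCorr.inner_eq (h : IsMagCorr s c r) {r' : L2Q} (h0 : cf 0 r' = 0)
    (hp : ∀ n, inner ℂ (cv (dual n)) (cf n r') = 0) : inner ℂ r' (s (r + ev 0 c)) = 0 := by
  refine inner_eq_zero_of_cf fun n => ?_
  by_cases hn : n = 0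
  · rw [hn, h0, inner_zero_left]
  · exact (par_of_crI_eq (dual_ne_zero hn) (h.curl n)).inner_eq' (hp n)

/-- Hill's identity: the quadratic form of the homogenised matrix is the energy of the corrected
field. This is how coercivity passes to the homogenised matrix; `IsElCorr.inner_cf_zero` plays the
same role for the electric matrix. -/
lemma IsMagCorr.inner_cf_zero (h : IsMagCorr s c r) :
    inner ℂ c (cf 0 (s (r + ev 0 c))) = inner ℂ (r + ev 0 c) (s (r + ev 0 c)) := by
  rw [inner_add_left, h.inner_eq h.mean h.perp, zero_add, inner_ev_left]

lemma IsMagCorr.norm_le (hs : IsCoerc s a b) (h : IsMagCorr s c r) :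
    ‖r + ev 0 c‖ ≤ b / a * ‖c‖ := by
  rw [← norm_ev 0 c]
  refine hs.norm_le ?_
  rw [add_sub_cancel_right]
  exact h.inner_eq h.mean h.perp

lemma IsMagCorr.lower (hs : IsCoerc s a b) (h : IsMagCorr s c r) :
    a * ‖c‖ ^ 2 ≤ (inner ℂ c (cf 0 (s (r + ev 0 c)))).re := by
  rw [h.inner_cf_zero]
  refine le_trans ?_ (hs.lower _)
  have : ‖c‖ ≤ ‖r + ev 0 c‖ := by
    have := norm_cf_le 0 (r + ev 0 c)
    rwa [map_add, h.mean, cf_ev, if_pos rfl, zero_add] at this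
  have := hs.pos
  gcongr

lemma IsElCorr.inner_eq (h : IsElCorr m κ c Y) {x : L2Q} (h0 : cf 0 x = 0)
    (hp : ∀ n, n ≠ 0 → Par (κ + dual n) (cf n x)) : inner ℂ x (m Y) = 0 := by
  refine inner_eq_zero_of_cf fun n => ?_
  by_cases hn : n = 0
  · rw [hn, h0, inner_zero_left]
  · exact (hp n hn).inner_eq (h.perp n hn)

lemma IsElCorr.inner_sub (h : IsElCorr m κ c Y) : inner ℂ (Y - ev 0 c) (m Y) = 0 := by
  refine h.inner_eq ?_ fun n hn => ?_
  · rw [map_sub, h.mean, cf_ev, if_pos rfl, sub_self]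
  · rw [map_sub, cf_ev, if_neg hn, sub_zero]
    exact h.par n hn

lemma IsElCorr.norm_le (hm : IsCoerc m α β) (h : IsElCorr m κ c Y) : ‖Y‖ ≤ β / α * ‖c‖ := by
  rw [← norm_ev 0 c]
  exact hm.norm_le h.inner_sub

lemma IsElCorr.inner_cf_zero (h : IsElCorr m κ c Y) :
    inner ℂ c (cf 0 (m Y)) = inner ℂ Y (m Y) := by
  have := h.inner_sub
  rw [inner_sub_left, inner_ev_left, sub_eq_zero] at this
  exact this.symm

lemma IsElCorr.lower (hm : IsCoerc m α β) (h : IsElCorr m κ c Y) :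
    α * ‖c‖ ^ 2 ≤ (inner ℂ c (cf 0 (m Y))).re := by
  rw [h.inner_cf_zero]
  refine le_trans ?_ (hm.lower _)
  have : ‖c‖ ≤ ‖Y‖ := by
    have := norm_cf_le 0 Y
    rwa [h.mean] at this
  have := hm.pos
  gcongr

end Corr

section Mode

variable {m s : L2Q →L[ℂ] L2Q} {α β a b ε : ℝ} {k : R3} {w γ : C3} {r Y : L2Q}

/-- The homogenised equation `ε⁻² ik × S (ik × w) + Â w = γ` for a single mode. -/
def IsMode (m s : L2Q →L[ℂ] L2Q) (ε : ℝ) (k : R3) (w γ : C3) (Y r : L2Q) : Prop :=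
  IsElCorr m k w Y ∧ IsMagCorr s (crI k w) r ∧
    ((ε⁻¹ ^ 2 : ℝ) : ℂ) • crI k (cf 0 (s (r + ev 0 (crI k w)))) + cf 0 (m Y) = γ

lemma IsMode.energy (hm : IsCoerc m α β) (hs : IsCoerc s a b) (h : IsMode m s ε k w γ Y r) :
    ε⁻¹ ^ 2 * (a * ‖crI k w‖ ^ 2) + α * ‖w‖ ^ 2 ≤ (inner ℂ w γ).re := by
  obtain ⟨hY, hr, he⟩ := h
  rw [← he, inner_add_right, inner_smul_right, ← inner_crI, Complex.add_re, Complex.re_ofReal_mul]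
  have h1 := hr.lower hs
  have h2 := hY.lower hm
  gcongr

/-- Write `x = ‖ik × w‖`, `y = ‖w‖`, `G = ‖γ‖` and `t = |⟨w, γ⟩|`. The energy gives `ε⁻² a x² + α y²
≤ t`. Besides `t ≤ y G`, the transversality of `γ` gives `‖k‖ t ≤ G x`, since only the curl of `w`
is seen. The second inequality yields the factor `ε²` in the bound for `‖k‖ x`, and inserting that
into `‖k‖ α y² ≤ G x` bounds `‖k‖ y`. Nothing is assumed about the size of `k`. -/
lemma IsMode.bounds (hε : 0 < ε) (hm : IsCoerc m α β) (hs : IsCoerc s a b)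
    (h : IsMode m s ε k w γ Y r) (hγ : inner ℂ (cv k) γ = 0) :
    ‖w‖ ≤ α⁻¹ * ‖γ‖ ∧ ‖k‖ * ‖crI k w‖ ≤ ε ^ 2 * a⁻¹ * ‖γ‖ ∧
      ‖crI k w‖ ≤ (√(a * α))⁻¹ * ε * ‖γ‖ ∧ ‖k‖ * ‖w‖ ≤ (√(a * α))⁻¹ * ε * ‖γ‖ := by
  have hE := h.energy hm hs
  have ha := hs.pos
  have hα := hm.pos
  set x := ‖crI k w‖
  set y := ‖w‖
  set G := ‖γ‖
  set t := ‖(inner ℂ w γ : ℂ)‖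
  have hx : 0 ≤ x := norm_nonneg _
  have hy : 0 ≤ y := norm_nonneg _
  have hG : 0 ≤ G := norm_nonneg _
  have ht : 0 ≤ t := norm_nonneg _
  have hk : 0 ≤ ‖k‖ := norm_nonneg _
  have h1 : ε⁻¹ ^ 2 * (a * x ^ 2) + α * y ^ 2 ≤ t := hE.trans (Complex.re_le_norm _)
  have h2 : t ≤ y * G := norm_inner_le_norm _ _
  have h3 : ‖k‖ * t ≤ G * x := norm_mul_norm_inner_le hγ w
  have h4 : 0 ≤ ε⁻¹ ^ 2 * (a * x ^ 2) := by positivity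
  have h5 : 0 ≤ α * y ^ 2 := by positivity
  have b1 : α * y ≤ G := by
    rcases hy.eq_or_lt with h0 | h0
    · rw [← h0]; simpa using hG
    · refine le_of_mul_le_mul_right ?_ h0
      nlinarith
  have b2 : ‖k‖ * (a * x) ≤ ε ^ 2 * G := by
    rcases hx.eq_or_lt with h0 | h0
    · rw [← h0]; simp; positivity
    · refine le_of_mul_le_mul_right ?_ h0
      have : ‖k‖ * (ε⁻¹ ^ 2 * (a * x ^ 2)) ≤ G * x :=
        (mul_le_mul_of_nonneg_left (by linarith) hk).trans h3
      have h6 := mul_le_mul_of_nonneg_left this (sq_nonneg ε)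
      have h7 : ε ^ 2 * (‖k‖ * (ε⁻¹ ^ 2 * (a * x ^ 2))) = ‖k‖ * (a * x) * x := by
        field_simp
      linarith
  have h8 : a * x ^ 2 ≤ ε ^ 2 * t := by
    have h6 := mul_le_mul_of_nonneg_left (show ε⁻¹ ^ 2 * (a * x ^ 2) ≤ t by linarith)
      (sq_nonneg ε)
    have h7 : ε ^ 2 * (ε⁻¹ ^ 2 * (a * x ^ 2)) = a * x ^ 2 := by field_simp
    linarith
  have hρ : 0 < √(a * α) := Real.sqrt_pos.mpr (by positivity)
  have hρ2 : √(a * α) ^ 2 = a * α := Real.sq_sqrt (by positivity)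
  have b3 : √(a * α) * x ≤ ε * G := by
    refine abs_le_of_sq_le_sq' ?_ (by positivity) |>.2
    rw [mul_pow, mul_pow, hρ2]
    have : α * t ≤ G ^ 2 := by nlinarith
    nlinarith [sq_nonneg ε, mul_le_mul_of_nonneg_left h8 hα.le,
      mul_le_mul_of_nonneg_left this (sq_nonneg ε)]
  have b4 : √(a * α) * (‖k‖ * y) ≤ ε * G := by
    refine abs_le_of_sq_le_sq' ?_ (by positivity) |>.2
    rw [mul_pow, mul_pow, mul_pow, hρ2]
    have e1 : ‖k‖ * (α * y ^ 2) ≤ G * x :=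
      (mul_le_mul_of_nonneg_left (by linarith) hk).trans h3
    have e2 := mul_le_mul_of_nonneg_left e1 (mul_nonneg ha.le hk)
    have e3 := mul_le_mul_of_nonneg_left b2 hG
    nlinarith
  refine ⟨?_, ?_, ?_, ?_⟩
  · rw [inv_mul_eq_div, le_div_iff₀ hα]; linarith
  · rw [mul_assoc, mul_left_comm, inv_mul_eq_div, le_div_iff₀ ha]; linarith
  · rw [mul_assoc, inv_mul_eq_div, le_div_iff₀ hρ]; linarith
  · rw [mul_assoc, inv_mul_eq_div, le_div_iff₀ hρ]; linarith

end Mode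

/-! ### The estimate in a fibre -/

section Fibre

variable {m s : L2Q →L[ℂ] L2Q} {α β a b ε : ℝ} {κ : R3}

/-- Take `N_n = |2πn|⁻² (2πi n × r_n)`. By `crI_crI` its curl is `r`, because `r_n` is transversal,
and `|2πn| ≥ 1` gives the norm bound. -/
lemma exists_vector_potential {r : L2Q} (h0 : cf 0 r = 0)
    (hp : ∀ n, inner ℂ (cv (dual n)) (cf n r) = 0) :
    ∃ N : L2Q, (∀ n, crI (dual n) (cf n N) = cf n r) ∧ cf 0 N = 0 ∧
      (∀ n, inner ℂ (cv (dual n)) (cf n N) = 0) ∧ ‖N‖ ≤ ‖r‖ := by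
  obtain ⟨N, hN, hN'⟩ := exists_cf_of_le
    (fun n => (((‖dual n‖ ^ 2)⁻¹ : ℝ) : ℂ) • crI (dual n) (cf n r)) r zero_le_one (fun n => by
      rw [norm_smul, Complex.norm_real, Real.norm_of_nonneg (by positivity), one_mul]
      by_cases hn : n = 0
      · subst hn
        rw [h0]; simp
      have h1 := one_le_norm_dual hn
      rw [inv_mul_le_iff₀ (by positivity)]
      refine (norm_crI_le _ _).trans ?_
      gcongr
      nlinarith)
  refine ⟨N, fun n => ?_, ?_, fun n => ?_, by simpa using hN'⟩
  · rw [hN, crI_smul, crI_crI, hp, zero_smul, sub_zero, smul_smul]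
    by_cases hn : n = 0
    · subst hn
      rw [h0, smul_zero]
    · rw [← Complex.ofReal_mul, inv_mul_cancel₀, Complex.ofReal_one, one_smul]
      have := one_le_norm_dual hn
      positivity
  · rw [hN, h0]; simp
  · rw [hN, inner_smul_right, inner_cv_crI, mul_zero]

/-- Each mode gains `‖κ + dual n‖⁻¹ ≤ 1` from `norm_mul_norm_inner_le`. Trading `z` for its curl `V`
matters because the energy controls `V` with the weight `ε⁻²`. -/
lemma norm_inner_le_of_perp (hκ : ∀ n, n ≠ 0 → 1 ≤ ‖κ + dual n‖) {z V q : L2Q}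
    (hV : ∀ n, cf n V = crI (κ + dual n) (cf n z)) (h0 : cf 0 q = 0)
    (hq : ∀ n, n ≠ 0 → inner ℂ (cv (κ + dual n)) (cf n q) = 0) :
    ‖(inner ℂ z q : ℂ)‖ ≤ ‖V‖ * ‖q‖ := by
  rw [← one_mul (‖V‖ * ‖q‖)]
  refine norm_inner_le_of_cf zero_le_one fun n => ?_
  by_cases hn : n = 0
  · subst hn
    rw [h0]; simp
  · have h1 := norm_mul_norm_inner_le (hq n hn) (cf n z)
    rw [hV, one_mul, mul_comm]
    refine le_trans ?_ h1
    exact le_mul_of_one_le_left (norm_nonneg _) (hκ n hn)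

/-- Here `p_n = t · 2πn` is a gradient for the untwisted curl, while `V_n` is orthogonal to `κ +
2πn`. Hence `⟨V_n, p_n⟩ = -t ⟨V_n, κ⟩`, and the mismatch between the two curls costs exactly a
factor `|κ|`. -/
lemma norm_inner_le_of_curl {z V p : L2Q} (hV : ∀ n, cf n V = crI (κ + dual n) (cf n z))
    (h0 : cf 0 p = 0) (hp : ∀ n, n ≠ 0 → crI (dual n) (cf n p) = 0) :
    ‖(inner ℂ V p : ℂ)‖ ≤ ‖κ‖ * (‖V‖ * ‖p‖) := by
  refine norm_inner_le_of_cf (norm_nonneg _) fun n => ?_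
  by_cases hn : n = 0
  · subst hn
    rw [h0]; simp
  obtain ⟨t, ht⟩ := par_of_crI_eq (dual_ne_zero hn) (hp n hn)
  have h1 : ‖t‖ ≤ ‖cf n p‖ := by
    rw [ht, norm_smul, norm_cv]
    exact le_mul_of_one_le_right (norm_nonneg _) (one_le_norm_dual hn)
  have h2 : inner ℂ (cf n V) (cf n p) = -(t * inner ℂ (cf n V) (cv κ)) := by
    have e : cv (dual n) = cv (κ + dual n) - cv κ := by rw [cv_add, add_sub_cancel_left]
    rw [ht, e, inner_smul_right, inner_sub_right, hV, inner_crI, crI_cv, inner_zero_right]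
    ring
  rw [h2, norm_neg, norm_mul]
  have h3 : ‖(inner ℂ (cf n V) (cv κ) : ℂ)‖ ≤ ‖cf n V‖ * ‖κ‖ := by
    rw [← norm_cv κ]
    exact norm_inner_le_norm _ _
  calc ‖t‖ * ‖(inner ℂ (cf n V) (cv κ) : ℂ)‖ ≤ ‖cf n p‖ * (‖cf n V‖ * ‖κ‖) := by gcongr
    _ = _ := by ring

lemma inner_eq_of_cf_add {x₁ y₁ x₂ y₂ x₃ y₃ : L2Q} (t : ℂ)
    (h : ∀ n, inner ℂ (cf n x₁) (cf n y₁) + t * inner ℂ (cf n x₂) (cf n y₂)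
      = inner ℂ (cf n x₃) (cf n y₃)) :
    inner ℂ x₁ y₁ + t * inner ℂ x₂ y₂ = inner ℂ x₃ y₃ := by
  have h1 := (hasSum_inner_cf x₁ y₁).add ((hasSum_inner_cf x₂ y₂).mul_left t)
  simp_rw [h] at h1
  exact h1.unique (hasSum_inner_cf x₃ y₃)

lemma norm_sub_ev_le (f : L2Q) : ‖f - ev 0 (cf 0 f)‖ ≤ ‖f‖ := by
  rw [← one_mul ‖f‖]
  refine norm_le_of_cf_le zero_le_one fun n => ?_
  rw [map_sub, cf_ev, one_mul]
  split_ifs with hn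
  · subst hn; simp
  · simp

/-- The Maxwell problem in a fibre, with the solution of the homogenised problem. -/
structure IsFibre (m s : L2Q →L[ℂ] L2Q) (ε : ℝ) (κ : R3) (u B g X W : L2Q) : Prop where
  curl : ∀ n, cf n B = crI (κ + dual n) (cf n u)
  eqn : ∀ n, ((ε⁻¹ ^ 2 : ℝ) : ℂ) • crI (κ + dual n) (cf n (s B)) + cf n (m u) = -cf n g
  div : ∀ n, inner ℂ (cv (κ + dual n)) (cf n g) = 0
  par : ∀ n, Par (κ + dual n) (cf n (X - W))
  perp : ∀ n, inner ℂ (cv (κ + dual n)) (cf n (m X)) = 0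
  mode : ∀ n, ∃ Y r, IsMode m s ε (κ + dual n) (cf n W) (cf n g) Y r

/-- The energy identity for the difference of the solution and its approximation. -/
lemma energy_identity {u B g Y r N E : L2Q} {c w γ : C3}
    (hcurl : ∀ n, cf n B = crI (κ + dual n) (cf n u))
    (heqn : ∀ n, ((ε⁻¹ ^ 2 : ℝ) : ℂ) • crI (κ + dual n) (cf n (s B)) + cf n (m u) = -cf n g)
    (hY : IsElCorr m κ w Y) (hc : c = crI κ w) (hr : cf 0 r = 0)
    (he : ((ε⁻¹ ^ 2 : ℝ) : ℂ) • crI κ (cf 0 (s (r + ev 0 c))) + cf 0 (m Y) = γ)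
    (hN : ∀ n, crI (dual n) (cf n N) = cf n r) (hE : ∀ n, cf n E = crI κ (cf n N)) :
    (∀ n, cf n (B + ev 0 c + r + E) = crI (κ + dual n) (cf n (u + Y + N))) ∧
    inner ℂ (u + Y + N) (m (u + Y + N))
      + ((ε⁻¹ ^ 2 : ℝ) : ℂ) * inner ℂ (B + ev 0 c + r + E) (s (B + ev 0 c + r + E))
    = -inner ℂ (u + Y + N) (g - ev 0 γ)
      + ((ε⁻¹ ^ 2 : ℝ) : ℂ) * inner ℂ (B + ev 0 c + r + E)
        (s (r + ev 0 c) - ev 0 (cf 0 (s (r + ev 0 c))))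
      + inner ℂ (u + Y + N) (m Y - ev 0 (cf 0 (m Y)))
      + inner ℂ (u + Y + N) (m N)
      + ((ε⁻¹ ^ 2 : ℝ) : ℂ) * inner ℂ (B + ev 0 c + r + E) (s E) := by
  have hV : ∀ n, cf n (B + ev 0 c + r + E) = crI (κ + dual n) (cf n (u + Y + N)) := by
    intro n
    simp only [map_add, crI_add, hcurl, hE, cf_ev]
    rw [crI_add_left κ (dual n) (cf n N), hN]
    by_cases hn : n = 0
    · subst hn
      rw [if_pos rfl, hY.mean, dual_zero, add_zero, hc, hr]
      abel
    · rw [if_neg hn, (hY.par n hn).crI_eq]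
      abel
  refine ⟨hV, ?_⟩
  set z := u + Y + N with hz
  set V := B + ev 0 c + r + E with hVdef
  set t : ℂ := ((ε⁻¹ ^ 2 : ℝ) : ℂ)
  -- The fibre equation tested with `z`.
  have h1 : inner ℂ z (m u) + t * inner ℂ V (s B) = inner ℂ z (-g) := by
    refine inner_eq_of_cf_add t fun n => ?_
    rw [map_neg, ← heqn, hV, inner_add_right, inner_smul_right, inner_crI, add_comm]
  -- The homogenised equation tested with the zeroth mode of `z`. Added to the previous identity it
  -- removes the zeroth modes of `g`, of `s (r + c)` and of `m Y`.
  have h2 : t * inner ℂ V (ev 0 (cf 0 (s (r + ev 0 c)))) + inner ℂ z (ev 0 (cf 0 (m Y)))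
      = inner ℂ z (ev 0 γ) := by
    rw [inner_ev_right, inner_ev_right, inner_ev_right, hV, dual_zero, add_zero, ← he,
      inner_add_right, inner_smul_right, inner_crI]
  have e1 : m z = m u + m Y + m N := by rw [hz, map_add, map_add]
  have e2 : s V = s B + s (r + ev 0 c) + s E := by
    rw [← map_add, ← map_add, hVdef]
    congr 1
    abel
  rw [inner_neg_right] at h1
  rw [e1, e2]
  simp only [inner_add_right, inner_sub_right] at h1 h2 ⊢
  linear_combination h1 + h2

/-- Young's inequality in the rescaled variable `v = ε v'`: the term in `v'` is absorbed completely
and the term in `x` up to half of `α x²`. The remainders give the constant. -/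
lemma le_of_energy_le {x v G C₁ C₂ : ℝ} (hα : 0 < α) (ha : 0 < a) (hε : 0 < ε)
    (hG0 : 0 ≤ G) (hen : α * x ^ 2 + ε⁻¹ ^ 2 * (a * v ^ 2) ≤ C₁ * G * v + C₂ * (ε * G) * x) :
    x ≤ √(2 / α * (C₁ ^ 2 / (4 * a) + C₂ ^ 2 / (2 * α))) * ε * G := by
  set K := 2 / α * (C₁ ^ 2 / (4 * a) + C₂ ^ 2 / (2 * α)) with hK
  have e0 : (√K) ^ 2 = K := Real.sq_sqrt (by positivity)
  refine abs_le_of_sq_le_sq' ?_ (by positivity) |>.2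
  rw [mul_pow, mul_pow, e0]
  obtain ⟨v', rfl⟩ : ∃ v', v = ε * v' := ⟨ε⁻¹ * v, by field_simp⟩
  have hv2 : ε⁻¹ ^ 2 * (a * (ε * v') ^ 2) = a * v' ^ 2 := by field_simp
  rw [hv2] at hen
  have y1 : C₁ * (ε * G) * v' ≤ a * v' ^ 2 + C₁ ^ 2 / (4 * a) * (ε * G) ^ 2 := by
    have : a * v' ^ 2 + C₁ ^ 2 / (4 * a) * (ε * G) ^ 2 - C₁ * (ε * G) * v'
      = a * (v' - C₁ * (ε * G) / (2 * a)) ^ 2 := by field_simp; ring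
    linarith [mul_nonneg ha.le (sq_nonneg (v' - C₁ * (ε * G) / (2 * a)))]
  have y2 : C₂ * (ε * G) * x ≤ α / 2 * x ^ 2 + C₂ ^ 2 / (2 * α) * (ε * G) ^ 2 := by
    have : α / 2 * x ^ 2 + C₂ ^ 2 / (2 * α) * (ε * G) ^ 2 - C₂ * (ε * G) * x
      = α / 2 * (x - C₂ * (ε * G) / α) ^ 2 := by field_simp; ring
    linarith [mul_nonneg (half_pos hα).le (sq_nonneg (x - C₂ * (ε * G) / α))]
  have y3 : α / 2 * x ^ 2 ≤ (C₁ ^ 2 / (4 * a) + C₂ ^ 2 / (2 * α)) * (ε * G) ^ 2 := by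
    have : C₁ * G * (ε * v') = C₁ * (ε * G) * v' := by ring
    rw [this] at hen
    linarith
  have y4 := mul_le_mul_of_nonneg_left y3 (show 0 ≤ 2 / α by positivity)
  have y5 : 2 / α * (α / 2 * x ^ 2) = x ^ 2 := by field_simp
  rw [y5] at y4
  refine y4.trans (le_of_eq ?_)
  rw [hK]; ring

/-- `IsCoerc.norm_le` applies because `m (X - Y)` is divergence-free in every mode and `X - Y`
differs from `W - ev 0 (cf 0 W)` by a gradient. At the zeroth mode, `m Y` is transversal because `γ`
is and the range of `crI κ` is orthogonal to `κ`. -/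
lemma IsFibre.norm_sub_le {u B g X W Y r : L2Q} (h : IsFibre m s ε κ u B g X W)
    (hm : IsCoerc m α β) (hY : IsElCorr m κ (cf 0 W) Y)
    (he : ((ε⁻¹ ^ 2 : ℝ) : ℂ) • crI κ (cf 0 (s (r + ev 0 (crI κ (cf 0 W))))) + cf 0 (m Y) = cf 0 g)
    (hγp : inner ℂ (cv κ) (cf 0 g) = 0) : ‖X - Y‖ ≤ β / α * ‖W - ev 0 (cf 0 W)‖ := by
  have hd0 : κ + dual 0 = κ := by rw [dual_zero, add_zero]
  refine hm.norm_le (inner_eq_zero_of_cf fun n => ?_)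
  by_cases hn : n = 0
  · subst hn
    refine Par.inner_eq (k := κ) ?_ ?_
    · have p := h.par 0
      rw [hd0, map_sub] at p
      rw [map_sub, map_sub, map_sub, cf_ev, if_pos rfl, hY.mean, sub_self, sub_zero]
      exact p
    · have q := h.perp 0
      rw [hd0] at q
      have q2 : inner ℂ (cv κ) (cf 0 (m Y)) = 0 := by
        rw [← he, inner_add_right, inner_smul_right, inner_cv_crI, mul_zero, zero_add] at hγp
        exact hγp
      rw [map_sub, map_sub, inner_sub_right, q, q2, sub_zero]
  · refine Par.inner_eq (k := κ + dual n) ?_ ?_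
    · have p := (h.par n).sub (hY.par n hn)
      rw [map_sub, sub_right_comm] at p
      rw [map_sub, map_sub, map_sub, cf_ev, if_neg hn, sub_zero]
      exact p
    · rw [map_sub, map_sub, inner_sub_right, h.perp, hY.perp n hn, sub_zero]

-- The constant is fixed before the operators, so it depends only on the coercivity and boundedness
-- constants. The quasimomentum enters only through the gap `1 ≤ ‖κ + dual n‖` for `n ≠ 0`.
set_option maxHeartbeats 1000000 in
theorem fibre_estimate (hα : 0 < α) (hβ : 0 ≤ β) (ha : 0 < a) (hb : 0 ≤ b) :
    ∃ C : ℝ, 0 < C ∧ ∀ (m s : L2Q →L[ℂ] L2Q), IsCoerc m α β → IsCoerc s a b →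
      ∀ (ε : ℝ), 0 < ε → ∀ κ : R3, (∀ n, n ≠ 0 → 1 ≤ ‖κ + dual n‖) →
      ∀ u B g X W : L2Q, IsFibre m s ε κ u B g X W → ‖u + X‖ ≤ C * ε * ‖g‖ := by
  set ρ := (√(a * α))⁻¹ with hρ
  have hρ0 : 0 ≤ ρ := by positivity
  set C₀ := b / a + 1 with hC₀
  have hC₀0 : 0 ≤ C₀ := by positivity
  set C₁ := 1 + b * (b / a) * a⁻¹ + β * (β / α * α⁻¹) + b * C₀ * a⁻¹ with hC₁
  set C₂ := β * C₀ * ρ with hC₂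
  set K := 2 / α * (C₁ ^ 2 / (4 * a) + C₂ ^ 2 / (2 * α)) with hK
  have hK0 : 0 ≤ K := by positivity
  -- The summands bound `z`, `N` and `X - Y` in `u + X = z - N + (X - Y)`; the final `1` only
  -- ensures positivity.
  refine ⟨√K + C₀ * ρ + β / α * ρ + 1, by positivity, ?_⟩
  intro m s hm hs ε hε κ hκ u B g X W h
  obtain ⟨Y, r, hmode⟩ := h.mode 0
  have hd0 : κ + dual 0 = κ := by rw [dual_zero, add_zero]
  rw [hd0] at hmode
  set w := cf 0 W with hw
  set c := crI κ w with hc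
  set γ := cf 0 g with hγ
  have hγp : inner ℂ (cv κ) γ = 0 := by simpa only [hd0] using h.div 0
  obtain ⟨hY, hr, he⟩ := id hmode
  obtain ⟨b1, b2, b3, -⟩ := hmode.bounds hε hm hs hγp
  obtain ⟨N, hN, -, -, hNr⟩ := exists_vector_potential hr.mean hr.perp
  -- `E` is the part of the twisted curl of `N` that is not `r`; it is of size `|κ| ‖N‖`.
  obtain ⟨E, hE, hEN⟩ := exists_cf_of_le (fun n => crI κ (cf n N)) N (norm_nonneg κ)
    (fun n => norm_crI_le _ _)
  obtain ⟨hV, hid⟩ := energy_identity h.curl h.eqn hY hc hr.mean he hN hE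
  set z := u + Y + N with hz
  set V := B + ev 0 c + r + E with hVdef
  have hG : ‖γ‖ ≤ ‖g‖ := norm_cf_le 0 g
  have hγ2 : 0 ≤ ‖γ‖ := norm_nonneg _
  have hrn : ‖r‖ ≤ C₀ * ‖c‖ := by
    have e1 := hr.norm_le hs
    have e2 : ‖r‖ ≤ ‖r + ev 0 c‖ + ‖ev 0 c‖ := norm_le_add_norm_add r (ev 0 c)
    rw [norm_ev] at e2
    rw [hC₀, add_mul, one_mul]
    linarith
  have hNn : ‖N‖ ≤ C₀ * ρ * ε * ‖g‖ := by
    calc ‖N‖ ≤ C₀ * ‖c‖ := hNr.trans hrn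
      _ ≤ C₀ * (ρ * ε * ‖γ‖) := by gcongr
      _ ≤ C₀ * (ρ * ε * ‖g‖) := by gcongr
      _ = _ := by ring
  have hκc : ‖κ‖ * ‖c‖ ≤ ε ^ 2 * a⁻¹ * ‖g‖ := b2.trans (by gcongr)
  -- the five terms of the energy identity
  have t1 : ‖(inner ℂ z (g - ev 0 γ) : ℂ)‖ ≤ ‖V‖ * ‖g‖ := by
    refine (norm_inner_le_of_perp hκ hV ?_ fun n hn => ?_).trans
      (mul_le_mul_of_nonneg_left (norm_sub_ev_le g) (norm_nonneg _))
    · rw [map_sub, cf_ev, if_pos rfl, hγ, sub_self]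
    · rw [map_sub, cf_ev, if_neg hn, sub_zero, h.div]
  have t3 : ‖(inner ℂ z (m Y - ev 0 (cf 0 (m Y))) : ℂ)‖
      ≤ ‖V‖ * (β * (β / α * α⁻¹) * ‖g‖) := by
    refine (norm_inner_le_of_perp hκ hV ?_ fun n hn => ?_).trans
      (mul_le_mul_of_nonneg_left ((norm_sub_ev_le (m Y)).trans ?_) (norm_nonneg _))
    · rw [map_sub, cf_ev, if_pos rfl, sub_self]
    · rw [map_sub, cf_ev, if_neg hn, sub_zero, hY.perp n hn]
    · calc ‖m Y‖ ≤ β * ‖Y‖ := hm.upper Y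
        _ ≤ β * (β / α * ‖w‖) := by gcongr; exact hY.norm_le hm
        _ ≤ β * (β / α * (α⁻¹ * ‖g‖)) := by
          gcongr; exact b1.trans (by gcongr)
        _ = _ := by ring
  -- The singular factor `ε⁻²` is compensated by `‖κ‖ ‖c‖ ≤ ε² a⁻¹ ‖g‖`; the factor `‖κ‖` comes from
  -- pairing a curl-free flux with `V`.
  have t2 : ε⁻¹ ^ 2 * ‖(inner ℂ V (s (r + ev 0 c) - ev 0 (cf 0 (s (r + ev 0 c)))) : ℂ)‖
      ≤ ‖V‖ * (b * (b / a) * a⁻¹ * ‖g‖) := by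
    have e1 := norm_inner_le_of_curl (p := s (r + ev 0 c) - ev 0 (cf 0 (s (r + ev 0 c)))) hV
      (by rw [map_sub, cf_ev, if_pos rfl, sub_self])
      (fun n hn => by rw [map_sub, cf_ev, if_neg hn, sub_zero, hr.curl])
    have e2 : ‖s (r + ev 0 c) - ev 0 (cf 0 (s (r + ev 0 c)))‖ ≤ b * (b / a * ‖c‖) :=
      (norm_sub_ev_le _).trans ((hs.upper _).trans
        (mul_le_mul_of_nonneg_left (hr.norm_le hs) hb))
    calc _ ≤ ε⁻¹ ^ 2 * (‖κ‖ * (‖V‖ * (b * (b / a * ‖c‖)))) := by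
          gcongr
          exact e1.trans (by gcongr)
      _ = ε⁻¹ ^ 2 * ‖V‖ * (b * (b / a)) * (‖κ‖ * ‖c‖) := by ring
      _ ≤ ε⁻¹ ^ 2 * ‖V‖ * (b * (b / a)) * (ε ^ 2 * a⁻¹ * ‖g‖) := by gcongr
      _ = _ := by field_simp
  have t4 : ‖(inner ℂ z (m N) : ℂ)‖ ≤ ‖z‖ * (C₂ * ε * ‖g‖) := by
    refine (norm_inner_le_norm _ _).trans (mul_le_mul_of_nonneg_left ?_ (norm_nonneg _))
    calc ‖m N‖ ≤ β * ‖N‖ := hm.upper N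
      _ ≤ β * (C₀ * ρ * ε * ‖g‖) := by gcongr
      _ = _ := by rw [hC₂]; ring
  -- The same compensation of `ε⁻²`, with the factor `‖κ‖` now supplied by `E`.
  have t5 : ε⁻¹ ^ 2 * ‖(inner ℂ V (s E) : ℂ)‖ ≤ ‖V‖ * (b * C₀ * a⁻¹ * ‖g‖) := by
    calc _ ≤ ε⁻¹ ^ 2 * (‖V‖ * (b * (‖κ‖ * (C₀ * ‖c‖)))) := by
          gcongr
          refine (norm_inner_le_norm _ _).trans (mul_le_mul_of_nonneg_left ?_ (norm_nonneg _))
          refine (hs.upper E).trans (mul_le_mul_of_nonneg_left ?_ hb)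
          exact hEN.trans (by gcongr; exact hNr.trans hrn)
      _ = ε⁻¹ ^ 2 * ‖V‖ * (b * C₀) * (‖κ‖ * ‖c‖) := by ring
      _ ≤ ε⁻¹ ^ 2 * ‖V‖ * (b * C₀) * (ε ^ 2 * a⁻¹ * ‖g‖) := by gcongr
      _ = _ := by field_simp
  have hen : α * ‖z‖ ^ 2 + ε⁻¹ ^ 2 * (a * ‖V‖ ^ 2)
      ≤ C₁ * ‖g‖ * ‖V‖ + C₂ * (ε * ‖g‖) * ‖z‖ := by
    have e1 := congrArg Complex.re hid
    simp only [Complex.add_re, Complex.neg_re, Complex.re_ofReal_mul] at e1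
    have l1 := hm.lower z
    have l2 : ε⁻¹ ^ 2 * (a * ‖V‖ ^ 2) ≤ ε⁻¹ ^ 2 * (inner ℂ V (s V)).re := by
      gcongr; exact hs.lower V
    have r1 := (abs_le.mp (Complex.abs_re_le_norm (inner ℂ z (g - ev 0 γ)))).1
    have r2 := mul_le_mul_of_nonneg_left (Complex.re_le_norm
      (inner ℂ V (s (r + ev 0 c) - ev 0 (cf 0 (s (r + ev 0 c)))))) (sq_nonneg ε⁻¹)
    have r3 := Complex.re_le_norm (inner ℂ z (m Y - ev 0 (cf 0 (m Y))))
    have r4 := Complex.re_le_norm (inner ℂ z (m N))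
    have r5 := mul_le_mul_of_nonneg_left (Complex.re_le_norm (inner ℂ V (s E))) (sq_nonneg ε⁻¹)
    have e3 : C₁ * ‖g‖ * ‖V‖ = ‖V‖ * ‖g‖ + ‖V‖ * (b * (b / a) * a⁻¹ * ‖g‖)
      + ‖V‖ * (β * (β / α * α⁻¹) * ‖g‖) + ‖V‖ * (b * C₀ * a⁻¹ * ‖g‖) := by rw [hC₁]; ring
    have e4 : C₂ * (ε * ‖g‖) * ‖z‖ = ‖z‖ * (C₂ * ε * ‖g‖) := by ring
    rw [e3, e4]
    linarith
  have hzn : ‖z‖ ≤ √K * ε * ‖g‖ :=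
    le_of_energy_le hα ha hε (norm_nonneg g) hen
  have hX : ‖X - Y‖ ≤ β / α * ρ * ε * ‖g‖ := by
    refine (h.norm_sub_le hm hY he hγp).trans ?_
    -- For `n ≠ 0` the frequency is at least `1`, so the bound on `‖k‖ ‖w‖` already bounds the mode
    -- itself by `O(ε)`.
    have e2 : ‖W - ev 0 w‖ ≤ ρ * ε * ‖g‖ := by
      refine norm_le_of_cf_le (by positivity) fun n => ?_
      rw [map_sub, cf_ev]
      split_ifs with hn
      · subst hn
        rw [hw, sub_self, norm_zero]
        positivity
      · obtain ⟨Y', r', hmode'⟩ := h.mode n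
        obtain ⟨-, -, -, b4⟩ := hmode'.bounds hε hm hs (h.div n)
        rw [sub_zero]
        exact (le_mul_of_one_le_left (norm_nonneg _) (hκ n hn)).trans b4
    calc _ ≤ β / α * (ρ * ε * ‖g‖) := by gcongr
      _ = _ := by ring
  have hdec : u + X = z - N + (X - Y) := by rw [hz]; abel
  rw [hdec]
  calc _ ≤ ‖z‖ + ‖N‖ + ‖X - Y‖ := (norm_add_le _ _).trans (by gcongr; exact norm_sub_le _ _)
    _ ≤ √K * ε * ‖g‖ + C₀ * ρ * ε * ‖g‖ + β / α * ρ * ε * ‖g‖ := by gcongr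
    _ ≤ _ := by
      have : 0 ≤ ε * ‖g‖ := by positivity
      nlinarith

end Fibre

/-! ### The Fourier transform of square integrable fields -/

open FourierTransform SchwartzMap

/-- The Hilbert space of square integrable fields on the whole space. -/
abbrev L2R := Lp C3 2 (volume : Measure R3)

/-- The Fourier transform on `L²`. -/
abbrev FT : L2R ≃ₗᵢ[ℂ] L2R := Lp.fourierTransformₗᵢ R3 C3

lemma fourier_eq_integral_pw (f : R3 → C3) (ξ : R3) :
    𝓕 f ξ = ∫ x, starRingEnd ℂ (pw ((2 * Real.pi) • ξ) x) • f x := by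
  rw [Real.fourier_eq]
  congr 1
  funext x
  rw [Circle.smul_def, Real.fourierChar_apply, ← pw_neg_left, pw]
  congr 2
  rw [inner_neg_left, inner_smul_left, real_inner_comm]
  push_cast
  simp
  ring

/-- The pairing of a Schwartz function with the Fourier transform. -/
lemma integral_schwartz_smul_FT (ψ : 𝓢(R3, ℂ)) (f : L2R) :
    ∫ x, (𝓕 ψ) x • f x = ∫ ξ, ψ ξ • FT f ξ := by
  have h := congrArg (fun T : 𝓢'(R3, C3) => T ψ) (Lp.fourier_toTemperedDistribution_eq f)
  simp only [TemperedDistribution.fourier_apply, Lp.toTemperedDistribution_apply] at h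
  exact h

/-- On `L¹ ∩ L²` the Fourier transform is given by the integral. -/
lemma FT_toLp_ae_eq {f : R3 → C3} (h1 : Integrable f) (h2 : MemLp f 2) :
    FT (h2.toLp f) =ᵐ[volume] 𝓕 f := by
  have hc : Continuous (𝓕 f) :=
    VectorFourier.fourierIntegral_continuous Real.continuous_fourierChar
      (innerSL ℝ).continuous₂ h1
  refine ae_eq_of_integral_contDiff_smul_eq
    ((Lp.memLp (FT (h2.toLp f))).locallyIntegrable (by norm_num))
    hc.locallyIntegrable fun g hg hgc => ?_
  have hg' : ContDiff ℝ ∞ fun x => (g x : ℂ) := Complex.ofRealCLM.contDiff.comp hg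
  have hgc' : HasCompactSupport fun x => (g x : ℂ) := hgc.comp_left Complex.ofReal_zero
  let ψ : 𝓢(R3, ℂ) := hgc'.toSchwartzMap hg'
  have hψ : ∀ x, ψ x = (g x : ℂ) := fun x => rfl
  have e1 := integral_schwartz_smul_FT ψ (h2.toLp f)
  have e2 : ∫ x, (𝓕 ψ) x • f x = ∫ ξ, ψ ξ • 𝓕 f ξ :=
    VectorFourier.integral_fourierIntegral_smul_eq_flip (L := innerₗ R3)
      Real.continuous_fourierChar continuous_inner ψ.integrable h1
      |>.trans (by simp only [flip_innerₗ]; rfl)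
  have e3 : ∫ x, (𝓕 ψ) x • h2.toLp f x = ∫ x, (𝓕 ψ) x • f x := by
    refine integral_congr_ae ?_
    filter_upwards [h2.coeFn_toLp] with x hx
    rw [hx]
  rw [e3, e2] at e1
  simp only [hψ] at e1
  simp only [Complex.coe_smul] at e1
  exact e1.symm

/-! ### Fibres -/

/-- The point `ε⁻¹ (τ + n)`. -/
def fib (ε : ℝ) (τ : R3) (n : Fin 3 → ℤ) : R3 := ε⁻¹ • (τ + latt n)

lemma latt_add (n m : Fin 3 → ℤ) : latt (n + m) = latt n + latt m := by
  ext i; simp [latt_apply]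

lemma fib_add_latt (ε : ℝ) (τ : R3) (n m : Fin 3 → ℤ) : fib ε (τ + latt m) n = fib ε τ (m + n) := by
  rw [fib, fib, latt_add, add_assoc]

lemma lintegral_eq_tsum_cell (F : R3 → ℝ≥0∞) :
    ∫⁻ x, F x = ∑' n : Fin 3 → ℤ, ∫⁻ t in Q, F (t + latt n) := by
  conv_lhs => rw [periodicMeasure_volume.eq_sum, lintegral_sum_measure]
  congr 1
  funext n
  rw [show (fun x : R3 => x + latt n) = MeasurableEquiv.addRight (latt n) from rfl,
    lintegral_map_equiv]
  rfl

lemma ae_of_ae_cell {P : R3 → Prop} (h : ∀ n, ∀ᵐ t ∂volQ, P (t + latt n)) : ∀ᵐ x, P x := by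
  rw [periodicMeasure_volume.eq_sum, Measure.ae_sum_iff]
  intro n
  have hm : MeasurableEmbedding fun x : R3 => x + latt n :=
    (MeasurableEquiv.addRight (latt n)).measurableEmbedding
  rw [hm.ae_map_iff]
  exact h n

variable {ε : ℝ}

lemma map_smul_volume (hε : 0 < ε) :
    (volume : Measure R3).map (fun x => ε • x) = ENNReal.ofReal (ε ^ 3)⁻¹ • volume := by
  rw [Measure.map_addHaar_smul _ hε.ne']
  simp only [finrank_euclideanSpace, Fintype.card_fin]
  rw [abs_of_pos (by positivity)]

lemma measurableEmbedding_smul (hε : 0 < ε) : MeasurableEmbedding fun x : R3 => ε • x :=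
  (MeasurableEquiv.smul₀ ε hε.ne').measurableEmbedding

lemma lintegral_smul (hε : 0 < ε) (F : R3 → ℝ≥0∞) :
    ∫⁻ x, F (ε • x) = ENNReal.ofReal (ε ^ 3)⁻¹ * ∫⁻ x, F x := by
  rw [← (measurableEmbedding_smul hε).lintegral_map F, map_smul_volume hε,
    lintegral_smul_measure, smul_eq_mul]

lemma ae_fib (hε : 0 < ε) {P : R3 → Prop} (h : ∀ᵐ ξ, P ξ) : ∀ᵐ τ, ∀ n, P (fib ε τ n) := by
  rw [ae_all_iff]
  intro n
  have h1 : ∀ᵐ x : R3, P (ε⁻¹ • x) := by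
    have h2 : ∀ᵐ x ∂((volume : Measure R3).map (fun x => ε⁻¹ • x)), P x := by
      rw [map_smul_volume (inv_pos.mpr hε)]
      exact Measure.ae_smul_measure h _
    exact (measurableEmbedding_smul (inv_pos.mpr hε)).ae_map_iff.mp h2
  have h3 : ∀ᵐ x ∂((volume : Measure R3).map (fun x => x + latt n)), P (ε⁻¹ • x) := by
    rw [periodicMeasure_volume n]; exact h1
  exact (MeasurableEquiv.addRight (latt n)).measurableEmbedding.ae_map_iff.mp h3

/-- The squared norm of a fibre. -/
def fibSq (ε : ℝ) (F : R3 → C3) (τ : R3) : ℝ≥0∞ := ∑' n, ‖F (fib ε τ n)‖ₑ ^ 2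

lemma fibSq_add_latt (F : R3 → C3) (τ : R3) (m : Fin 3 → ℤ) :
    fibSq ε F (τ + latt m) = fibSq ε F τ := by
  rw [fibSq, fibSq]
  simp_rw [fib_add_latt]
  exact (Equiv.addLeft m).tsum_eq fun n => ‖F (fib ε τ n)‖ₑ ^ 2

lemma aemeasurable_fib (hε : 0 < ε) {F : R3 → C3} (hF : AEStronglyMeasurable F volume)
    (n : Fin 3 → ℤ) : AEMeasurable (fun τ => ‖F (fib ε τ n)‖ₑ ^ 2) volume := by
  have h1 : Measure.QuasiMeasurePreserving (fun τ : R3 => fib ε τ n) volume volume := by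
    refine ⟨by unfold fib; fun_prop, ?_⟩
    intro s hs
    have := ae_fib hε (P := fun x => x ∉ s) (by rwa [← compl_mem_ae_iff] at hs)
    have hm : MeasurableEmbedding fun τ : R3 => fib ε τ n :=
      (measurableEmbedding_smul (inv_pos.mpr hε)).comp
        (MeasurableEquiv.addRight (latt n)).measurableEmbedding
    rw [hm.map_apply]
    rw [ae_all_iff] at this
    have h2 := this n
    rw [ae_iff] at h2
    simp only [not_not] at h2
    exact h2
  exact (hF.comp_quasiMeasurePreserving h1).enorm.pow_const 2

/-- Unfolding: the sum over `n` and the integral over one cell together run over the whole space.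
The shift `h` makes any translate of `Q` usable as the cell. -/
lemma lintegral_fibSq (hε : 0 < ε) {F : R3 → C3} (hF : AEStronglyMeasurable F volume) (h : R3) :
    ∫⁻ t in Q, fibSq ε F (t + h) = ENNReal.ofReal (ε ^ 3) * ∫⁻ ξ, ‖F ξ‖ₑ ^ 2 := by
  have e1 := lintegral_smul (inv_pos.mpr hε) fun ξ => ‖F ξ‖ₑ ^ 2
  rw [inv_pow, inv_inv] at e1
  rw [← e1, ← lintegral_add_right_eq_self (fun x => ‖F (ε⁻¹ • x)‖ₑ ^ 2) h, lintegral_eq_tsum_cell]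
  unfold fibSq
  rw [lintegral_tsum]
  · congr 1
    funext n
    refine lintegral_congr fun t => ?_
    rw [fib, add_right_comm]
  · intro n
    have hq : Measure.QuasiMeasurePreserving (fun τ : R3 => τ + h) volQ volume :=
      (measurePreserving_add_right volume h).quasiMeasurePreserving.mono_left
        Measure.restrict_le_self.absolutelyContinuous
    exact (aemeasurable_fib hε hF n).comp_quasiMeasurePreserving hq

lemma lintegral_enorm_sq_eq {α : Type*} [MeasurableSpace α] {ν : Measure α} (F : α → C3) :
    ∫⁻ ξ, ‖F ξ‖ₑ ^ 2 ∂ν = eLpNorm F 2 ν ^ 2 := by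
  have := eLpNorm_nnreal_pow_eq_lintegral (f := F) (μ := ν) (p := 2) two_ne_zero
  simp only [NNReal.coe_ofNat, ENNReal.rpow_ofNat, ENNReal.coe_ofNat] at this
  exact this.symm

lemma lintegral_fibSq_Lp (hε : 0 < ε) (F : L2R) :
    ∫⁻ t in Q, fibSq ε F t = ENNReal.ofReal (ε ^ 3) * ‖F‖ₑ ^ 2 := by
  have := lintegral_fibSq hε (Lp.aestronglyMeasurable F) 0
  simp only [add_zero] at this
  rw [this, lintegral_enorm_sq_eq, Lp.enorm_def]

lemma aemeasurable_fibSq (hε : 0 < ε) {F : R3 → C3} (hF : AEStronglyMeasurable F volume) :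
    AEMeasurable (fibSq ε F) volume :=
  AEMeasurable.tsum fun n => aemeasurable_fib hε hF n

lemma ae_of_ae_periodic {P : R3 → Prop} (hP : ∀ n τ, P τ → P (τ + latt n))
    (h : ∀ᵐ t ∂volQ, P t) : ∀ᵐ x, P x :=
  ae_of_ae_cell fun n => h.mono fun t ht => hP n t ht

lemma ae_fibSq_ne_top (hε : 0 < ε) (F : L2R) : ∀ᵐ τ, fibSq ε F τ ≠ ⊤ := by
  refine ae_of_ae_periodic (fun n τ h => by rwa [fibSq_add_latt]) ?_
  have := ae_lt_top' (aemeasurable_fibSq hε (Lp.aestronglyMeasurable F)).restrict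
    (μ := volQ) (by
      rw [lintegral_fibSq_Lp hε]
      exact ENNReal.mul_ne_top ENNReal.ofReal_ne_top (by simp))
  exact this.mono fun t ht => ht.ne

/-- Square summability of the norms makes the sum over `j` of the fibre norms integrable over a
cell, hence finite almost everywhere. The full sequence converges and no subsequence is needed. -/
lemma ae_tendsto_fibSq (hε : 0 < ε) (F : ℕ → L2R) (h : ∑' j, ‖F j‖ₑ ^ 2 ≠ ⊤) :
    ∀ᵐ τ, Tendsto (fun j => fibSq ε (F j) τ) atTop (𝓝 0) := by
  refine ae_of_ae_periodic (fun n τ h => by simpa only [fibSq_add_latt] using h) ?_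
  have hm : ∀ j, AEMeasurable (fibSq ε (F j)) volQ := fun j =>
    (aemeasurable_fibSq hε (Lp.aestronglyMeasurable (F j))).restrict
  have := ae_lt_top' (μ := volQ) (AEMeasurable.tsum hm) (by
    rw [lintegral_tsum hm]
    simp_rw [lintegral_fibSq_Lp hε]
    rw [ENNReal.tsum_mul_left]
    exact ENNReal.mul_ne_top ENNReal.ofReal_ne_top h)
  exact this.mono fun t ht => ENNReal.tendsto_atTop_zero_of_tsum_ne_top ht.ne

/-- A fibrewise estimate gives an estimate on the whole space. -/
lemma eLpNorm_le_of_fibre (hε : 0 < ε) {F G : R3 → C3} (hF : AEStronglyMeasurable F volume)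
    (hG : AEStronglyMeasurable G volume) {C : ℝ≥0∞} (hC : C ≠ ⊤)
    (h : ∀ᵐ τ, (∀ n, n ≠ 0 → 1 ≤ ‖(2 * Real.pi) • τ + dual n‖) →
      fibSq ε F τ ≤ C ^ 2 * fibSq ε G τ) : eLpNorm F 2 volume ≤ C * eLpNorm G 2 volume := by
  -- Integrating over the cell `[-1/2, 1/2)³` gives every `τ + n` with `n ≠ 0` a component of
  -- modulus at least `1/2`. Thus `|2πτ + 2πn| ≥ π`, more than the required gap.
  let c : R3 := WithLp.toLp 2 fun _ => -(1 / 2 : ℝ)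
  have hc : ∀ᵐ t ∂volQ, fibSq ε F (t + c) ≤ C ^ 2 * fibSq ε G (t + c) := by
    have h1 : ∀ᵐ t : R3, (∀ n, n ≠ 0 → 1 ≤ ‖(2 * Real.pi) • (t + c) + dual n‖) →
        fibSq ε F (t + c) ≤ C ^ 2 * fibSq ε G (t + c) :=
      (measurePreserving_add_right volume c).quasiMeasurePreserving.ae h
    filter_upwards [ae_restrict_of_ae h1, ae_restrict_mem measurableSet_Q] with t ht hQ
    refine ht fun n hn => ?_
    obtain ⟨j, hj⟩ := Function.ne_iff.mp hn
    have h2 := PiLp.norm_apply_le ((2 * Real.pi) • (t + c) + dual n) j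
    have h3 : ((2 * Real.pi) • (t + c) + dual n) j = 2 * Real.pi * (t j - 1 / 2 + n j) := by
      simp [dual_apply, c]; ring
    have h4 := hQ j
    have h5 : (1 : ℝ) / 2 ≤ |t j - 1 / 2 + n j| := by
      rcases Int.one_le_abs hj |> le_abs.mp with h6 | h6
      · have : (1 : ℝ) ≤ n j := by exact_mod_cast h6
        rw [le_abs]; left; linarith
      · have : (1 : ℝ) ≤ -n j := by exact_mod_cast h6
        rw [le_abs]; right; linarith
    rw [h3, Real.norm_eq_abs, abs_mul, abs_of_pos Real.two_pi_pos] at h2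
    nlinarith [Real.pi_gt_three]
  have h1 : ENNReal.ofReal (ε ^ 3) * ∫⁻ ξ, ‖F ξ‖ₑ ^ 2
      ≤ ENNReal.ofReal (ε ^ 3) * (C ^ 2 * ∫⁻ ξ, ‖G ξ‖ₑ ^ 2) := by
    rw [mul_left_comm, ← lintegral_fibSq hε hF c, ← lintegral_fibSq hε hG c,
      ← lintegral_const_mul' _ _ (by finiteness)]
    exact lintegral_mono_ae hc
  rw [ENNReal.mul_le_mul_iff_right (by simpa using by positivity) ENNReal.ofReal_ne_top,
    lintegral_enorm_sq_eq, lintegral_enorm_sq_eq, ← mul_pow] at h1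
  exact (ENNReal.pow_le_pow_left_iff two_ne_zero).mp h1

/-! ### The Zak transform -/

section Zak

open FourierTransform SchwartzMap

variable {ε : ℝ}

/-- The quasiperiodic sum `ε³ ∑_{k ∈ S} f(ε (y + k)) exp(-2πi τ·(y + k))`. -/
def zak (ε : ℝ) (S : Finset (Fin 3 → ℤ)) (τ : R3) (f : R3 → C3) (y : R3) : C3 :=
  ∑ k ∈ S, ((ε ^ 3 : ℝ) : ℂ) •
    (starRingEnd ℂ (pw ((2 * Real.pi) • τ) (y + latt k)) • f (ε • (y + latt k)))

/-- All cells meeting the support of `f(ε ·)` are listed in `S`. -/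
def Covers (ε : ℝ) (S : Finset (Fin 3 → ℤ)) (f : R3 → C3) : Prop :=
  ∀ k ∉ S, ∀ y ∈ Q, f (ε • (y + latt k)) = 0

lemma exists_covers (hε : 0 < ε) (r : ℝ) : ∃ S : Finset (Fin 3 → ℤ), ∀ f : R3 → C3,
    (∀ x, r ≤ ‖x‖ → f x = 0) → Covers ε S f := by
  obtain ⟨N, hN⟩ := exists_nat_gt (r / ε + 1)
  refine ⟨Finset.Icc (fun _ => -(N : ℤ)) (fun _ => N), fun f hf k hk y hy => hf _ ?_⟩
  by_contra! hlt
  refine hk (Finset.mem_Icc.mpr ?_)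
  have h1 : ∀ i, |y i + k i| < r / ε := by
    intro i
    have h2 := PiLp.norm_apply_le (ε • (y + latt k)) i
    simp only [PiLp.smul_apply, PiLp.add_apply, latt_apply, smul_eq_mul, Real.norm_eq_abs, abs_mul,
      abs_of_pos hε] at h2
    rw [lt_div_iff₀ hε]
    linarith
  constructor <;> intro i <;> have h3 := abs_lt.mp (h1 i) <;> have h4 := hy i
  · have : -(N : ℝ) ≤ k i := by linarith
    exact_mod_cast this
  · have : (k i : ℝ) ≤ N := by linarith
    exact_mod_cast this

lemma memLp_comp_smul (hε : 0 < ε) {f : R3 → C3} (hf : MemLp f 2) (k : R3) :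
    MemLp (fun y => f (ε • (y + k))) 2 := by
  have h1 : MemLp (fun y => f (ε • y)) 2 := by
    have h2 : MemLp f 2 ((volume : Measure R3).map fun x => ε • x) := by
      rw [map_smul_volume hε]
      exact hf.smul_measure ENNReal.ofReal_ne_top
    exact h2.comp_of_map (measurableEmbedding_smul hε).measurable.aemeasurable
  exact h1.comp_measurePreserving (measurePreserving_add_right volume k)

lemma MemLp.pw_smul {f : R3 → C3} {ν : Measure R3} (hf : MemLp f 2 ν) (θ k : R3) :
    MemLp (fun y => starRingEnd ℂ (pw θ (y + k)) • f y) 2 ν := by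
  refine hf.of_le (AEStronglyMeasurable.fun_smul ?_ hf.1) (Eventually.of_forall fun y => ?_)
  · exact (Complex.continuous_conj.comp
      ((continuous_pw θ).comp (continuous_add_const k))).aestronglyMeasurable
  · simp [norm_smul]

lemma memLp_zak_term (hε : 0 < ε) {f : R3 → C3} (hf : MemLp f 2) (τ : R3) (k : Fin 3 → ℤ) :
    MemLp (fun y => ((ε ^ 3 : ℝ) : ℂ) • (starRingEnd ℂ (pw ((2 * Real.pi) • τ) (y + latt k)) •
      f (ε • (y + latt k)))) 2 volQ :=
  (MemLp.pw_smul ((memLp_comp_smul hε hf (latt k)).restrict Q) ((2 * Real.pi) • τ)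
    (latt k)).const_smul ((ε ^ 3 : ℝ) : ℂ)

lemma memLp_zak (hε : 0 < ε) {f : R3 → C3} (hf : MemLp f 2) (S : Finset (Fin 3 → ℤ)) (τ : R3) :
    MemLp (zak ε S τ f) 2 volQ :=
  memLp_finsetSum S fun k _ => memLp_zak_term hε hf τ k

/-- Periodicity enters here: all the summed translates meet the same matrix, which can be pulled out
of the sum. -/
lemma app_zak {M : R3 → CMat} (hM : Periodic M) (hε : 0 < ε) (S : Finset (Fin 3 → ℤ)) (τ : R3)
    (f : R3 → C3) (y : R3) :
    app (M y) (zak ε S τ f y) = zak ε S τ (fun x => app (M (ε⁻¹ • x)) (f x)) y := by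
  have happ : ∀ N : CMat, ∀ (S : Finset (Fin 3 → ℤ)) (v : (Fin 3 → ℤ) → C3),
      app N (∑ k ∈ S, v k) = ∑ k ∈ S, app N (v k) := by
    intro N S v
    exact map_sum (⟨⟨app N, app_add N⟩, app_smul N⟩ : C3 →ₗ[ℂ] C3) v S
  rw [zak, zak, happ]
  refine Finset.sum_congr rfl fun k _ => ?_
  rw [app_smul, app_smul, smul_smul ε⁻¹ ε, inv_mul_cancel₀ hε.ne', one_smul, hM]

lemma integral_comp_smul_pos (hε : 0 < ε) (G : R3 → C3) :
    ∫ y, G (ε • y) = ((ε ^ 3)⁻¹ : ℝ) • ∫ x, G x := by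
  have := Measure.integral_comp_smul volume G ε
  simp only [finrank_euclideanSpace, Fintype.card_fin] at this
  rwa [abs_of_pos (by positivity)] at this

/-- Poisson summation by unfolding: `e_{2πn}` is constant along the lattice, so the cell integrals
of the translates add up to one integral over the space. The factor `ε³` in `zak` is the Jacobian of
`y ↦ ε y`. -/
lemma fc_zak (hε : 0 < ε) {f : R3 → C3} (hf : MemLp f 2) (hfi : Integrable f)
    {S : Finset (Fin 3 → ℤ)} (hS : Covers ε S f) (τ : R3) (n : Fin 3 → ℤ) :
    fc (zak ε S τ f) n = 𝓕 f (fib ε τ n) := by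
  set θ : R3 := (2 * Real.pi) • τ + dual n with hθ
  let G : R3 → C3 := fun y => starRingEnd ℂ (pw θ y) • f (ε • y)
  have hfε : Integrable fun y => f (ε • y) := hfi.comp_smul hε.ne'
  have hG : Integrable G := by
    exact hfε.bdd_smul (φ := fun y => starRingEnd ℂ (pw θ y)) 1
      (Complex.continuous_conj.comp (continuous_pw θ)).aestronglyMeasurable
      (Eventually.of_forall fun y => by simp)
  have hterm : ∀ (k : Fin 3 → ℤ) (y : R3), starRingEnd ℂ (pw (dual n) y) •
      (starRingEnd ℂ (pw ((2 * Real.pi) • τ) (y + latt k)) • f (ε • (y + latt k)))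
      = G (y + latt k) := by
    intro k y
    have : pw (dual n) y = pw (dual n) (y + latt k) := by rw [pw_add_right, pw_dual_latt, mul_one]
    rw [this, smul_smul, ← map_mul, mul_comm, ← pw_add_left]
  have hsum : HasSum (fun k : Fin 3 → ℤ => ∫ y in Q, G (y + latt k)) (∫ y, G y) := by
    have e := periodicMeasure_volume.eq_sum
    have h1 := hG
    rw [e] at h1
    have h2 := hasSum_integral_measure h1
    rw [← e] at h2
    refine h2.congr_fun ?_
    intro k
    exact ((MeasurableEquiv.addRight (latt k)).measurableEmbedding.integral_map G).symm
  have h0 : ∀ k ∉ S, ∫ y in Q, G (y + latt k) = 0 := by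
    intro k hk
    refine setIntegral_eq_zero_of_forall_eq_zero fun y hy => ?_
    simp only [G]
    rw [hS k hk y hy, smul_zero]
  have hfin := (hasSum_sum_of_ne_finset_zero h0).unique hsum
  have hL : fc (zak ε S τ f) n = ((ε ^ 3 : ℝ) : ℂ) • ∑ k ∈ S, ∫ y in Q, G (y + latt k) := by
    rw [fc, Finset.smul_sum]
    simp only [zak, Finset.smul_sum]
    rw [integral_finsetSum]
    · refine Finset.sum_congr rfl fun k _ => ?_
      rw [← integral_smul]
      congr 1
      funext y
      rw [smul_comm, hterm]
    · exact fun k _ => MemLp.integrable_conj_pw_smul (memLp_zak_term hε hf τ k) _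
  rw [hL, hfin, fourier_eq_integral_pw]
  have e1 : G = fun y => (fun x => starRingEnd ℂ (pw ((2 * Real.pi) • fib ε τ n) x) • f x)
      (ε • y) := by
    funext y
    simp only [G]
    congr 2
    simp only [pw, fib, hθ, dual, inner_smul_left, inner_smul_right, inner_add_left]
    congr 3
    simp
    field_simp
  rw [e1, integral_comp_smul_pos hε, Complex.coe_smul, smul_smul, mul_inv_cancel₀ (by positivity),
    one_smul]

/-- The field `f` cut off outside a ball. -/
def cutoff (f : R3 → C3) (r : ℝ) : R3 → C3 := (Metric.ball (0 : R3) r).indicator f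

lemma cutoff_eq_zero (f : R3 → C3) (r : ℝ) (x : R3) (hx : r ≤ ‖x‖) : cutoff f r x = 0 := by
  rw [cutoff, Set.indicator_of_notMem]
  simpa using hx

lemma memLp_cutoff {f : R3 → C3} (hf : MemLp f 2) (r : ℝ) : MemLp (cutoff f r) 2 :=
  hf.indicator Metric.isOpen_ball.measurableSet

lemma integrable_of_memLp_of_eq_zero {E : Type*} [NormedAddCommGroup E] {f : R3 → E}
    (hf : MemLp f 2) {r : ℝ} (h : ∀ x, r ≤ ‖x‖ → f x = 0) : Integrable f := by
  have h1 : f = (Metric.ball (0 : R3) r).indicator f := by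
    funext x
    by_cases hx : x ∈ Metric.ball (0 : R3) r
    · rw [Set.indicator_of_mem hx]
    · rw [Set.indicator_of_notMem hx]
      exact h x (by simpa using hx)
  rw [h1, integrable_indicator_iff Metric.isOpen_ball.measurableSet]
  have : IsFiniteMeasure (volume.restrict (Metric.ball (0 : R3) r)) :=
    ⟨by rw [Measure.restrict_apply_univ]; exact measure_ball_lt_top⟩
  exact (hf.restrict _).integrable (by norm_num)

lemma integrable_cutoff {f : R3 → C3} (hf : MemLp f 2) (r : ℝ) : Integrable (cutoff f r) :=
  integrable_of_memLp_of_eq_zero (memLp_cutoff hf r) (cutoff_eq_zero f r)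

lemma tendsto_zero_of_sq {ι : Type*} {l : Filter ι} {u : ι → ℝ≥0∞}
    (h : Tendsto (fun i => u i ^ 2) l (𝓝 0)) : Tendsto u l (𝓝 0) := by
  rw [ENNReal.tendsto_nhds_zero] at h ⊢
  intro δ hδ
  filter_upwards [h (δ ^ 2) (ENNReal.pow_pos hδ 2)] with i hi
  exact (ENNReal.pow_le_pow_left_iff two_ne_zero).mp hi

lemma tendsto_toLp_cutoff (f : L2R) :
    Tendsto (fun r => (memLp_cutoff (Lp.memLp f) r).toLp) atTop (𝓝 f) := by
  have key : Tendsto (fun r => eLpNorm (fun x => cutoff (⇑f) r x - f x) 2 volume ^ 2) atTop (𝓝 0) := by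
    simp_rw [← lintegral_enorm_sq_eq]
    have h0 : (0 : ℝ≥0∞) = ∫⁻ _ : R3, 0 := by simp
    rw [h0]
    have hm : Measurable f := (Lp.stronglyMeasurable f).measurable
    refine tendsto_lintegral_filter_of_dominated_convergence (fun x => ‖f x‖ₑ ^ 2) ?_ ?_ ?_ ?_
    · exact Eventually.of_forall fun r =>
        (((hm.indicator Metric.isOpen_ball.measurableSet).sub hm).enorm).pow_const 2
    · refine Eventually.of_forall fun r => Eventually.of_forall fun x => ?_
      by_cases hx : x ∈ Metric.ball (0 : R3) r <;> simp [cutoff, hx]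
    · rw [lintegral_enorm_sq_eq]
      exact ENNReal.pow_ne_top (Lp.memLp f).2.ne
    · refine Eventually.of_forall fun x => ?_
      refine tendsto_const_nhds.congr' ?_
      filter_upwards [eventually_gt_atTop ‖x‖] with r hr
      have hx : x ∈ Metric.ball (0 : R3) r := by simpa using hr
      simp [cutoff, hx]
  have h2 := (Lp.tendsto_Lp_iff_tendsto_eLpNorm'' (fun r => cutoff f r)
    (fun r => memLp_cutoff (Lp.memLp f) r) f (Lp.memLp f)).mpr (tendsto_zero_of_sq key)
  rwa [Lp.toLp_coeFn] at h2

/-- The bounded matrix field `M(·/ε)`. -/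
lemma IsBddMat.rescale {M : R3 → CMat} {C : ℝ} (hM : IsBddMat M C) (ε : ℝ) :
    IsBddMat (fun x => M (ε⁻¹ • x)) C :=
  ⟨fun i j => (hM.meas i j).comp (by fun_prop), hM.nonneg, fun y v => hM.bound _ v⟩

lemma enorm_sq_sub_eq {z : L2Q} {F : R3 → C3} {τ : R3} (h : ∀ n, cf n z = F (fib ε τ n)) :
    ‖z‖ₑ ^ 2 = fibSq ε F τ := by
  have h1 := hasSum_norm_sq_cf z
  simp_rw [h] at h1
  rw [fibSq]
  have h2 : ∀ n, ‖F (fib ε τ n)‖ₑ ^ 2 = ENNReal.ofReal (‖F (fib ε τ n)‖ ^ 2) := fun n => by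
    rw [ENNReal.ofReal_pow (norm_nonneg _), ofReal_norm]
  simp_rw [h2]
  rw [← ENNReal.ofReal_tsum_of_nonneg (fun _ => by positivity) h1.summable, h1.tsum_eq,
    ENNReal.ofReal_pow (norm_nonneg _), ofReal_norm]

lemma exists_fibre {F : R3 → C3} {τ : R3} (h : fibSq ε F τ ≠ ⊤) :
    ∃ z : L2Q, ∀ n, cf n z = F (fib ε τ n) := by
  refine exists_cf_eq ?_
  rw [fibSq] at h
  have h2 := ENNReal.summable_toReal h
  simpa using h2

lemma FT_sub_ae (f g : L2R) : ∀ᵐ ξ, FT (f - g) ξ = FT f ξ - FT g ξ := by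
  rw [map_sub]
  exact Lp.coeFn_sub _ _

/-- Multiplication by a periodic matrix acts fibrewise. -/
theorem ae_exists_fibre_mulOp {M : R3 → CMat} {C : ℝ} (hM : IsBddMat M C) (hper : Periodic M)
    (hε : 0 < ε) (f : L2R) : ∀ᵐ τ, ∃ z : L2Q, (∀ n, cf n z = FT f (fib ε τ n)) ∧
      ∀ n, cf n (mulOp hM volQ z) = FT (mulOp (hM.rescale ε) volume f) (fib ε τ n) := by
  have hlim : Tendsto (fun r => ‖(memLp_cutoff (Lp.memLp f) r).toLp - f‖ₑ ^ 2) atTop (𝓝 0) := by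
    have h1 := (tendsto_toLp_cutoff f).sub_const f
    rw [sub_self] at h1
    have h2 := ENNReal.Tendsto.pow (n := 2) h1.enorm
    simpa using h2
  -- The claim holds explicitly for cut-off fields, whose fibres are finite Zak sums. The geometric
  -- rate makes the errors summable, so that the fibres converge for almost every `τ` and the claim
  -- passes to the limit.
  have hex : ∀ j : ℕ, ∃ r : ℝ, ‖(memLp_cutoff (Lp.memLp f) r).toLp - f‖ₑ ^ 2 ≤ (2⁻¹ : ℝ≥0∞) ^ j :=
    fun j => (ENNReal.tendsto_nhds_zero.mp hlim _ (ENNReal.pow_pos (by simp) j)).exists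
  choose r hr using hex
  let c : ℕ → R3 → C3 := fun j => cutoff f (r j)
  have hc : ∀ j, MemLp (c j) 2 := fun j => memLp_cutoff (Lp.memLp f) (r j)
  let fj : ℕ → L2R := fun j => (hc j).toLp
  let T : L2R →L[ℂ] L2R := mulOp (hM.rescale ε) volume
  let c' : ℕ → R3 → C3 := fun j x => app (M (ε⁻¹ • x)) (c j x)
  have hc' : ∀ j, MemLp (c' j) 2 := fun j => (hM.rescale ε).memLp (hc j)
  have hTf : ∀ j, T (fj j) = (hc' j).toLp := fun j => mulOp_toLp (hM.rescale ε) (hc j)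
  have hci : ∀ j, Integrable (c j) := fun j => integrable_cutoff (Lp.memLp f) (r j)
  have hz' : ∀ j x, r j ≤ ‖x‖ → c' j x = 0 := fun j x hx => by
    simp only [c', c]
    rw [cutoff_eq_zero f (r j) x hx]
    simpa using app_smul (M (ε⁻¹ • x)) 0 0
  have hci' : ∀ j, Integrable (c' j) := fun j => integrable_of_memLp_of_eq_zero (hc' j) (hz' j)
  have hgeo : ∑' j : ℕ, (2⁻¹ : ℝ≥0∞) ^ j ≠ ⊤ := by
    rw [ENNReal.tsum_geometric]; simp
  have hs1 : ∑' j, ‖FT (fj j - f)‖ₑ ^ 2 ≠ ⊤ := by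
    refine ne_top_of_le_ne_top hgeo (ENNReal.tsum_le_tsum fun j => ?_)
    rw [LinearIsometryEquiv.enorm_map]
    exact hr j
  have hs2 : ∑' j, ‖FT (T (fj j - f))‖ₑ ^ 2 ≠ ⊤ := by
    have h3 : ENNReal.ofReal C ^ 2 * ∑' j : ℕ, (2⁻¹ : ℝ≥0∞) ^ j ≠ ⊤ :=
      ENNReal.mul_ne_top (ENNReal.pow_ne_top ENNReal.ofReal_ne_top) hgeo
    rw [← ENNReal.tsum_mul_left] at h3
    refine ne_top_of_le_ne_top h3 (ENNReal.tsum_le_tsum fun j => ?_)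
    rw [LinearIsometryEquiv.enorm_map]
    have h4 : ‖T (fj j - f)‖ₑ ≤ ENNReal.ofReal C * ‖fj j - f‖ₑ := by
      rw [← ofReal_norm, ← ofReal_norm, ← ENNReal.ofReal_mul hM.nonneg]
      exact ENNReal.ofReal_le_ofReal (norm_mulOp_le (hM.rescale ε) _)
    calc _ ≤ (ENNReal.ofReal C * ‖fj j - f‖ₑ) ^ 2 := by gcongr
      _ = ENNReal.ofReal C ^ 2 * ‖fj j - f‖ₑ ^ 2 := mul_pow _ _ _
      _ ≤ _ := mul_le_mul' le_rfl (hr j)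
  have a1 := ae_fib hε (ae_all_iff.mpr fun j => FT_toLp_ae_eq (hci j) (hc j))
  have a2 := ae_fib hε (ae_all_iff.mpr fun j => FT_toLp_ae_eq (hci' j) (hc' j))
  have a3 := ae_fib hε (ae_all_iff.mpr fun j => FT_sub_ae (fj j) f)
  have a4 := ae_fib hε (ae_all_iff.mpr fun j => FT_sub_ae (T (fj j)) (T f))
  filter_upwards [ae_tendsto_fibSq hε _ hs1, ae_tendsto_fibSq hε _ hs2, ae_fibSq_ne_top hε (FT f),
    a1, a2, a3, a4] with τ t1 t2 t3 a1 a2 a3 a4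
  obtain ⟨z, hz⟩ := exists_fibre t3
  refine ⟨z, hz, fun n => ?_⟩
  have hcov : ∀ j, ∃ S : Finset (Fin 3 → ℤ), Covers ε S (c j) ∧ Covers ε S (c' j) := fun j => by
    obtain ⟨S, hS⟩ := exists_covers hε (r j)
    exact ⟨S, hS _ (cutoff_eq_zero f (r j)), hS _ (hz' j)⟩
  choose S hS hS' using hcov
  let zj : ℕ → L2Q := fun j => (memLp_zak hε (hc j) (S j) τ).toLp
  have e1 : ∀ j n, cf n (zj j) = FT (fj j) (fib ε τ n) := fun j n => by
    rw [cf_toLp, fc_zak hε (hc j) (hci j) (hS j)]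
    exact (a1 n j).symm
  have e2 : ∀ j n, cf n (mulOp hM volQ (zj j)) = FT (T (fj j)) (fib ε τ n) := fun j n => by
    rw [mulOp_toLp hM (memLp_zak hε (hc j) (S j) τ), cf_toLp, hTf]
    simp_rw [app_zak hper hε]
    rw [fc_zak hε (hc' j) (hci' j) (hS' j)]
    exact (a2 n j).symm
  have l1 : Tendsto zj atTop (𝓝 z) := by
    rw [tendsto_iff_edist_tendsto_0]
    refine tendsto_zero_of_sq (t1.congr fun j => ?_)
    rw [edist_eq_enorm_sub]
    refine (enorm_sq_sub_eq fun n => ?_).symm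
    rw [map_sub, e1, hz, a3]
  have l2 : Tendsto (fun j => cf n (mulOp hM volQ (zj j))) atTop (𝓝 (cf n (mulOp hM volQ z))) :=
    ((cf n).continuous.comp (mulOp hM volQ).continuous).continuousAt.tendsto.comp l1
  have l3 : Tendsto (fun j => cf n (mulOp hM volQ (zj j))) atTop (𝓝 (FT (T f) (fib ε τ n))) := by
    rw [tendsto_iff_edist_tendsto_0]
    refine tendsto_zero_of_sq (tendsto_of_tendsto_of_tendsto_of_le_of_le tendsto_const_nhds t2
      (fun _ => bot_le) fun j => ?_)
    simp only
    rw [edist_eq_enorm_sub, e2, ← a4, ← map_sub]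
    exact ENNReal.le_tsum n
  exact tendsto_nhds_unique l2 l3

end Zak

/-! ### The coefficients -/

lemma cm_apply (M : RMat) (i j : Fin 3) : cm M i j = (M i j : ℂ) := rfl

lemma cm_mul (M N : RMat) : cm (M * N) = cm M * cm N :=
  map_mul (Complex.ofRealHom.mapMatrix : RMat →+* CMat) M N

lemma cm_one : cm 1 = 1 := map_one (Complex.ofRealHom.mapMatrix : RMat →+* CMat)

lemma isBddMat_of_entries {M : R3 → RMat} (hm : ∀ i j, Measurable fun y => M y i j) {B : ℝ}
    (hB : 0 ≤ B) (h : ∀ y i j, |M y i j| ≤ B) : IsBddMat (fun y => cm (M y)) (9 * B) := by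
  refine ⟨fun i j => Complex.measurable_ofReal.comp (hm i j), by positivity, fun y v => ?_⟩
  have h1 : ∀ i, ‖app (cm (M y)) v i‖ ≤ 3 * B * ‖v‖ := by
    intro i
    rw [app_apply]
    refine (norm_sum_le _ _).trans ?_
    have h2 : ∀ j ∈ Finset.univ, ‖cm (M y) i j * v j‖ ≤ B * ‖v‖ := by
      intro j _
      rw [norm_mul, cm_apply, Complex.norm_real, Real.norm_eq_abs]
      exact mul_le_mul (h y i j) (PiLp.norm_apply_le v j) (norm_nonneg _) hB
    refine (Finset.sum_le_sum h2).trans (le_of_eq ?_)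
    simp; ring
  have h3 : ‖app (cm (M y)) v‖ ≤ ∑ i, ‖app (cm (M y)) v i‖ := by
    rw [EuclideanSpace.norm_eq]
    exact Real.sqrt_le_iff.mpr ⟨by positivity, Finset.sum_sq_le_sq_sum_of_nonneg fun _ _ => norm_nonneg _⟩
  refine h3.trans ((Finset.sum_le_sum fun i _ => h1 i).trans (le_of_eq ?_))
  simp; ring

lemma exists_mem_Q (x : R3) : ∃ n, x + latt n ∈ Q := by
  refine ⟨fun i => -⌊x i⌋, fun i => ?_⟩
  simp only [PiLp.add_apply, latt_apply, Int.cast_neg]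
  exact ⟨by linarith [Int.floor_le (x i)], by linarith [Int.lt_floor_add_one (x i)]⟩

lemma exists_bound_of_periodic {f : R3 → ℝ} (hf : Continuous f) (hp : Periodic f) :
    ∃ C, 0 ≤ C ∧ ∀ y, |f y| ≤ C := by
  obtain ⟨C, hC⟩ := (isCompact_closedBall (0 : R3) 2).exists_bound_of_continuousOn hf.continuousOn
  refine ⟨C, (norm_nonneg _).trans (hC 0 (by simp)), fun y => ?_⟩
  obtain ⟨n, hn⟩ := exists_mem_Q y
  rw [← hp n y]
  refine hC _ ?_
  rw [mem_closedBall_zero_iff, EuclideanSpace.norm_eq]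
  refine Real.sqrt_le_iff.mpr ⟨by norm_num, ?_⟩
  have h1 : ∀ i ∈ Finset.univ, ‖(y + latt n) i‖ ^ 2 ≤ 1 := fun i _ => by
    rw [Real.norm_eq_abs, sq_abs]
    have := hn i
    nlinarith
  refine (Finset.sum_le_sum h1).trans ?_
  norm_num

lemma exists_isBddMat_of_continuous {M : R3 → RMat} (hM : ∀ i j, Continuous fun y => M y i j)
    (hp : Periodic M) : ∃ C, IsBddMat (fun y => cm (M y)) C := by
  choose C hC0 hC using fun i j => exists_bound_of_periodic (hM i j) fun n x => by rw [hp n x]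
  have h1 : ∀ i j, C i j ≤ ∑ i, ∑ j, C i j := fun i j =>
    (Finset.single_le_sum (fun j _ => hC0 i j) (Finset.mem_univ j)).trans
      (Finset.single_le_sum (f := fun i => ∑ j, C i j)
        (fun i _ => Finset.sum_nonneg fun j _ => hC0 i j) (Finset.mem_univ i))
  exact ⟨_, isBddMat_of_entries (fun i j => (hM i j).measurable) (B := ∑ i, ∑ j, C i j)
    (Finset.sum_nonneg fun i _ => Finset.sum_nonneg fun j _ => hC0 i j)
    fun y i j => (hC i j y).trans (h1 i j)⟩

/-! ### The positive square root and its regularity. -/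

section Sqrt

open scoped MatrixOrder Matrix.Norms.L2Operator

lemma msqrt_mul_self {A : RMat} (hA : A.PosDef) : msqrt A * msqrt A = A :=
  CFC.sqrt_mul_sqrt_self A hA.posSemidef.nonneg

lemma msqrt_isSymm (A : RMat) : (msqrt A).IsSymm := by
  have h : (0 : RMat) ≤ msqrt A := CFC.sqrt_nonneg A
  have h1 := (Matrix.nonneg_iff_posSemidef.mp h).isHermitian
  rwa [Matrix.IsHermitian, Matrix.conjTranspose_eq_transpose_of_trivial] at h1

lemma continuous_msqrt {A : R3 → RMat} (hA : ∀ i j, Continuous fun y => A y i j)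
    (hpos : ∀ y, (A y).PosDef) (i j : Fin 3) : Continuous fun y => msqrt (A y) i j := by
  have hc : Continuous A := continuous_matrix hA
  have h0 : ∀ y, 0 ≤ A y := fun y => (hpos y).posSemidef.nonneg
  have h1 : Continuous fun y => msqrt (A y) := by
    rw [← continuousOn_univ]
    have h2 := ContinuousOn.cfc_nnreal_of_mem_nhdsSet (s := Set.univ) NNReal.sqrt Filter.univ_mem
      hc.continuousOn (fun y _ => h0 y) NNReal.continuous_sqrt.continuousOn (t := Set.univ)
    refine h2.congr fun y _ => ?_
    exact CFC.sqrt_eq_cfc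
  exact h1.matrix_elem i j

end Sqrt

lemma det_msqrt_ne_zero {A : RMat} (hA : A.PosDef) : (msqrt A).det ≠ 0 := by
  intro h
  have h1 := hA.det_pos
  rw [← msqrt_mul_self hA, Matrix.det_mul, h] at h1
  simp at h1

lemma continuous_inv_apply {M : R3 → RMat} (hM : ∀ i j, Continuous fun y => M y i j)
    (h : ∀ y, (M y).det ≠ 0) (i j : Fin 3) : Continuous fun y => (M y)⁻¹ i j := by
  have hc : Continuous M := continuous_matrix hM
  simp_rw [Matrix.inv_def, Ring.inverse_eq_inv', Matrix.smul_apply, smul_eq_mul]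
  exact (hc.matrix_det.inv₀ h).mul (hc.matrix_adjugate.matrix_elem i j)

lemma inner_app_symm {M : RMat} (hM : M.IsSymm) (v w : C3) :
    inner ℂ (app (cm M) v) w = inner ℂ v (app (cm M) w) := by
  have h : ∀ i j, M i j = M j i := fun i j => (hM.apply i j).symm
  simp only [PiLp.inner_apply, RCLike.inner_apply, app_apply, cm_apply, Fin.sum_univ_three, map_add,
    map_mul, Complex.conj_ofReal]
  rw [h 1 0, h 2 0, h 2 1]
  ring

lemma inner_app_re (M : RMat) (v : C3) :
    (inner ℂ v (app (cm M) v)).re = (fun i => (v i).re) ⬝ᵥ (M *ᵥ fun i => (v i).re)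
      + (fun i => (v i).im) ⬝ᵥ (M *ᵥ fun i => (v i).im) := by
  simp only [PiLp.inner_apply, RCLike.inner_apply, app_apply, cm_apply, Fin.sum_univ_three,
    dotProduct, Matrix.mulVec]
  simp
  ring

lemma norm_sq_eq_dotProduct (v : C3) : ‖v‖ ^ 2 = (fun i => (v i).re) ⬝ᵥ (fun i => (v i).re)
    + (fun i => (v i).im) ⬝ᵥ (fun i => (v i).im) := by
  rw [EuclideanSpace.norm_sq_eq]
  simp only [Complex.sq_norm, Complex.normSq_apply, dotProduct, Fin.sum_univ_three]
  ring

/-- A symmetric, periodic, bounded and uniformly positive matrix field. -/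
structure IsCoeff (M : R3 → RMat) (a C : ℝ) : Prop where
  pos : 0 < a
  per : Periodic M
  symm : ∀ y, (M y).IsSymm
  bdd : IsBddMat (fun y => cm (M y)) C
  lower : ∀ y v, a * ‖v‖ ^ 2 ≤ (inner ℂ v (app (cm (M y)) v)).re

lemma exists_isCoeff {M : R3 → RMat} (hper : Periodic M) (hsymm : ∀ y, (M y).IsSymm)
    (hmeas : ∀ i j, Measurable fun y => M y i j) {a b : ℝ} (ha : 0 < a)
    (hlow : ∀ (y : R3) (v : Fin 3 → ℝ), a * (v ⬝ᵥ v) ≤ v ⬝ᵥ (M y *ᵥ v))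
    (hup : ∀ (y : R3) (v : Fin 3 → ℝ), v ⬝ᵥ (M y *ᵥ v) ≤ b * (v ⬝ᵥ v)) :
    ∃ C, IsCoeff M a C := by
  have hself : ∀ v : Fin 3 → ℝ, 0 ≤ v ⬝ᵥ v := fun v => by
    simp only [dotProduct, Fin.sum_univ_three]
    nlinarith [mul_self_nonneg (v 0), mul_self_nonneg (v 1), mul_self_nonneg (v 2)]
  have hb : 0 ≤ b := by
    have h1 := (hlow 0 ![1, 0, 0]).trans (hup 0 ![1, 0, 0])
    simp [dotProduct, Fin.sum_univ_three] at h1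
    linarith
  have hnn : ∀ y v, 0 ≤ v ⬝ᵥ (M y *ᵥ v) := fun y v =>
    (mul_nonneg ha.le (hself v)).trans (hlow y v)
  -- The form is nonnegative on `e_i ± e_j`, which bounds an off-diagonal entry by the diagonal
  -- ones; the factor `2` is slack.
  have hent : ∀ y i j, |M y i j| ≤ 2 * b := by
    intro y i j
    have hs := (hsymm y).apply i j
    have e1 : ∀ i, (Pi.single i 1 : Fin 3 → ℝ) ⬝ᵥ (Pi.single i 1) = 1 := fun i => by simp
    have h1 : ∀ i, M y i i ≤ b := fun i => by simpa using hup y (Pi.single i 1)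
    have h2 := hnn y (Pi.single i 1 + Pi.single j 1)
    have h3 := hnn y (Pi.single i 1 - Pi.single j 1)
    simp [Matrix.mulVec_add, Matrix.mulVec_sub, dotProduct_add, add_dotProduct, dotProduct_sub,
      sub_dotProduct, hs] at h2 h3
    have := h1 i
    have := h1 j
    rw [abs_le]
    constructor <;> linarith
  refine ⟨_, ha, hper, hsymm, isBddMat_of_entries hmeas (by positivity) hent, fun y v => ?_⟩
  rw [inner_app_re, norm_sq_eq_dotProduct, mul_add]
  exact add_le_add (hlow y _) (hlow y _)

lemma app_cm_inv {S : RMat} (h : S.det ≠ 0) (v : C3) : app (cm S) (app (cm S⁻¹) v) = v := by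
  rw [← app_mul, ← cm_mul, Matrix.mul_nonsing_inv _ (isUnit_iff_ne_zero.mpr h), cm_one, app_one]

lemma app_inv_cm {S : RMat} (h : S.det ≠ 0) (v : C3) : app (cm S⁻¹) (app (cm S) v) = v := by
  rw [← app_mul, ← cm_mul, Matrix.nonsing_inv_mul _ (isUnit_iff_ne_zero.mpr h), cm_one, app_one]

lemma cm_inv_eq {A : RMat} (hA : A.PosDef) : cm A⁻¹ = cm (msqrt A)⁻¹ * cm (msqrt A)⁻¹ := by
  rw [← cm_mul, ← Matrix.mul_inv_rev, msqrt_mul_self hA]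

lemma msqrt_inv_isSymm (A : RMat) : ((msqrt A)⁻¹).IsSymm := by
  rw [Matrix.IsSymm, Matrix.transpose_nonsing_inv, msqrt_isSymm]

/-- The square root `A^{1/2}`, its inverse and `A⁻¹` are bounded coefficients. -/
structure IsRootCoeff (A : R3 → RMat) (C C' a b : ℝ) : Prop where
  posDef : ∀ y, (A y).PosDef
  per : Periodic A
  root : IsBddMat (fun y => cm (msqrt (A y))) C
  root_inv : IsBddMat (fun y => cm (msqrt (A y))⁻¹) C'
  inv : IsCoeff (fun y => (A y)⁻¹) a b

lemma exists_isRootCoeff {A : R3 → RMat} (hper : Periodic A) (hpos : ∀ y, (A y).PosDef)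
    (hreg : ∀ i j, ContDiff ℝ 1 fun y => A y i j) : ∃ C C' a b, IsRootCoeff A C C' a b := by
  have hc := continuous_msqrt (fun i j => (hreg i j).continuous) hpos
  have hci := continuous_inv_apply hc fun y => det_msqrt_ne_zero (hpos y)
  have hcA := continuous_inv_apply (fun i j => (hreg i j).continuous) fun y => (hpos y).det_pos.ne'
  obtain ⟨C, hC⟩ := exists_isBddMat_of_continuous hc fun n x => by rw [hper n x]
  obtain ⟨C', hC'⟩ := exists_isBddMat_of_continuous hci fun n x => by rw [hper n x]
  obtain ⟨b, hb⟩ := exists_isBddMat_of_continuous hcA fun n x => by rw [hper n x]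
  have hC1 : 0 < C + 1 := by linarith [hC.nonneg]
  refine ⟨C, C', ((C + 1) ^ 2)⁻¹, b, hpos, hper, hC, hC',
    ⟨by positivity, fun n x => by rw [hper n x], fun y => ?_, hb, fun y v => ?_⟩⟩
  · have h1 := (hpos y).isHermitian
    rw [Matrix.IsHermitian, Matrix.conjTranspose_eq_transpose_of_trivial] at h1
    rw [Matrix.IsSymm, Matrix.transpose_nonsing_inv, h1]
  · rw [cm_inv_eq (hpos y), app_mul, ← inner_app_symm (msqrt_inv_isSymm _), inner_self_eq_norm_sq_to_K]
    -- The form of `A⁻¹` is `|A^{-1/2} v|²`, so its lower bound is an upper bound for `A^{1/2}`. The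
    -- constant `C + 1` is used because `C` is only known to be nonnegative.
    have h1 : ‖v‖ ≤ (C + 1) * ‖app (cm (msqrt (A y))⁻¹) v‖ := by
      have h2 := hC.bound y (app (cm (msqrt (A y))⁻¹) v)
      rw [app_cm_inv (det_msqrt_ne_zero (hpos y))] at h2
      nlinarith [norm_nonneg (app (cm (msqrt (A y))⁻¹) v)]
    rw [inv_mul_le_iff₀ (by positivity)]
    have h3 := pow_le_pow_left₀ (norm_nonneg v) h1 2
    rw [mul_pow] at h3
    refine h3.trans (le_of_eq ?_)
    congr 1
    norm_cast

lemma IsCoeff.isCoerc {M : R3 → RMat} {a C : ℝ} (h : IsCoeff M a C) :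
    IsCoerc (mulOp h.bdd volQ) a C :=
  ⟨h.pos, mulOp_coercive h.bdd h.lower, h.bdd.nonneg, norm_mulOp_le h.bdd⟩

lemma IsCoeff.per_cm {M : R3 → RMat} {a C : ℝ} (h : IsCoeff M a C) :
    Periodic fun y => cm (M y) := fun n x => congrArg cm (h.per n x)

lemma IsCoeff.inner_mulOp {M : R3 → RMat} {a C : ℝ} (h : IsCoeff M a C) {ν : Measure R3}
    (f g : Lp C3 2 ν) : inner ℂ (mulOp h.bdd ν f) g = inner ℂ f (mulOp h.bdd ν g) :=
  mulOp_symm h.bdd (fun y => inner_app_symm (h.symm y)) f g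

/-! ### Fourier coefficients of periodic gradients and curls -/

section PeriodicFields

lemma pd_mul {f g : R3 → ℂ} {x : R3} (hf : DifferentiableAt ℝ f x) (hg : DifferentiableAt ℝ g x)
    (j : Fin 3) : pd j (fun y => f y * g y) x = pd j f x * g x + f x * pd j g x := by
  simp only [pd]
  rw [fderiv_fun_mul hf hg]
  simp only [add_apply, smul_apply, smul_eq_mul]
  ring

lemma contDiff_pd {f : R3 → ℂ} (hf : ContDiff ℝ ∞ f) (j : Fin 3) : ContDiff ℝ ∞ (pd j f) :=
  (hf.fderiv_right (m := ∞) (by simp)).clm_apply contDiff_const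

lemma PerTest.pd {f : R3 → ℂ} (hf : PerTest f) (j : Fin 3) : PerTest (pd j f) := by
  refine ⟨contDiff_pd hf.1 j, fun n x => ?_⟩
  have h : f = fun y => f (y + latt n) := funext fun y => (hf.2 n y).symm
  conv_rhs => rw [h]
  rw [PeriodicMaxwell.pd, PeriodicMaxwell.pd, fderiv_comp_add_right]

lemma PerTest.apply {F : R3 → C3} (hF : PerTest F) (i : Fin 3) : PerTest fun y => F y i :=
  ⟨(contDiff_piLp _ |>.mp hF.1) i, fun n x => by simp only [hF.2 n x]⟩

lemma PerTest.mul {f g : R3 → ℂ} (hf : PerTest f) (hg : PerTest g) :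
    PerTest fun y => f y * g y :=
  ⟨hf.1.mul hg.1, fun n x => by simp only [hf.2 n x, hg.2 n x]⟩

lemma PerTest.sub {f g : R3 → ℂ} (hf : PerTest f) (hg : PerTest g) :
    PerTest fun y => f y - g y :=
  ⟨hf.1.sub hg.1, fun n x => by simp only [hf.2 n x, hg.2 n x]⟩

lemma PerTest.toLp {f : Fin 3 → R3 → ℂ} (hf : ∀ i, PerTest (f i)) :
    PerTest (E := C3) fun y => WithLp.toLp 2 fun i => f i y := by
  refine ⟨?_, fun n x => by simp only [(hf _).2 n x]⟩
  exact (PiLp.contDiff_toLp (𝕜 := ℝ) (p := 2) (n := ∞)).comp (contDiff_pi.mpr fun i => (hf i).1)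

lemma PerTest.grad {f : R3 → ℂ} (hf : PerTest f) : PerTest (grad f) := PerTest.toLp fun i => hf.pd i

lemma curl_apply (F : R3 → C3) (x : R3) (i : Fin 3) : curl F x i =
    pd (i + 1) (fun y => F y (i + 2)) x - pd (i + 2) (fun y => F y (i + 1)) x := by
  fin_cases i <;> rfl

lemma PerTest.curl {F : R3 → C3} (hF : PerTest F) : PerTest (PeriodicMaxwell.curl F) := by
  have : PeriodicMaxwell.curl F = fun y => WithLp.toLp 2 fun i =>
      PeriodicMaxwell.pd (i + 1) (fun y => F y (i + 2)) y
        - PeriodicMaxwell.pd (i + 2) (fun y => F y (i + 1)) y := by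
    funext y; ext i; exact curl_apply F y i
  rw [this]
  exact PerTest.toLp fun i => ((hF.apply _).pd _).sub ((hF.apply _).pd _)

variable {E : Type*} [NormedAddCommGroup E]

lemma PerTest.memLp [NormedSpace ℝ E] {f : R3 → E} (hf : PerTest f) : MemLp f 2 volQ := by
  obtain ⟨C, -, hC⟩ := exists_bound_of_periodic hf.1.continuous.norm fun n x => by rw [hf.2 n x]
  exact MemLp.of_bound hf.1.continuous.aestronglyMeasurable C (Eventually.of_forall fun y =>
    (le_abs_self _).trans (hC y))

/-- The device by which identities valid for smooth fields pass to the closures in the definitions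
of the Sobolev spaces. -/
lemma eq_of_forall_enorm_sub_le {a b : E} {K : ℝ≥0∞} (hK : K ≠ ⊤)
    (h : ∀ δ : ℝ, 0 < δ → ‖a - b‖ₑ ≤ K * ENNReal.ofReal δ) : a = b := by
  by_contra hne
  have h0 : ‖a - b‖ₑ ≠ 0 := by simpa [sub_eq_zero] using hne
  lift K to NNReal using hK
  have h1 : Tendsto (fun δ : ℝ => (K : ℝ≥0∞) * ENNReal.ofReal δ) (𝓝[>] 0) (𝓝 (K * 0)) := by
    refine ENNReal.Tendsto.const_mul ?_ (Or.inr ENNReal.coe_ne_top)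
    have := (ENNReal.continuous_ofReal.tendsto 0).mono_left (nhdsWithin_le_nhds (s := Set.Ioi 0))
    simpa using this
  rw [mul_zero] at h1
  have h2 := ge_of_tendsto h1 (eventually_nhdsWithin_of_forall fun δ hδ => h δ hδ)
  exact h0 (le_antisymm h2 bot_le)

variable [NormedSpace ℂ E]

lemma fc_add {f g : R3 → E} (hf : MemLp f 2 volQ) (hg : MemLp g 2 volQ) (n : Fin 3 → ℤ) :
    fc (fun y => f y + g y) n = fc f n + fc g n := by
  simp only [fc, smul_add]
  exact integral_add (MemLp.integrable_conj_pw_smul hf _) (MemLp.integrable_conj_pw_smul hg _)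

lemma fc_sub {f g : R3 → E} (hf : MemLp f 2 volQ) (hg : MemLp g 2 volQ) (n : Fin 3 → ℤ) :
    fc (fun y => f y - g y) n = fc f n - fc g n := by
  simp only [fc, smul_sub]
  exact integral_sub (MemLp.integrable_conj_pw_smul hf _) (MemLp.integrable_conj_pw_smul hg _)

lemma enorm_fc_le {f : R3 → E} (hf : AEStronglyMeasurable f volQ) (n : Fin 3 → ℤ) :
    ‖fc f n‖ₑ ≤ eLpNorm f 2 volQ := by
  rw [fc]
  refine (enorm_integral_le_lintegral_enorm _).trans ?_
  have h1 : ∀ y, ‖starRingEnd ℂ (pw (dual n) y) • f y‖ₑ = ‖f y‖ₑ := fun y => by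
    rw [enorm_smul, ← ofReal_norm (starRingEnd ℂ _), RCLike.norm_conj, norm_pw, ENNReal.ofReal_one,
      one_mul]
  simp_rw [h1]
  rw [← eLpNorm_one_eq_lintegral_enorm]
  exact eLpNorm_le_eLpNorm_of_exponent_le (by norm_num) hf

lemma enorm_crI_le (k : R3) (v : C3) : ‖crI k v‖ₑ ≤ ‖k‖ₑ * ‖v‖ₑ := by
  rw [← ofReal_norm, ← ofReal_norm, ← ofReal_norm, ← ENNReal.ofReal_mul (norm_nonneg _)]
  exact ENNReal.ofReal_le_ofReal (norm_crI_le k v)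

lemma dual_neg (n : Fin 3 → ℤ) : dual (-n) = -dual n := by
  rw [← zero_sub n, ← dual_sub, dual_zero, zero_sub]

variable {φ : R3 → ℂ} {F : R3 → C3}

/-- Integration by parts without boundary terms: the product `e_{-2πn} φ` is again periodic, so its
derivative has mean zero. -/
lemma fc_pd (hgrad : ∀ φ : R3 → ℂ, PerTest φ → ∀ j, ∫ y in Q, pd j φ y = 0) (hφ : PerTest φ)
    (j : Fin 3) (n : Fin 3 → ℤ) : fc (pd j φ) n = Complex.I * dual n j * fc φ n := by
  have h := hgrad _ ((perTest_pw (-n)).mul hφ) j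
  have e : ∀ y, pd j (fun y => pw (dual (-n)) y * φ y) y
      = -(Complex.I * dual n j) * (starRingEnd ℂ (pw (dual n) y) • φ y)
        + starRingEnd ℂ (pw (dual n) y) • pd j φ y := fun y => by
    rw [pd_mul ((contDiff_pw _).differentiable (by simp) y) (hφ.1.differentiable (by simp) y),
      pd_pw, dual_neg, pw_neg_left]
    simp only [PiLp.neg_apply, smul_eq_mul]
    push_cast
    ring
  simp_rw [e] at h
  rw [integral_add ((MemLp.integrable_conj_pw_smul hφ.memLp _).const_mul _)
    (MemLp.integrable_conj_pw_smul (hφ.pd j).memLp _), integral_const_mul] at h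
  simp only [fc]
  linear_combination h

lemma fc_grad (hgrad : ∀ φ : R3 → ℂ, PerTest φ → ∀ j, ∫ y in Q, pd j φ y = 0) (hφ : PerTest φ)
    (n : Fin 3 → ℤ) : fc (grad φ) n = (Complex.I * fc φ n) • cv (dual n) := by
  ext i
  rw [fc_apply hφ.grad.memLp]
  refine (fc_pd hgrad hφ i n).trans ?_
  simp only [PiLp.smul_apply, cv_apply, smul_eq_mul]
  ring

lemma fc_curl (hgrad : ∀ φ : R3 → ℂ, PerTest φ → ∀ j, ∫ y in Q, pd j φ y = 0) (hF : PerTest F)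
    (n : Fin 3 → ℤ) : fc (curl F) n = crI (dual n) (fc F n) := by
  ext i
  rw [fc_apply hF.curl.memLp]
  have h : fc (fun y => curl F y i) n
      = Complex.I * dual n (i + 1) * fc F n (i + 2) - Complex.I * dual n (i + 2) * fc F n (i + 1) := by
    simp_rw [curl_apply]
    rw [fc_sub ((hF.apply _).pd _).memLp ((hF.apply _).pd _).memLp, fc_pd hgrad (hF.apply _),
      fc_pd hgrad (hF.apply _), fc_apply hF.memLp, fc_apply hF.memLp]
  rw [h, crI_apply]
  fin_cases i <;> simp <;> ring

/-- Each Fourier coefficient is continuous for the `L²` norm. In particular the gradient is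
determined by the function, which need not happen for a general measure. -/
lemma MemHOneZero.fc_eq (hgrad : ∀ φ : R3 → ℂ, PerTest φ → ∀ j, ∫ y in Q, pd j φ y = 0)
    {ψ : R3 → ℂ} {p : R3 → C3} (h : MemHOneZero volume ψ p) (n : Fin 3 → ℤ) :
    fc p n = (Complex.I * fc ψ n) • cv (dual n) := by
  obtain ⟨hψ, hp, h⟩ := h
  refine eq_of_forall_enorm_sub_le (K := 1 + ‖cv (dual n)‖ₑ) (by simp) fun δ hδ => ?_
  obtain ⟨φ, hφ, h1, h2⟩ := h δ hδ
  have e : fc p n - (Complex.I * fc ψ n) • cv (dual n) = fc (fun y => p y - grad φ y) n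
      - (Complex.I * fc (fun y => ψ y - φ y) n) • cv (dual n) := by
    rw [fc_sub hp hφ.1.grad.memLp, fc_sub hψ hφ.1.memLp, fc_grad hgrad hφ.1]
    module
  rw [e, add_mul, one_mul]
  refine (enorm_sub_le).trans (add_le_add ?_ ?_)
  · exact (enorm_fc_le (hp.sub hφ.1.grad.memLp).1 n).trans h2
  · rw [enorm_smul, enorm_mul, mul_comm]
    have : ‖Complex.I‖ₑ = 1 := by rw [← ofReal_norm]; simp
    rw [this, one_mul]
    exact mul_le_mul' le_rfl ((enorm_fc_le (hψ.sub hφ.1.memLp).1 n).trans h1)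

lemma PerTestZero.fc_zero {φ : R3 → ℂ} (h : PerTestZero volume φ) : fc φ 0 = 0 := by
  have := h.2
  simpa [fc, dual_zero] using this

lemma MemHOneZero.fc_zero {ψ : R3 → ℂ} {p : R3 → C3} (h : MemHOneZero volume ψ p) :
    fc ψ 0 = 0 := by
  obtain ⟨hψ, -, h⟩ := h
  refine eq_of_forall_enorm_sub_le (K := 1) (by simp) fun δ hδ => ?_
  obtain ⟨φ, hφ, h1, -⟩ := h δ hδ
  have e : fc ψ 0 - 0 = fc (fun y => ψ y - φ y) 0 := by
    rw [fc_sub hψ hφ.1.memLp, hφ.fc_zero]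
  rw [e, one_mul]
  exact (enorm_fc_le (hψ.sub hφ.1.memLp).1 0).trans h1

lemma MemHCurlPer.fc_eq (hgrad : ∀ φ : R3 → ℂ, PerTest φ → ∀ j, ∫ y in Q, pd j φ y = 0)
    {A : R3 → RMat} {C : ℝ} (hS : IsBddMat (fun y => cm (msqrt (A y))) C) {φ w : R3 → C3}
    (h : MemHCurlPer volume A φ w) (n : Fin 3 → ℤ) :
    fc w n = crI (dual n) (fc (fun y => app (cm (msqrt (A y))) (φ y)) n) := by
  obtain ⟨hφ, hw, h⟩ := h
  refine eq_of_forall_enorm_sub_le (K := 1 + ‖dual n‖ₑ * ENNReal.ofReal C)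
    (ENNReal.add_ne_top.mpr ⟨ENNReal.one_ne_top,
      ENNReal.mul_ne_top enorm_ne_top ENNReal.ofReal_ne_top⟩) fun δ hδ => ?_
  obtain ⟨f, hf, h1, h2⟩ := h δ hδ
  have e0 : ∀ y, app (cm (msqrt (A y))) (φ y) - app (cm (msqrt (A y))) (f y)
      = app (cm (msqrt (A y))) (φ y - f y) := fun y => (app_sub _ _ _).symm
  have e : fc w n - crI (dual n) (fc (fun y => app (cm (msqrt (A y))) (φ y)) n)
      = fc (fun y => w y - curl (fun z => app (cm (msqrt (A z))) (f z)) y) n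
        - crI (dual n) (fc (fun y => app (cm (msqrt (A y))) (φ y - f y)) n) := by
    simp_rw [← e0]
    rw [fc_sub hw hf.curl.memLp, fc_sub (hS.memLp hφ) hf.memLp, fc_curl hgrad hf, crI_sub]
    abel
  rw [e, add_mul, one_mul]
  refine (enorm_sub_le).trans (add_le_add ?_ ((enorm_crI_le _ _).trans ?_))
  · exact (enorm_fc_le (hw.sub hf.curl.memLp).1 n).trans h2
  · rw [mul_assoc]
    refine mul_le_mul' le_rfl ((enorm_fc_le ?_ n).trans ((hS.eLpNorm_le _).trans
      (mul_le_mul' le_rfl h1)))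
    simp_rw [← e0]
    exact ((hS.memLp hφ).sub hf.memLp).1

end PeriodicFields

/-! ### The electric cell problem -/

section CellProblems

lemma memLp_smul_const {ψ : R3 → ℂ} (hψ : MemLp ψ 2 volQ) (v : C3) :
    MemLp (fun y => (Complex.I * ψ y) • v) 2 volQ := by
  have h := (hψ.const_mul Complex.I).continuousLinearMap_comp
    ((ContinuousLinearMap.id ℂ ℂ).smulRight v)
  exact h

lemma memLp_gradK_add {ψ : R3 → ℂ} {p : R3 → C3} (h : MemHOneZero volume ψ p) (κ : R3) (c : C3) :
    MemLp (fun y => gradK κ ψ p y + c) 2 volQ :=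
  (h.2.1.add (memLp_smul_const h.1 _)).add (memLp_const c)

lemma fc_const (c : C3) (n : Fin 3 → ℤ) : fc (fun _ => c) n = if n = 0 then c else 0 := by
  rw [← fc_pw_smul 0 n c]
  simp [dual_zero]

section


lemma fc_gradK_add (hgrad : ∀ φ : R3 → ℂ, PerTest φ → ∀ j, ∫ y in Q, pd j φ y = 0)
    {ψ : R3 → ℂ} {p : R3 → C3} (h : MemHOneZero volume ψ p) (κ : R3) (c : C3) (n : Fin 3 → ℤ) :
    fc (fun y => gradK κ ψ p y + c) n
      = (Complex.I * fc ψ n) • cv (κ + dual n) + if n = 0 then c else 0 := by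
  have h1 : fc (fun y => (Complex.I * ψ y) • cv κ) n = (Complex.I * fc ψ n) • cv κ := by
    simp only [fc]
    rw [← integral_const_mul, ← integral_smul_const]
    refine integral_congr_ae (Eventually.of_forall fun y => ?_)
    simp only [smul_smul, smul_eq_mul]
    congr 1
    ring
  simp only [gradK]
  have h2 : MemLp (fun y => p y + (Complex.I * ψ y) • cv κ) 2 volQ :=
    h.2.1.add (memLp_smul_const h.1 _)
  rw [fc_add h2 (memLp_const c), fc_add h.2.1 (memLp_smul_const h.1 _), h1, h.fc_eq hgrad, fc_const, cv_add]
  module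

lemma memHOneZero_of_perTestZero {φ : R3 → ℂ} (h : PerTestZero volume φ) :
    MemHOneZero volume φ (grad φ) :=
  ⟨h.1.memLp, h.1.grad.memLp, fun δ _ => ⟨φ, h, by simp, by simp⟩⟩

lemma integral_cdot_pw_smul {f : R3 → C3} (hf : MemLp f 2 volQ) (n : Fin 3 → ℤ) (v : C3) :
    ∫ y in Q, cdot (f y) (pw (dual n) y • v) = inner ℂ v (fc f n) := by
  rw [fc, ← integral_inner (MemLp.integrable_conj_pw_smul hf _)]
  refine integral_congr_ae (Eventually.of_forall fun y => ?_)
  simp only [cdot_eq_inner, inner_smul_left, inner_smul_right]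

lemma integral_cdot_eq_inner {ν : Measure R3} {f g : R3 → C3} (hf : MemLp f 2 ν)
    (hg : MemLp g 2 ν) : ∫ y, cdot (f y) (g y) ∂ν = inner ℂ (hg.toLp g) (hf.toLp f) := by
  rw [L2.inner_def]
  refine integral_congr_ae ?_
  filter_upwards [hf.coeFn_toLp, hg.coeFn_toLp] with y h1 h2
  rw [h1, h2, cdot_eq_inner]

lemma perTestZero_pw {n : Fin 3 → ℤ} (hn : n ≠ 0) : PerTestZero volume (pw (dual n)) :=
  ⟨perTest_pw n, by rw [integral_pw_dual, if_neg hn]⟩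

lemma gradK_pw (κ : R3) (n : Fin 3 → ℤ) (y : R3) :
    gradK κ (pw (dual n)) (grad (pw (dual n))) y
      = pw (dual n) y • (Complex.I • cv (κ + dual n)) := by
  ext i
  simp only [gradK, grad, pd_pw, cv_add, PiLp.add_apply, PiLp.smul_apply, smul_eq_mul, cv_apply]
  ring

variable {A : R3 → RMat} {α β : ℝ}

/-- The exponentials `e_{2πn}` with `n ≠ 0` have mean zero and are therefore admissible test
functions. Testing with them gives the divergence condition on every mode but the zeroth. -/
lemma IsCellSolution.isElCorr
    (hgrad : ∀ φ : R3 → ℂ, PerTest φ → ∀ j, ∫ y in Q, pd j φ y = 0)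
    (hA : IsCoeff (fun y => (A y)⁻¹) α β) {κ : R3} {c : C3} {ψ : R3 → ℂ} {p : R3 → C3}
    (h : IsCellSolution volume A κ c ψ p) :
    IsElCorr (mulOp hA.bdd volQ) κ c (memLp_gradK_add h.2.2.1 κ c).toLp := by
  refine ⟨?_, fun n hn => ?_, fun n hn => ?_⟩
  · rw [cf_toLp, fc_gradK_add hgrad h.2.2.1, h.2.2.1.fc_zero]
    simp
  · rw [cf_toLp, fc_gradK_add hgrad h.2.2.1, if_neg hn, add_zero]
    exact ⟨_, rfl⟩
  · rw [mulOp_toLp hA.bdd (memLp_gradK_add h.2.2.1 κ c), cf_toLp]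
    have h1 := h.2.2.2 _ (perTestZero_pw hn)
    simp_rw [gradK_pw] at h1
    rw [integral_cdot_pw_smul (hA.bdd.memLp (memLp_gradK_add h.2.2.1 κ c)), inner_smul_left] at h1
    simpa using h1

end

/-! ### Approximation by trigonometric polynomials. -/

lemma ev_eq_sum (n : Fin 3 → ℤ) (v : C3) : ev n v = ∑ i, v i • ev n (EuclideanSpace.single i 1) := by
  refine ext_cf fun m => ?_
  simp only [map_sum, map_smul, cf_ev]
  split_ifs
  · ext j
    simp [Pi.single_apply]
  · simp

lemma hasSum_ev_cf (z : L2Q) : HasSum (fun n => ev n (cf n z)) z := by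
  refine (expBasis.hasSum_repr z).prod_fiberwise fun n => ?_
  rw [ev_eq_sum]
  simp only [HilbertBasis.repr_apply_apply, expBasis_apply, cf_apply]
  exact hasSum_fintype _

lemma coeFn_sum_ev (S : Finset (Fin 3 → ℤ)) (a : (Fin 3 → ℤ) → C3) :
    ⇑(∑ n ∈ S, ev n (a n)) =ᵐ[volQ] fun y => ∑ n ∈ S, pw (dual n) y • a n := by
  have h : ∀ n, ev n (a n) =ᵐ[volQ] fun y => pw (dual n) y • a n := fun n =>
    MemLp.coeFn_toLp (memLp_pw_smul (dual n) (a n))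
  filter_upwards [Lp.coeFn_finsetSum S fun n => ev n (a n), ae_all_iff.mpr h] with y h1 h2
  rw [h1, Finset.sum_apply]
  exact Finset.sum_congr rfl fun n _ => h2 n

lemma eventually_eLpNorm_sub_le (z : L2Q) {δ : ℝ} (hδ : 0 < δ) : ∀ᶠ S in atTop,
    eLpNorm (fun y => z y - ∑ n ∈ S, pw (dual n) y • cf n z) 2 volQ ≤ ENNReal.ofReal δ := by
  have h1 : Tendsto (fun S : Finset (Fin 3 → ℤ) => ‖z - ∑ n ∈ S, ev n (cf n z)‖) atTop (𝓝 0) := by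
    have h2 := (tendsto_const_nhds (x := z)).sub (hasSum_ev_cf z)
    simpa using h2.norm
  filter_upwards [h1.eventually (gt_mem_nhds hδ)] with S hS
  have h3 : eLpNorm (fun y => z y - ∑ n ∈ S, pw (dual n) y • cf n z) 2 volQ
      = ‖z - ∑ n ∈ S, ev n (cf n z)‖ₑ := by
    rw [Lp.enorm_def]
    refine eLpNorm_congr_ae ?_
    filter_upwards [Lp.coeFn_sub z (∑ n ∈ S, ev n (cf n z)), coeFn_sum_ev S fun n => cf n z]
      with y e1 e2
    rw [e1, Pi.sub_apply, e2]
  rw [h3, ← ofReal_norm]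
  exact ENNReal.ofReal_le_ofReal hS.le

lemma contDiff_trig (S : Finset (Fin 3 → ℤ)) (a : (Fin 3 → ℤ) → ℂ) :
    ContDiff ℝ ∞ fun y => ∑ n ∈ S, pw (dual n) y * a n :=
  ContDiff.sum fun _ _ => (contDiff_pw _).mul contDiff_const

lemma perTest_trig (S : Finset (Fin 3 → ℤ)) (a : (Fin 3 → ℤ) → ℂ) :
    PerTest fun y => ∑ n ∈ S, pw (dual n) y * a n :=
  ⟨contDiff_trig S a, fun k x => Finset.sum_congr rfl fun n _ => by rw [(perTest_pw n).2]⟩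

lemma pd_trig (S : Finset (Fin 3 → ℤ)) (a : (Fin 3 → ℤ) → ℂ) (j : Fin 3) (x : R3) :
    pd j (fun y => ∑ n ∈ S, pw (dual n) y * a n) x
      = ∑ n ∈ S, pw (dual n) x * (Complex.I * dual n j * a n) := by
  have hd : ∀ n, DifferentiableAt ℝ (pw (dual n)) x := fun n =>
    (contDiff_pw _).differentiable (by simp) x
  rw [pd, fderiv_fun_sum fun n _ => (hd n).mul_const _, sum_apply]
  refine Finset.sum_congr rfl fun n _ => ?_
  change pd j (fun y => pw (dual n) y * a n) x = _
  rw [pd_mul (hd n) (differentiableAt_const _), pd_pw]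
  simp [pd]
  ring

lemma grad_trig (S : Finset (Fin 3 → ℤ)) (a : (Fin 3 → ℤ) → ℂ) (x : R3) :
    grad (fun y => ∑ n ∈ S, pw (dual n) y * a n) x
      = ∑ n ∈ S, pw (dual n) x • ((Complex.I * a n) • cv (dual n)) := by
  ext j
  simp only [grad, pd_trig, WithLp.ofLp_sum, Finset.sum_apply, PiLp.smul_apply, cv_apply,
    smul_eq_mul]
  exact Finset.sum_congr rfl fun n _ => by ring

/-- The periodic extension of the restriction of `f` to the unit cell. -/
def perExt {E : Type*} (f : R3 → E) (x : R3) : E := f (x + latt fun i => -⌊x i⌋)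

lemma periodic_perExt {E : Type*} (f : R3 → E) : Periodic (perExt f) := by
  intro n x
  rw [perExt, perExt, add_assoc, ← latt_add]
  congr 3
  funext i
  simp [latt_apply]

lemma perExt_of_mem {E : Type*} (f : R3 → E) {x : R3} (hx : x ∈ Q) : perExt f x = f x := by
  have h : (fun i => -⌊x i⌋) = 0 := by
    funext i
    simpa using Int.floor_eq_zero_iff.mpr (hx i)
  rw [perExt, h]
  congr 1
  ext i
  simp [latt_apply]

lemma perExt_ae_eq {E : Type*} (f : R3 → E) : perExt f =ᵐ[volQ] f :=
  (ae_restrict_iff' measurableSet_Q).mpr (Eventually.of_forall fun _ hx => perExt_of_mem f hx)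

/-- Only finitely many `n` satisfy `|κ + 2πn| < 1`. The gap `δ` bounds a potential by its twisted
gradient for this fixed `κ`; it may degenerate as `κ` varies, but only existence rests on it, no
estimate. -/
lemma exists_pos_le_norm_add_dual (κ : R3) :
    ∃ δ : ℝ, 0 < δ ∧ ∀ n, κ + dual n = 0 ∨ δ ≤ ‖κ + dual n‖ := by
  obtain ⟨N, hN⟩ := exists_nat_gt (1 + ‖κ‖)
  have hfin : ∀ n ∉ Finset.Icc (fun _ : Fin 3 => -(N : ℤ)) (fun _ => N), 1 ≤ ‖κ + dual n‖ := by
    intro n hn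
    by_contra! hlt
    refine hn (Finset.mem_Icc.mpr ?_)
    have h1 : ∀ i, |(n i : ℝ)| < N := by
      intro i
      have h2 := PiLp.norm_apply_le (κ + dual n) i
      have h3 := PiLp.norm_apply_le κ i
      simp only [PiLp.add_apply, dual_apply, Real.norm_eq_abs] at h2 h3
      have h4 : |2 * Real.pi * n i| ≤ 1 + ‖κ‖ := by
        rw [abs_le] at h2 h3 ⊢
        constructor <;> linarith
      rw [abs_mul, abs_of_pos Real.two_pi_pos] at h4
      nlinarith [Real.pi_gt_three, abs_nonneg (n i : ℝ)]
    constructor <;> intro i <;> have h3 := abs_lt.mp (h1 i)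
    · have : -(N : ℝ) ≤ n i := by linarith
      exact_mod_cast this
    · have : (n i : ℝ) ≤ N := by linarith
      exact_mod_cast this
  let F := (Finset.Icc (fun _ : Fin 3 => -(N : ℤ)) (fun _ => N)).filter fun n => κ + dual n ≠ 0
  rcases F.eq_empty_or_nonempty with hF | hF
  · refine ⟨1, one_pos, fun n => ?_⟩
    by_cases hn : n ∈ Finset.Icc (fun _ : Fin 3 => -(N : ℤ)) (fun _ => N)
    · left
      by_contra h
      have : n ∈ F := Finset.mem_filter.mpr ⟨hn, h⟩
      simp [hF] at this
    · exact Or.inr (hfin n hn)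
  · obtain ⟨n₀, hn₀, hmin⟩ := F.exists_min_image (fun n => ‖κ + dual n‖) hF
    refine ⟨min 1 ‖κ + dual n₀‖, lt_min one_pos (norm_pos_iff.mpr (Finset.mem_filter.mp hn₀).2),
      fun n => ?_⟩
    by_cases hn : n ∈ Finset.Icc (fun _ : Fin 3 => -(N : ℤ)) (fun _ => N)
    · by_cases h : κ + dual n = 0
      · exact Or.inl h
      · exact Or.inr ((min_le_right _ _).trans (hmin n (Finset.mem_filter.mpr ⟨hn, h⟩)))
    · exact Or.inr ((min_le_left _ _).trans (hfin n hn))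

/-- The fields without zeroth mode which are `κ`-quasiperiodic gradients. -/
def gradSpace (κ : R3) : Submodule ℂ L2Q where
  carrier := {G | cf 0 G = 0 ∧ ∀ n, n ≠ 0 → Par (κ + dual n) (cf n G)}
  add_mem' := fun hx hy => ⟨by rw [map_add, hx.1, hy.1, add_zero], fun n hn => by
    rw [map_add]; exact (hx.2 n hn).add (hy.2 n hn)⟩
  zero_mem' := ⟨map_zero _, fun n _ => by rw [map_zero]; exact par_zero _⟩
  smul_mem' := fun c x hx => ⟨by rw [map_smul, hx.1, smul_zero], fun n hn => by
    rw [map_smul]; exact (hx.2 n hn).smul c⟩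

lemma isClosed_gradSpace (κ : R3) : IsClosed (gradSpace κ : Set L2Q) := by
  have : (gradSpace κ : Set L2Q)
      = cf 0 ⁻¹' {0} ∩ ⋂ n, ⋂ (_ : n ≠ 0), cf n ⁻¹' {a | Par (κ + dual n) a} := by
    ext G
    simp only [Set.mem_inter_iff, Set.mem_iInter]
    rfl
  rw [this]
  refine (isClosed_singleton.preimage (cf 0).continuous).inter ?_
  exact isClosed_iInter fun n => isClosed_iInter fun _ => (isClosed_par _).preimage (cf n).continuous

/-- A gradient correction making `T G - f` divergence-free. -/
lemma exists_gradient_correction {T : L2Q →L[ℂ] L2Q} {a b : ℝ} (hT : IsCoerc T a b) (κ : R3)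
    (f : L2Q) : ∃ G ∈ gradSpace κ, ∀ n, n ≠ 0 →
      inner ℂ (cv (κ + dual n)) (cf n (T G - f)) = 0 := by
  obtain ⟨G, hG, h⟩ := exists_mem_forall_inner_eq_zero T hT.pos hT.lower (gradSpace κ)
    (isClosed_gradSpace κ) f
  refine ⟨G, hG, fun n hn => ?_⟩
  rw [← inner_ev_left]
  refine h _ ⟨by rw [cf_ev, if_neg hn.symm], fun k hk => ?_⟩
  rw [cf_ev]
  split_ifs with hkn
  · subst hkn
    exact ⟨1, (one_smul _ _).symm⟩
  · exact par_zero _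

/-- Fields in `gradSpace κ` have a periodic potential. -/
lemma exists_potential {κ : R3} {G : L2Q} (hG : G ∈ gradSpace κ) :
    ∃ (ψ : R3 → ℂ) (p : R3 → C3), Periodic ψ ∧ Periodic p ∧ MemHOneZero volume ψ p ∧
      ∀ n, cf n G = (Complex.I * fc ψ n) • cv (κ + dual n) := by
  obtain ⟨δ, hδ, hlow⟩ := exists_pos_le_norm_add_dual κ
  -- Where `κ + dual n = 0` the coefficient `s` is undetermined and is set to `0`, to keep the
  -- bound. At `n = 0` it must vanish for the potential to have mean zero.
  have hs : ∀ n, ∃ s : ℂ, cf n G = s • cv (κ + dual n) ∧ (n = 0 → s = 0) ∧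
      δ * ‖s‖ ≤ ‖cf n G‖ := by
    intro n
    by_cases hn : n = 0
    · exact ⟨0, by rw [hn, hG.1, zero_smul], fun _ => rfl, by simp⟩
    · rcases hlow n with h | h
      · obtain ⟨s, hs⟩ := hG.2 n hn
        rw [h, cv_zero, smul_zero] at hs
        exact ⟨0, by rw [hs, zero_smul], fun _ => rfl, by simp⟩
      · obtain ⟨s, hs⟩ := hG.2 n hn
        refine ⟨s, hs, fun h => absurd h hn, ?_⟩
        rw [hs, norm_smul, norm_cv, mul_comm]
        exact mul_le_mul_of_nonneg_left h (norm_nonneg _)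
  choose s hs hs0 hsb using hs
  have hsb' : ∀ n, ‖s n‖ ≤ δ⁻¹ * ‖cf n G‖ := fun n => by
    rw [le_inv_mul_iff₀ hδ]; exact hsb n
  -- The scalar potential is the first component of a vector field. Its coefficients are `-i s`, so
  -- that the factor `i` of the gradient returns `s`.
  obtain ⟨Z, hZ, -⟩ := exists_cf_of_le
    (fun n => (-Complex.I * s n) • EuclideanSpace.single 0 (1 : ℂ)) G (inv_nonneg.mpr hδ.le)
    fun n => by simpa [norm_smul] using hsb' n
  obtain ⟨P, hP, -⟩ := exists_cf_of_le (fun n => s n • cv (dual n)) G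
    (C := 1 + ‖κ‖ * δ⁻¹) (by positivity) fun n => by
      have e : s n • cv (dual n) = cf n G - s n • cv κ := by
        rw [hs, cv_add, smul_add, add_sub_cancel_left]
      rw [e, add_mul, one_mul]
      refine (norm_sub_le _ _).trans (add_le_add le_rfl ?_)
      rw [norm_smul, norm_cv, mul_comm, mul_assoc]
      exact mul_le_mul_of_nonneg_left (hsb' n) (norm_nonneg _)
  have hZm : MemLp (fun y => Z y 0) 2 volQ :=
    (Lp.memLp Z).continuousLinearMap_comp (EuclideanSpace.proj 0 : C3 →L[ℂ] ℂ)
  have hfψ : ∀ n, fc (perExt fun y => Z y 0) n = -Complex.I * s n := fun n => by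
    rw [fc_congr (perExt_ae_eq _), ← fc_apply (Lp.memLp Z), ← cf_eq_fc, hZ]
    simp
  refine ⟨perExt fun y => Z y 0, perExt P, periodic_perExt _, periodic_perExt _,
    ⟨(memLp_congr_ae (perExt_ae_eq _)).mpr hZm, (memLp_congr_ae (perExt_ae_eq _)).mpr (Lp.memLp P),
      fun η hη => ?_⟩, fun n => ?_⟩
  · obtain ⟨S, h1, h2⟩ := ((eventually_eLpNorm_sub_le Z hη).and
      (eventually_eLpNorm_sub_le P hη)).exists
    refine ⟨fun y => ∑ n ∈ S, pw (dual n) y * (-Complex.I * s n), ⟨perTest_trig S _, ?_⟩, ?_, ?_⟩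
    · rw [integral_finsetSum]
      · refine Finset.sum_eq_zero fun n _ => ?_
        rw [integral_mul_const, integral_pw_dual]
        split_ifs with h
        · rw [hs0 n h]; simp
        · simp
      · exact fun n _ => ((perTest_pw n).memLp.integrable (by norm_num)).mul_const _
    · refine le_trans (eLpNorm_mono_ae ?_) h1
      filter_upwards [perExt_ae_eq fun y => Z y 0] with y hy
      rw [hy]
      refine le_trans (le_of_eq ?_) (PiLp.norm_apply_le _ 0)
      congr 1
      simp [hZ, WithLp.ofLp_sum, Finset.sum_apply]
    · refine le_trans (le_of_eq (eLpNorm_congr_ae ?_)) h2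
      filter_upwards [perExt_ae_eq P] with y hy
      rw [hy, grad_trig]
      simp only [hP]
      congr 1
      refine Finset.sum_congr rfl fun n _ => ?_
      congr 2
      linear_combination (-s n) * Complex.I_mul_I
  · rw [hfψ, hs]
    congr 1
    linear_combination (s n) * Complex.I_mul_I

/-- Lax–Milgram is solved for the twisted gradient in the closed space `gradSpace κ`, not for the
potential. A potential is extracted afterwards, so coercivity in `ψ`, which fails when `κ + 2πn =
0`, is not needed. -/
theorem exists_isCellSolution
    (hgrad : ∀ φ : R3 → ℂ, PerTest φ → ∀ j, ∫ y in Q, pd j φ y = 0) {A : R3 → RMat} {α β : ℝ}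
    (hA : IsCoeff (fun y => (A y)⁻¹) α β) (κ : R3) (c : C3) :
    ∃ ψ p, IsCellSolution volume A κ c ψ p := by
  obtain ⟨G, hG, h⟩ := exists_gradient_correction hA.isCoerc κ (-(mulOp hA.bdd volQ (ev 0 c)))
  obtain ⟨ψ, p, hψ, hp, hm, hcf⟩ := exists_potential hG
  refine ⟨ψ, p, hψ, hp, hm, fun φ hφ => ?_⟩
  have e : (memLp_gradK_add hm κ c).toLp = G + ev 0 c := ext_cf fun n => by
    rw [cf_toLp, fc_gradK_add hgrad hm, map_add, hcf, cf_ev]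
  have hφ' := memHOneZero_of_perTestZero hφ
  have hφm := memLp_gradK_add hφ' κ 0
  have h1 : (fun y => gradK κ φ (grad φ) y) = fun y => gradK κ φ (grad φ) y + 0 := by simp
  have hE : IsElCorr (mulOp hA.bdd volQ) κ c (G + ev 0 c) := by
    refine ⟨by rw [map_add, hG.1, cf_ev, if_pos rfl, zero_add], fun n hn => ?_, fun n hn => ?_⟩
    · rw [map_add, cf_ev, if_neg hn, add_zero]
      exact hG.2 n hn
    · have := h n hn
      rwa [sub_neg_eq_add, ← map_add (mulOp hA.bdd volQ)] at this
  have h2 := integral_cdot_eq_inner (hA.bdd.memLp (memLp_gradK_add hm κ c)) hφm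
  simp only [add_zero] at h2
  rw [h2, ← mulOp_toLp hA.bdd (memLp_gradK_add hm κ c), e]
  have hcf' : ∀ n, cf n (hφm.toLp) = (Complex.I * fc φ n) • cv (κ + dual n) := fun n => by
    rw [cf_toLp, fc_gradK_add hgrad hφ']
    simp
  have h3 := hE.inner_eq (x := hφm.toLp) (by rw [hcf', hφ.fc_zero]; simp)
    fun n _ => by rw [hcf']; exact ⟨_, rfl⟩
  simpa only [add_zero] using h3

end CellProblems

/-! ### The magnetic cell problem -/

section MagneticCell

lemma ev_zero_eq (c : C3) : ev 0 c = (memLp_const c).toLp (fun _ => c) := by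
  rw [ev]
  exact MemLp.toLp_congr _ _ (Eventually.of_forall fun y => by simp [dual_zero])

@[simp] lemma crI_zero_left (v : C3) : crI 0 v = 0 := by
  have := crI_smul_left 0 0 v
  simpa using this

lemma crI_eq_zero_of_inner {k : R3} {z : C3} (h : ∀ v, inner ℂ (crI k v) z = 0) :
    crI k z = 0 := by
  have h1 := h (crI k z)
  rwa [inner_crI, inner_self_eq_zero] at h1

lemma PerTest.trig (S : Finset (Fin 3 → ℤ)) (a : (Fin 3 → ℤ) → C3) :
    PerTest fun y => ∑ n ∈ S, pw (dual n) y • a n := by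
  have : (fun y => ∑ n ∈ S, pw (dual n) y • a n)
      = fun y => WithLp.toLp 2 fun i => ∑ n ∈ S, pw (dual n) y * a n i := by
    funext y; ext i
    simp [WithLp.ofLp_sum, Finset.sum_apply]
  rw [this]
  exact PerTest.toLp fun i => perTest_trig S fun n => a n i

lemma curl_trig (S : Finset (Fin 3 → ℤ)) (a : (Fin 3 → ℤ) → C3) (x : R3) :
    curl (fun y => ∑ n ∈ S, pw (dual n) y • a n) x
      = ∑ n ∈ S, pw (dual n) x • crI (dual n) (a n) := by
  have h : ∀ i, (fun y => (∑ n ∈ S, pw (dual n) y • a n) i)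
      = fun y => ∑ n ∈ S, pw (dual n) y * a n i := fun i => by
    funext y
    simp [WithLp.ofLp_sum, Finset.sum_apply]
  ext i
  rw [curl_apply, h, h, pd_trig, pd_trig, ← Finset.sum_sub_distrib, WithLp.ofLp_sum,
    Finset.sum_apply]
  refine Finset.sum_congr rfl fun n _ => ?_
  rw [PiLp.smul_apply, crI_apply]
  fin_cases i <;> simp <;> ring

variable {A At : R3 → RMat} {C C' α β a b : ℝ} {N R : Fin 3 → R3 → C3}

lemma memHCurlPer_of_perTest (hA : IsRootCoeff A C C' α β) {F : R3 → C3} (hF : PerTest F) :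
    MemHCurlPer volume A (fun y => app (cm (msqrt (A y))⁻¹) (F y)) (curl F) := by
  refine ⟨hA.root_inv.memLp hF.memLp, hF.curl.memLp, fun δ _ =>
    ⟨fun y => app (cm (msqrt (A y))⁻¹) (F y), ?_, by simp, ?_⟩⟩
  · simp_rw [app_cm_inv (det_msqrt_ne_zero (hA.posDef _))]
    exact hF
  · simp_rw [app_cm_inv (det_msqrt_ne_zero (hA.posDef _))]
    simp

/-- Testing with `A^{-1/2} (e_{2πn} v)`, `n ≠ 0`, is allowed since its image under `A^{1/2}` has
mean zero. As `v` is arbitrary and `crI` is self-adjoint, the flux is curl-free. -/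
lemma IsMagneticCell.isMagCorr
    (hgrad : ∀ φ : R3 → ℂ, PerTest φ → ∀ j, ∫ y in Q, pd j φ y = 0)
    (hA : IsRootCoeff A C C' α β) (hs : IsCoeff At a b) (h : IsMagneticCell volume A At N R)
    (j : Fin 3) : IsMagCorr (mulOp hs.bdd volQ) (EuclideanSpace.single j 1)
      ((h j).1.2.1.toLp (R j)) := by
  have hcf : ∀ n, cf n ((h j).1.2.1.toLp (R j)) = crI (dual n) _ := fun n => by
    rw [cf_toLp]
    exact (h j).1.fc_eq hgrad hA.root n
  refine ⟨by rw [hcf, dual_zero, crI_zero_left], fun n => by rw [hcf, inner_cv_crI], fun n => ?_⟩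
  by_cases hn : n = 0
  · rw [hn, dual_zero, crI_zero_left]
  refine crI_eq_zero_of_inner fun v => ?_
  have hF := PerTest.trig {n} fun _ => v
  have h1 := (h j).2.2.2 _ _ (memHCurlPer_of_perTest hA hF) (by
    simp_rw [app_cm_inv (det_msqrt_ne_zero (hA.posDef _)), Finset.sum_singleton]
    rw [integral_smul_const, integral_pw_dual, if_neg hn, zero_smul])
  simp_rw [curl_trig, Finset.sum_singleton] at h1
  rw [integral_cdot_pw_smul (hs.bdd.memLp (h j).1.2.1),
    integral_cdot_pw_smul (hs.bdd.memLp (memLp_const _))] at h1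
  rw [map_add (mulOp hs.bdd volQ), ev_zero_eq, mulOp_toLp hs.bdd (h j).1.2.1,
    mulOp_toLp hs.bdd (memLp_const _), map_add, cf_toLp, cf_toLp, inner_add_right, h1,
    neg_add_cancel]

/-- The divergence-free fields without zeroth mode. -/
def divSpace : Submodule ℂ L2Q where
  carrier := {r | cf 0 r = 0 ∧ ∀ n, inner ℂ (cv (dual n)) (cf n r) = 0}
  add_mem' := fun hx hy => ⟨by rw [map_add, hx.1, hy.1, add_zero], fun n => by
    rw [map_add, inner_add_right, hx.2, hy.2, add_zero]⟩
  zero_mem' := ⟨map_zero _, fun n => by rw [map_zero, inner_zero_right]⟩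
  smul_mem' := fun c x hx => ⟨by rw [map_smul, hx.1, smul_zero], fun n => by
    rw [map_smul, inner_smul_right, hx.2, mul_zero]⟩

lemma isClosed_divSpace : IsClosed (divSpace : Set L2Q) := by
  have : (divSpace : Set L2Q)
      = cf 0 ⁻¹' {0} ∩ ⋂ n, {r | inner ℂ (cv (dual n)) (cf n r) = 0} := by
    ext G
    simp only [Set.mem_inter_iff, Set.mem_iInter]
    rfl
  rw [this]
  refine (isClosed_singleton.preimage (cf 0).continuous).inter ?_
  exact isClosed_iInter fun n => isClosed_eq
    (continuous_const.inner (cf n).continuous) continuous_const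

/-- Again the unknown is the curl `r` itself, found by Lax–Milgram among divergence-free fields of
mean zero. -/
lemma exists_isMagCorr {s : L2Q →L[ℂ] L2Q} (hs : IsCoerc s a b) (c : C3) :
    ∃ r, IsMagCorr s c r := by
  obtain ⟨r, hr, h⟩ := exists_mem_forall_inner_eq_zero s hs.pos hs.lower divSpace
    isClosed_divSpace (-(s (ev 0 c)))
  refine ⟨r, hr.1, hr.2, fun n => ?_⟩
  by_cases hn : n = 0
  · rw [hn, dual_zero, crI_zero_left]
  refine crI_eq_zero_of_inner fun v => ?_
  have h1 := h (ev n (crI (dual n) v)) ⟨by rw [cf_ev, if_neg (Ne.symm hn)], fun k => by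
    rw [cf_ev]
    split_ifs with hk
    · rw [hk, inner_cv_crI]
    · exact inner_zero_right _⟩
  rwa [sub_neg_eq_add, ← map_add, inner_ev_left] at h1

/-- A vector potential `N₀` of `r` has the right curl but the wrong divergence. A gradient `G` makes
`A⁻¹ (N₀ + G)` divergence-free without changing the curl or the mean, and the solution is `A^{-1/2}
(N₀ + G)`. -/
theorem exists_isMagneticCell
    (hgrad : ∀ φ : R3 → ℂ, PerTest φ → ∀ j, ∫ y in Q, pd j φ y = 0)
    (hA : IsRootCoeff A C C' α β) (hs : IsCoeff At a b) :
    ∃ N R, IsMagneticCell volume A At N R := by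
  choose r hr using fun j : Fin 3 => exists_isMagCorr hs.isCoerc (EuclideanSpace.single j 1)
  choose N₀ hN₀ hN₀0 hN₀p _ using fun j => exists_vector_potential (hr j).mean (hr j).perp
  choose G hG hGd using fun j => exists_gradient_correction hA.inv.isCoerc 0
    (-(mulOp hA.inv.bdd volQ (N₀ j)))
  let F : Fin 3 → L2Q := fun j => N₀ j + G j
  have hF0 : ∀ j, cf 0 (F j) = 0 := fun j => by rw [map_add, hN₀0, (hG j).1, add_zero]
  have hFc : ∀ j n, crI (dual n) (cf n (F j)) = cf n (r j) := fun j n => by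
    rw [map_add, crI_add, hN₀]
    by_cases hn : n = 0
    · simp [hn, (hG j).1]
    · have := ((hG j).2 n hn).crI_eq
      rw [zero_add] at this
      rw [this, add_zero]
  have hFd : ∀ j n, inner ℂ (cv (dual n)) (cf n (mulOp hA.inv.bdd volQ (F j))) = 0 := fun j n => by
    by_cases hn : n = 0
    · rw [hn, dual_zero, cv_zero, inner_zero_left]
    · have := hGd j n hn
      rwa [zero_add, sub_neg_eq_add, ← map_add, add_comm] at this
  have hSS : ∀ y v, app (cm (msqrt (A y))) (app (cm (msqrt (A y))⁻¹) v) = v := fun y v =>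
    app_cm_inv (det_msqrt_ne_zero (hA.posDef _)) v
  refine ⟨fun j y => app (cm (msqrt (A y))⁻¹) (F j y), fun j => r j, fun j =>
    ⟨⟨hA.root_inv.memLp (Lp.memLp _), Lp.memLp _, fun δ hδ => ?_⟩, fun φ hφ => ?_, ?_,
      fun φ w hw _ => ?_⟩⟩
  · have hC' := hA.root_inv.nonneg
    have hδ' : 0 < δ / (C' + 1) := by positivity
    obtain ⟨S, h1, h2⟩ := ((eventually_eLpNorm_sub_le (F j) hδ').and
      (eventually_eLpNorm_sub_le (r j) hδ)).exists
    refine ⟨fun y => app (cm (msqrt (A y))⁻¹) (∑ n ∈ S, pw (dual n) y • cf n (F j)), ?_, ?_, ?_⟩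
    · simp_rw [hSS]
      exact PerTest.trig S _
    · simp_rw [← app_sub]
      refine (hA.root_inv.eLpNorm_le _).trans ((mul_le_mul' le_rfl h1).trans ?_)
      rw [← ENNReal.ofReal_mul hC']
      refine ENNReal.ofReal_le_ofReal ?_
      rw [mul_div_assoc', div_le_iff₀ (by positivity)]
      nlinarith
    · simp_rw [hSS, curl_trig, hFc]
      exact h2
  · simp_rw [← app_mul, ← cm_inv_eq (hA.posDef _)]
    rw [integral_cdot_eq_inner (hA.inv.bdd.memLp (Lp.memLp _)) hφ.grad.memLp,
      ← mulOp_toLp hA.inv.bdd (Lp.memLp (F j)), Lp.toLp_coeFn]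
    refine inner_eq_zero_of_cf fun n => ?_
    rw [cf_toLp, fc_grad hgrad hφ, inner_smul_left, hFd, mul_zero]
  · simp_rw [hSS]
    have := hF0 j
    rw [cf_eq_fc] at this
    simpa [fc, dual_zero] using this
  · have hwcf : ∀ n, cf n (hw.2.1.toLp w) = crI (dual n) _ := fun n => by
      rw [cf_toLp]
      exact hw.fc_eq hgrad hA.root n
    have h1 := (hr j).inner_eq (r' := hw.2.1.toLp w) (by rw [hwcf, dual_zero, crI_zero_left])
      fun n => by rw [hwcf, inner_cv_crI]
    rw [map_add, inner_add_right] at h1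
    rw [integral_cdot_eq_inner (hs.bdd.memLp (Lp.memLp _)) hw.2.1,
      integral_cdot_eq_inner (hs.bdd.memLp (memLp_const _)) hw.2.1,
      ← mulOp_toLp hs.bdd (Lp.memLp (r j)), Lp.toLp_coeFn, ← mulOp_toLp hs.bdd (memLp_const _),
      ← ev_zero_eq]
    exact eq_neg_of_add_eq_zero_left h1

end MagneticCell

/-! ### The homogenised matrices -/

section Homogenised

variable {A At : R3 → RMat} {C C' α β a b : ℝ} {N R : Fin 3 → R3 → C3}
  {Ψ : R3 → Fin 3 → R3 → ℂ} {P : R3 → Fin 3 → R3 → C3}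

lemma sum_smul_single (c : C3) : ∑ j, c j • EuclideanSpace.single j (1 : ℂ) = c := by
  ext i
  simp [Pi.single_apply]

lemma app_of_col (M : CMat) (v : Fin 3 → C3) (h : ∀ i j, M i j = v j i) (c : C3) :
    app M c = ∑ j, c j • v j := by
  ext i
  simp only [app_apply, h, WithLp.ofLp_sum, Finset.sum_apply, PiLp.smul_apply, smul_eq_mul]
  exact Finset.sum_congr rfl fun j _ => mul_comm _ _

lemma corr_apply (κ y : R3) (i j : Fin 3) : corr Ψ P κ y i j
    = (gradK κ (Ψ κ j) (P κ j) y + EuclideanSpace.single j 1 : C3) i := by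
  simp [corr, Matrix.one_apply]

lemma app_corr (κ y : R3) (c : C3) : app (corr Ψ P κ y) c
    = ∑ j, c j • (gradK κ (Ψ κ j) (P κ j) y + EuclideanSpace.single j 1 : C3) :=
  app_of_col _ (fun j => (gradK κ (Ψ κ j) (P κ j) y + EuclideanSpace.single j 1 : C3))
    (corr_apply κ y) c

lemma memLp_app_corr (h : IsCellFamily volume A Ψ P) (κ : R3) (c : C3) :
    MemLp (fun y => app (corr Ψ P κ y) c) 2 volQ := by
  simp_rw [app_corr]
  exact memLp_finsetSum _ fun j _ => (memLp_gradK_add (h κ j).2.2.1 κ _).const_smul (c j)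

/-- The field `(conj(e_κ) ∇(e_κ Ψ_κ) + I) c`. -/
def elCorr (h : IsCellFamily volume A Ψ P) (κ : R3) (c : C3) : L2Q := (memLp_app_corr h κ c).toLp

lemma elCorr_eq (h : IsCellFamily volume A Ψ P) (κ : R3) (c : C3) : elCorr h κ c
    = ∑ j, c j • (memLp_gradK_add (h κ j).2.2.1 κ (EuclideanSpace.single j 1)).toLp := by
  have h1 : ∀ j, _ := fun j =>
    (memLp_gradK_add (h κ j).2.2.1 κ (EuclideanSpace.single j 1)).coeFn_toLp
  refine Lp.ext ?_
  filter_upwards [(memLp_app_corr h κ c).coeFn_toLp, ae_all_iff.mpr h1,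
    Lp.coeFn_finsetSum Finset.univ fun j => c j •
      (memLp_gradK_add (h κ j).2.2.1 κ (EuclideanSpace.single j 1)).toLp,
    ae_all_iff.mpr fun j => Lp.coeFn_smul (c j)
      (memLp_gradK_add (h κ j).2.2.1 κ (EuclideanSpace.single j 1)).toLp] with y e1 e2 e3 e4
  rw [elCorr, e1, e3, Finset.sum_apply, app_corr]
  refine Finset.sum_congr rfl fun j _ => ?_
  rw [e4, Pi.smul_apply, e2]

lemma isElCorr_elCorr (hgrad : ∀ φ : R3 → ℂ, PerTest φ → ∀ j, ∫ y in Q, pd j φ y = 0)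
    (hA : IsCoeff (fun y => (A y)⁻¹) α β) (h : IsCellFamily volume A Ψ P) (κ : R3) (c : C3) :
    IsElCorr (mulOp hA.bdd volQ) κ c (elCorr h κ c) := by
  have h1 := fun j => (h κ j).isElCorr hgrad hA
  rw [elCorr_eq]
  refine ⟨?_, fun n hn => ?_, fun n hn => ?_⟩
  · simp only [map_sum, map_smul, (h1 _).mean, sum_smul_single]
  · rw [map_sum]
    simp only [map_smul, Fin.sum_univ_three]
    exact (((h1 0).par n hn).smul _ |>.add (((h1 1).par n hn).smul _)).add
      (((h1 2).par n hn).smul _)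
  · simp only [map_sum, map_smul, inner_sum, inner_smul_right, (h1 _).perp n hn, mul_zero,
      Finset.sum_const_zero]

/-- Translates the entrywise definition into the corrector formalism, where coercivity and Hill's
identity are available. -/
lemma app_AhatHom (hA : IsCoeff (fun y => (A y)⁻¹) α β) (h : IsCellFamily volume A Ψ P) (κ : R3)
    (c : C3) : app (AhatHom volume A Ψ P κ) c = cf 0 (mulOp hA.bdd volQ (elCorr h κ c)) := by
  rw [elCorr_eq]
  simp only [map_sum, map_smul]
  refine app_of_col _ _ (fun i j => ?_) c
  have hm := memLp_gradK_add (h κ j).2.2.1 κ (EuclideanSpace.single j 1)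
  rw [mulOp_toLp hA.bdd hm, cf_toLp, fc_apply (hA.bdd.memLp hm), AhatHom, Matrix.of_apply]
  simp only [fc, dual_zero, pw_zero_left, map_one, one_smul, Matrix.mul_apply, app_apply,
    corr_apply]

lemma sum_isMagCorr {s : L2Q →L[ℂ] L2Q} {r : Fin 3 → L2Q}
    (h : ∀ j, IsMagCorr s (EuclideanSpace.single j 1) (r j)) (c : C3) :
    IsMagCorr s c (∑ j, c j • r j) := by
  have e : ∑ j, c j • r j + ev 0 c = ∑ j, c j • (r j + ev 0 (EuclideanSpace.single j 1)) := by
    simp only [smul_add, Finset.sum_add_distrib]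
    rw [ev_eq_sum]
  have hcr : ∀ (k : R3) (v : Fin 3 → C3), crI k (∑ j, v j) = ∑ j, crI k (v j) := fun k v => by
    simp only [Fin.sum_univ_three, crI_add]
  refine ⟨?_, fun n => ?_, fun n => ?_⟩
  · simp only [map_sum, map_smul, (h _).mean, smul_zero, Finset.sum_const_zero]
  · simp only [map_sum, map_smul, inner_sum, inner_smul_right, (h _).perp n, mul_zero,
      Finset.sum_const_zero]
  · rw [e]
    simp only [map_sum, map_smul, hcr, crI_smul, (h _).curl n, smul_zero, Finset.sum_const_zero]

lemma exists_app_AtHom (hgrad : ∀ φ : R3 → ℂ, PerTest φ → ∀ j, ∫ y in Q, pd j φ y = 0)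
    (hA : IsRootCoeff A C C' α β) (hs : IsCoeff At a b) (h : IsMagneticCell volume A At N R)
    (c : C3) : ∃ r, IsMagCorr (mulOp hs.bdd volQ) c r ∧
      app (AtHom volume At R) c = cf 0 (mulOp hs.bdd volQ (r + ev 0 c)) := by
  refine ⟨_, sum_isMagCorr (fun j => h.isMagCorr hgrad hA hs j) c, ?_⟩
  rw [ev_eq_sum, ← Finset.sum_add_distrib]
  simp only [← smul_add, map_sum, map_smul]
  refine app_of_col _ _ (fun i j => ?_) c
  have hm : MemLp (fun y => R j y + EuclideanSpace.single j (1 : ℂ)) 2 volQ :=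
    (h j).1.2.1.add (memLp_const _)
  have e : (h j).1.2.1.toLp (R j) + ev 0 (EuclideanSpace.single j 1) = hm.toLp := by
    rw [ev_zero_eq]
    rfl
  rw [e, mulOp_toLp hs.bdd hm, cf_toLp, fc_apply (hs.bdd.memLp hm), AtHom, Matrix.of_apply]
  simp [fc, dual_zero, Matrix.mul_apply, app_apply, Matrix.one_apply]

end Homogenised

/-! ### Invertibility and measurability of the homogenised symbol -/

section Symbol

variable {A At : R3 → RMat} {C C' α β a b : ℝ} {N R : Fin 3 → R3 → C3}
  {Ψ : R3 → Fin 3 → R3 → ℂ} {P : R3 → Fin 3 → R3 → C3}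

lemma isUnit_det_of_lower {M : CMat} (hα : 0 < α)
    (h : ∀ c, α * ‖c‖ ^ 2 ≤ (inner ℂ c (app M c)).re) : IsUnit M.det := by
  rw [isUnit_iff_ne_zero]
  intro h0
  obtain ⟨v, hv, hMv⟩ := Matrix.exists_mulVec_eq_zero_iff.mpr h0
  have h1 := h (WithLp.toLp 2 v)
  have h2 : app M (WithLp.toLp 2 v) = 0 := by simp [app, hMv]
  rw [h2, inner_zero_right, Complex.zero_re] at h1
  have h3 : 0 < ‖(WithLp.toLp 2 v : C3)‖ := norm_pos_iff.mpr (by simpa using hv)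
  have : 0 < α * ‖(WithLp.toLp 2 v : C3)‖ ^ 2 := by positivity
  linarith

/-- The homogenised operator `iθ × At^hom iθ × + Â^hom_{εθ}`. -/
def homMat (A At : R3 → RMat) (Ψ : R3 → Fin 3 → R3 → ℂ) (P : R3 → Fin 3 → R3 → C3)
    (R : Fin 3 → R3 → C3) (ε : ℝ) (θ : R3) : CMat :=
  crossI θ * AtHom volume At R * crossI θ + AhatHom volume A Ψ P (ε • θ)

lemma AhatHom_lower (hgrad : ∀ φ : R3 → ℂ, PerTest φ → ∀ j, ∫ y in Q, pd j φ y = 0)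
    (hA : IsCoeff (fun y => (A y)⁻¹) α β) (h : IsCellFamily volume A Ψ P) (κ : R3) (c : C3) :
    α * ‖c‖ ^ 2 ≤ (inner ℂ c (app (AhatHom volume A Ψ P κ) c)).re := by
  rw [app_AhatHom hA h]
  exact (isElCorr_elCorr hgrad hA h κ c).lower hA.isCoerc

lemma app_homMat (ε : ℝ) (θ : R3) (c : C3) : app (homMat A At Ψ P R ε θ) c
    = crI θ (app (AtHom volume At R) (crI θ c)) + app (AhatHom volume A Ψ P (ε • θ)) c := by
  rw [homMat, app_add_left, app_mul, app_mul]
  rfl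

lemma homMat_lower (hgrad : ∀ φ : R3 → ℂ, PerTest φ → ∀ j, ∫ y in Q, pd j φ y = 0)
    (hA : IsRootCoeff A C C' α β) (hs : IsCoeff At a b) (h : IsCellFamily volume A Ψ P)
    (h' : IsMagneticCell volume A At N R) (ε : ℝ) (θ : R3) (c : C3) :
    α * ‖c‖ ^ 2 ≤ (inner ℂ c (app (homMat A At Ψ P R ε θ) c)).re := by
  rw [app_homMat, inner_add_right, ← inner_crI, Complex.add_re]
  obtain ⟨r, hr, he⟩ := exists_app_AtHom hgrad hA hs h' (crI θ c)
  have h1 := hr.lower hs.isCoerc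
  rw [← he] at h1
  have h2 := AhatHom_lower hgrad hA.inv h (ε • θ) c
  have := mul_nonneg hs.pos.le (sq_nonneg ‖crI θ c‖)
  linarith

/-- The symbol itself has no obvious coercivity; factoring out `Â⁻¹` leaves `homMat`, a nonnegative
term plus a coercive one. The product of the two inverses in the theorem is then just `homMat⁻¹`. -/
lemma symb_add_one (ε : ℝ) (θ : R3) (hu : IsUnit (AhatHom volume A Ψ P (ε • θ)).det) :
    symb volume A At Ψ P R ε θ + 1
      = homMat A At Ψ P R ε θ * (AhatHom volume A Ψ P (ε • θ))⁻¹ := by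
  rw [homMat, add_mul, Matrix.mul_nonsing_inv _ hu, symb]

theorem isUnit_det_symb (hgrad : ∀ φ : R3 → ℂ, PerTest φ → ∀ j, ∫ y in Q, pd j φ y = 0)
    (hA : IsRootCoeff A C C' α β) (hs : IsCoeff At a b) (h : IsCellFamily volume A Ψ P)
    (h' : IsMagneticCell volume A At N R) (ε : ℝ) (θ : R3) :
    IsUnit (AhatHom volume A Ψ P (ε • θ)).det ∧
      IsUnit (symb volume A At Ψ P R ε θ + 1).det := by
  have hu := isUnit_det_of_lower hA.inv.pos (AhatHom_lower hgrad hA.inv h (ε • θ))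
  refine ⟨hu, ?_⟩
  rw [symb_add_one ε θ hu, Matrix.det_mul]
  exact (isUnit_det_of_lower hA.inv.pos (homMat_lower hgrad hA hs h h' ε θ)).mul
    (Matrix.isUnit_nonsing_inv_det _ hu)

lemma inv_mul_inv_symb (ε : ℝ) (θ : R3) (hu : IsUnit (AhatHom volume A Ψ P (ε • θ)).det) :
    (AhatHom volume A Ψ P (ε • θ))⁻¹ * (symb volume A At Ψ P R ε θ + 1)⁻¹
      = (homMat A At Ψ P R ε θ)⁻¹ := by
  rw [symb_add_one ε θ hu, Matrix.mul_inv_rev, Matrix.nonsing_inv_nonsing_inv _ hu, ← mul_assoc,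
    Matrix.nonsing_inv_mul _ hu, one_mul]

lemma app_mul_inv {M : CMat} (hM : IsUnit M.det) (v : C3) : app M (app M⁻¹ v) = v := by
  rw [← app_mul, Matrix.mul_nonsing_inv _ hM, app_one]

lemma norm_app_inv_le {M : CMat} (hα : 0 < α)
    (h : ∀ c, α * ‖c‖ ^ 2 ≤ (inner ℂ c (app M c)).re) (v : C3) :
    ‖app M⁻¹ v‖ ≤ α⁻¹ * ‖v‖ := by
  have h1 := h (app M⁻¹ v)
  rw [app_mul_inv (isUnit_det_of_lower hα h)] at h1
  have h2 := (Complex.re_le_norm _).trans (norm_inner_le_norm (𝕜 := ℂ) (app M⁻¹ v) v)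
  rw [le_inv_mul_iff₀ hα]
  rcases (norm_nonneg (app M⁻¹ v)).eq_or_lt with h0 | h0
  · rw [← h0, mul_zero]; exact norm_nonneg _
  · refine le_of_mul_le_mul_left ?_ h0
    nlinarith

/-! ### Variational principle and measurability in the quasimomentum. -/

lemma elCorr_inner (hgrad : ∀ φ : R3 → ℂ, PerTest φ → ∀ j, ∫ y in Q, pd j φ y = 0)
    (hA : IsCoeff (fun y => (A y)⁻¹) α β) (h : IsCellFamily volume A Ψ P) (κ : R3) (c : C3) :
    inner ℂ c (app (AhatHom volume A Ψ P κ) c)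
      = ((inner ℂ c (app (AhatHom volume A Ψ P κ) c)).re : ℂ) := by
  rw [app_AhatHom hA h, (isElCorr_elCorr hgrad hA h κ c).inner_cf_zero]
  refine (Complex.conj_eq_iff_re.mp ?_).symm
  rw [inner_conj_symm, hA.inner_mulOp]

/-- Dirichlet's principle: the cross terms vanish by the corrector equation and the symmetry of `m`,
leaving the nonnegative energy of `X - Y`. -/
lemma IsElCorr.re_inner_le {m : L2Q →L[ℂ] L2Q} (hm : IsCoerc m α β)
    (hsymm : ∀ f g, inner ℂ (m f) g = inner ℂ f (m g)) {κ : R3} {c : C3} {Y G : L2Q}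
    (h : IsElCorr m κ c Y) (hG : G ∈ gradSpace κ) :
    (inner ℂ Y (m Y)).re ≤ (inner ℂ (G + ev 0 c) (m (G + ev 0 c))).re := by
  set X := G + ev 0 c with hX
  have h1 : inner ℂ (X - Y) (m Y) = 0 := by
    refine h.inner_eq ?_ fun n hn => ?_
    · rw [hX, map_sub, map_add, hG.1, h.mean, cf_ev, if_pos rfl, zero_add, sub_self]
    · rw [hX, map_sub, map_add, cf_ev, if_neg hn, add_zero]
      exact (hG.2 n hn).sub (h.par n hn)
  have h2 : inner ℂ Y (m (X - Y)) = 0 := by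
    rw [← hsymm, ← inner_conj_symm, h1, map_zero]
  have h3 : inner ℂ X (m X) = inner ℂ Y (m Y) + inner ℂ (X - Y) (m (X - Y)) := by
    have e : X = Y + (X - Y) := by abel
    conv_lhs => rw [e]
    rw [map_add, inner_add_left, inner_add_right, inner_add_right, h1, h2]
    ring
  rw [h3, Complex.add_re]
  have := hm.lower (X - Y)
  have := mul_nonneg hm.pos.le (sq_nonneg ‖X - Y‖)
  linarith

lemma continuous_ev (n : Fin 3 → ℤ) : Continuous (ev n) := by
  have : ev n = fun v => ∑ i, v i • ev n (EuclideanSpace.single i 1) := funext (ev_eq_sum n)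
  rw [this]
  fun_prop

lemma continuous_cv : Continuous cv := by
  refine (PiLp.continuous_toLp 2 _).comp (continuous_pi fun i => ?_)
  fun_prop

/-- An infimum over trial fields that depend continuously on `κ` is upper semicontinuous. Since
`gradSpace κ` degenerates where `κ + 2πn = 0` with `n ≠ 0`, semicontinuity is all this argument
gives, and it suffices for measurability. -/
lemma isOpen_AhatHom_lt (hgrad : ∀ φ : R3 → ℂ, PerTest φ → ∀ j, ∫ y in Q, pd j φ y = 0)
    (hA : IsCoeff (fun y => (A y)⁻¹) α β) (h : IsCellFamily volume A Ψ P) (c : C3) (t : ℝ) :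
    IsOpen {κ | (inner ℂ c (app (AhatHom volume A Ψ P κ) c)).re < t} := by
  set m := mulOp hA.bdd volQ with hm
  have hq : ∀ κ, inner ℂ c (app (AhatHom volume A Ψ P κ) c)
      = inner ℂ (elCorr h κ c) (m (elCorr h κ c)) := fun κ => by
    rw [app_AhatHom hA h, (isElCorr_elCorr hgrad hA h κ c).inner_cf_zero]
  have hcont : Continuous fun X : L2Q => (inner ℂ X (m X)).re :=
    Complex.continuous_re.comp (continuous_id.inner m.continuous)
  refine isOpen_iff_mem_nhds.mpr fun κ₀ hκ₀ => ?_
  rw [Set.mem_ofPred_eq, hq] at hκ₀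
  have hY := isElCorr_elCorr hgrad hA h κ₀ c
  choose! s hs using hY.par
  -- The trial field keeps finitely many coefficients `s n` of the solution at `κ₀` and lets the
  -- directions `κ + dual n` move with `κ`. It is then admissible at every `κ` and continuous in
  -- `κ`.
  let X : Finset (Fin 3 → ℤ) → R3 → L2Q := fun S κ =>
    ∑ n ∈ S, ev n (if n = 0 then 0 else s n • cv (κ + dual n))
  have hX : ∀ S, X S κ₀ + ev 0 c = ∑ n ∈ S, ev n (cf n (elCorr h κ₀ c - ev 0 c)) + ev 0 c := by
    intro S
    congr 1
    refine Finset.sum_congr rfl fun n _ => ?_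
    congr 1
    rw [map_sub, cf_ev]
    split_ifs with hn
    · rw [hn, hY.mean, sub_self]
    · rw [hs n hn, sub_zero]
  have h1 : Tendsto (fun S => X S κ₀ + ev 0 c) atTop (𝓝 (elCorr h κ₀ c)) := by
    simp_rw [hX]
    simpa using (hasSum_ev_cf (elCorr h κ₀ c - ev 0 c)).add_const (ev 0 c)
  obtain ⟨S, hS⟩ := (((hcont.tendsto _).comp h1).eventually (gt_mem_nhds hκ₀)).exists
  have hXc : Continuous fun κ => X S κ + ev 0 c := by
    refine (continuous_finsetSum _ fun n _ => (continuous_ev n).comp ?_).add continuous_const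
    split_ifs
    · exact continuous_const
    · exact (continuous_cv.comp (continuous_add_const _)).const_smul (s n)
  filter_upwards [(hcont.comp hXc).continuousAt.eventually (gt_mem_nhds hS)] with κ hκ
  rw [hq]
  refine ((isElCorr_elCorr hgrad hA h κ c).re_inner_le hA.isCoerc hA.inner_mulOp ?_).trans_lt hκ
  refine (gradSpace κ).sum_mem fun n _ => ?_
  split_ifs with hn
  · rw [ev_eq_sum]
    simp
  · refine ⟨by rw [cf_ev, if_neg (Ne.symm hn)], fun k _ => ?_⟩
    rw [cf_ev]
    split_ifs with hk
    · rw [hk]; exact ⟨_, rfl⟩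
    · exact par_zero _

/-- The quadratic form is real and upper semicontinuous, hence measurable; polarisation recovers the
entries. -/
lemma measurable_AhatHom (hgrad : ∀ φ : R3 → ℂ, PerTest φ → ∀ j, ∫ y in Q, pd j φ y = 0)
    (hA : IsCoeff (fun y => (A y)⁻¹) α β) (h : IsCellFamily volume A Ψ P) (i j : Fin 3) :
    Measurable fun κ => AhatHom volume A Ψ P κ i j := by
  have h1 : ∀ c, Measurable fun κ => inner ℂ (app (AhatHom volume A Ψ P κ) c) c := fun c => by
    have h2 : Measurable fun κ => (inner ℂ c (app (AhatHom volume A Ψ P κ) c)).re :=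
      measurable_of_Iio fun t => (isOpen_AhatHom_lt hgrad hA h c t).measurableSet
    have h3 : (fun κ => inner ℂ (app (AhatHom volume A Ψ P κ) c) c)
        = fun κ => ((inner ℂ c (app (AhatHom volume A Ψ P κ) c)).re : ℂ) := by
      funext κ
      rw [← inner_conj_symm, elCorr_inner hgrad hA h κ c, Complex.conj_ofReal, Complex.ofReal_re]
    rw [h3]
    exact Complex.measurable_ofReal.comp h2
  have h4 : (fun κ => AhatHom volume A Ψ P κ i j) = fun κ => starRingEnd ℂ
      (inner ℂ (app (AhatHom volume A Ψ P κ) (EuclideanSpace.single j 1))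
        (EuclideanSpace.single i (1 : ℂ))) := by
    funext κ
    rw [inner_conj_symm, inner_single_left']
    simp [app_apply]
  rw [h4]
  have h5 : ∀ κ, inner ℂ (app (AhatHom volume A Ψ P κ) (EuclideanSpace.single j 1))
      (EuclideanSpace.single i (1 : ℂ)) = _ := fun κ =>
    inner_map_polarization (⟨⟨app (AhatHom volume A Ψ P κ), app_add _⟩, app_smul _⟩ : C3 →ₗ[ℂ] C3)
      (EuclideanSpace.single i (1 : ℂ)) (EuclideanSpace.single j 1)
  simp_rw [h5]
  refine Complex.continuous_conj.measurable.comp ?_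
  simp only [LinearMap.coe_mk, AddHom.coe_mk]
  exact ((((h1 _).sub (h1 _)).add ((h1 _).const_mul _)).sub ((h1 _).const_mul _)).div_const 4

lemma measurable_mul_apply {M N : R3 → CMat} (hM : ∀ i j, Measurable fun x => M x i j)
    (hN : ∀ i j, Measurable fun x => N x i j) (i j : Fin 3) :
    Measurable fun x => (M x * N x) i j := by
  simp only [Matrix.mul_apply]
  exact Finset.measurable_fun_sum _ fun k _ => (hM i k).mul (hN k j)

lemma measurable_inv_apply {M : R3 → CMat} (hM : ∀ i j, Measurable fun x => M x i j)
    (i j : Fin 3) : Measurable fun x => (M x)⁻¹ i j := by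
  simp only [Matrix.inv_def, Ring.inverse_eq_inv', Matrix.smul_apply, smul_eq_mul,
    Matrix.det_fin_three, Matrix.adjugate_fin_three]
  refine Measurable.mul ?_ ?_
  · fun_prop
  · fin_cases i <;> fin_cases j <;> simp <;> fun_prop

lemma measurable_crossI (i j : Fin 3) : Measurable fun θ => crossI θ i j := by
  have h : (fun θ => crossI θ i j) = fun θ => crI θ (EuclideanSpace.single j 1) i := by
    funext θ
    simp [crI, app_apply]
  rw [h]
  simp only [crI_apply]
  fin_cases i <;> fin_cases j <;> simp <;> fun_prop

lemma measurable_homMat (hgrad : ∀ φ : R3 → ℂ, PerTest φ → ∀ j, ∫ y in Q, pd j φ y = 0)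
    (hA : IsCoeff (fun y => (A y)⁻¹) α β) (h : IsCellFamily volume A Ψ P) (ε : ℝ) (i j : Fin 3) :
    Measurable fun θ => homMat A At Ψ P R ε θ i j := by
  have h1 : Measurable fun θ : R3 => AhatHom volume A Ψ P (ε • θ) i j :=
    (measurable_AhatHom hgrad hA h i j).comp (measurable_const_smul ε)
  have h2 : ∀ i j, Measurable fun θ => (crossI θ * AtHom volume At R) i j :=
    measurable_mul_apply (N := fun _ => AtHom volume At R) measurable_crossI
      fun _ _ => measurable_const
  exact (measurable_mul_apply h2 measurable_crossI i j).add h1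

/-- The matrix field `(iθ × At^hom iθ × + Â^hom_{εθ})⁻¹` is bounded. -/
lemma isBddMat_homMat_inv (hgrad : ∀ φ : R3 → ℂ, PerTest φ → ∀ j, ∫ y in Q, pd j φ y = 0)
    (hA : IsRootCoeff A C C' α β) (hs : IsCoeff At a b) (h : IsCellFamily volume A Ψ P)
    (h' : IsMagneticCell volume A At N R) (ε : ℝ) :
    IsBddMat (fun ξ => (homMat A At Ψ P R ε ((2 * Real.pi) • ξ))⁻¹) α⁻¹ := by
  refine ⟨fun i j => ?_, inv_nonneg.mpr hA.inv.pos.le, fun ξ v =>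
    norm_app_inv_le hA.inv.pos (homMat_lower hgrad hA hs h h' ε _) v⟩
  exact (measurable_inv_apply (measurable_homMat hgrad hA.inv h ε) i j).comp
    (measurable_const_smul (2 * Real.pi))

/-- Every mode of the homogenised solution solves the homogenised equation. -/
lemma exists_isMode (hgrad : ∀ φ : R3 → ℂ, PerTest φ → ∀ j, ∫ y in Q, pd j φ y = 0)
    (hA : IsRootCoeff A C C' α β) (hs : IsCoeff At a b) (h : IsCellFamily volume A Ψ P)
    (h' : IsMagneticCell volume A At N R) {ε : ℝ} (hε : 0 < ε) {θ k : R3} (hk : k = ε • θ)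
    (γ : C3) : ∃ Y r, IsMode (mulOp hA.inv.bdd volQ) (mulOp hs.bdd volQ) ε k
      (app (homMat A At Ψ P R ε θ)⁻¹ γ) γ Y r := by
  set w := app (homMat A At Ψ P R ε θ)⁻¹ γ with hw
  obtain ⟨r, hr, he⟩ := exists_app_AtHom hgrad hA hs h' (crI k w)
  refine ⟨elCorr h k w, r, isElCorr_elCorr hgrad hA.inv h k w, hr, ?_⟩
  have h1 := app_mul_inv (isUnit_det_of_lower hA.inv.pos (homMat_lower hgrad hA hs h h' ε θ)) γ
  rw [← hw, app_homMat] at h1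
  rw [← he, ← app_AhatHom hA.inv h, hk, ← h1, crI_smul_left, crI_smul_left, app_smul, crI_smul,
    smul_smul, smul_smul]
  congr 1
  -- The two curls at `k = εθ` carry `ε²`, which cancels the weight `ε⁻²` of the rescaled equation.
  have : ((ε⁻¹ ^ 2 : ℝ) : ℂ) * ε * ε = 1 := by
    have hε' : (ε : ℂ) ≠ 0 := by exact_mod_cast hε.ne'
    push_cast
    field_simp
  rw [this, one_smul]

end Symbol

/-! ### Weak differential equations on the Fourier side -/

section WeakEquations

open FourierTransform SchwartzMap LineDeriv

lemma norm_pd_le (j : Fin 3) (f : R3 → ℂ) (x : R3) : ‖pd j f x‖ ≤ ‖fderiv ℝ f x‖ := by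
  have := (fderiv ℝ f x).le_opNorm (EuclideanSpace.single j 1)
  simpa [pd] using this

/-- A smooth cutoff function on the ball of radius `2`. -/
def bump : ContDiffBump (0 : R3) := ⟨1, 2, one_pos, one_lt_two⟩

/-- The cutoff function `bump` on the scale `n + 1`. -/
def bumpN (n : ℕ) (x : R3) : ℂ := (bump (((n : ℝ) + 1)⁻¹ • x) : ℂ)

lemma contDiff_bumpN (n : ℕ) : ContDiff ℝ ∞ (bumpN n) :=
  Complex.ofRealCLM.contDiff.comp (bump.contDiff.comp (contDiff_const_smul _))

lemma hasCompactSupport_bumpN (n : ℕ) : HasCompactSupport (bumpN n) := by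
  have h : HasCompactSupport fun x : R3 => bump (((n : ℝ) + 1)⁻¹ • x) :=
    bump.hasCompactSupport.comp_homeomorph (Homeomorph.smulOfNeZero ((n : ℝ) + 1)⁻¹ (by positivity))
  exact h.comp_left Complex.ofReal_zero

lemma norm_bumpN_le (n : ℕ) (x : R3) : ‖bumpN n x‖ ≤ 1 := by
  rw [bumpN, Complex.norm_real, Real.norm_of_nonneg bump.nonneg]
  exact bump.le_one

lemma bumpN_eventuallyEq {n : ℕ} {x : R3} (h : ‖x‖ < n + 1) : bumpN n =ᶠ[𝓝 x] fun _ => 1 := by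
  filter_upwards [Metric.isOpen_ball.mem_nhds (show x ∈ Metric.ball (0 : R3) (n + 1) by simpa using h)]
    with y hy
  have hy' : ‖y‖ < n + 1 := by simpa using hy
  rw [bumpN, bump.one_of_mem_closedBall, Complex.ofReal_one]
  rw [mem_closedBall_zero_iff, norm_smul, norm_inv, Real.norm_of_nonneg (by positivity)]
  change _ ≤ (1 : ℝ)
  rw [inv_mul_le_iff₀ (by positivity)]
  linarith

lemma exists_norm_pd_bumpN_le : ∃ C : ℝ, ∀ n j x, ‖pd j (bumpN n) x‖ ≤ C := by
  let f : R3 → ℂ := fun x => (bump x : ℂ)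
  have hf : ContDiff ℝ ∞ f := Complex.ofRealCLM.contDiff.comp bump.contDiff
  have hfc : HasCompactSupport f := bump.hasCompactSupport.comp_left Complex.ofReal_zero
  obtain ⟨C, hC⟩ := (hf.continuous_fderiv (by simp)).bounded_above_of_compact_support (hfc.fderiv (𝕜 := ℝ))
  refine ⟨C, fun n j x => (norm_pd_le j _ x).trans ?_⟩
  have e : bumpN n = fun x => f (((n : ℝ) + 1)⁻¹ • x) := rfl
  rw [e, fderiv_comp_smul, norm_smul, norm_inv, Real.norm_of_nonneg (by positivity)]
  refine le_trans (mul_le_of_le_one_left (norm_nonneg _) (inv_le_one_of_one_le₀ ?_)) (hC _)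
  linarith [(Nat.cast_nonneg n : (0 : ℝ) ≤ n)]

/-- The field equation `-∑ L_j ∂_j f + f₀ = 0` in the sense of distributions. -/
def WeakEq (L : Fin 3 → C3 →L[ℂ] C3) (f f₀ : L2R) : Prop :=
  ∀ φ : R3 → ℂ, Test φ → (∑ j, ∫ x, pd j φ x • L j (f x)) + ∫ x, φ x • f₀ x = 0

variable {L : Fin 3 → C3 →L[ℂ] C3} {f f₀ : L2R}

lemma pd_schwartz (φ : 𝓢(R3, ℂ)) (j : Fin 3) (x : R3) :
    pd j φ x = (∂_{EuclideanSpace.single j (1 : ℝ)} φ) x := rfl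

lemma MemLp.integrable_smul_of_schwartz {g : R3 → C3} (hg : MemLp g 2) (φ : 𝓢(R3, ℂ)) :
    Integrable fun x => φ x • g x :=
  memLp_one_iff_integrable.mp (hg.smul (φ.memLp 2))

lemma memLp_clm (L : C3 →L[ℂ] C3) (f : L2R) : MemLp (fun x => L (f x)) 2 :=
  (Lp.memLp f).continuousLinearMap_comp L

/-- The Fourier transform of a test function is not compactly supported, so the class of test
functions must be enlarged. The cutoffs have uniformly bounded derivatives that vanish near any
given point from some index on, so dominated convergence applies. -/
lemma WeakEq.schwartz (h : WeakEq L f f₀) (φ : 𝓢(R3, ℂ)) :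
    (∑ j, ∫ x, pd j φ x • L j (f x)) + ∫ x, φ x • f₀ x = 0 := by
  obtain ⟨C, hC⟩ := exists_norm_pd_bumpN_le
  have hd : ∀ x, DifferentiableAt ℝ φ x := fun x => φ.differentiableAt
  have hdb : ∀ n x, DifferentiableAt ℝ (bumpN n) x := fun n x =>
    (contDiff_bumpN n).differentiable (by simp) x
  have ht : ∀ n : ℕ, Test fun x => bumpN n x * φ x := fun n =>
    ⟨(contDiff_bumpN n).mul (φ.smooth _), (hasCompactSupport_bumpN n).mul_right⟩
  have hev : ∀ x : R3, ∀ᶠ n : ℕ in atTop, ‖x‖ < n + 1 := fun x => by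
    obtain ⟨N, hN⟩ := exists_nat_gt ‖x‖
    filter_upwards [eventually_ge_atTop N] with n hn
    have : (N : ℝ) ≤ n := by exact_mod_cast hn
    linarith
  have l0 : Tendsto (fun n : ℕ => ∫ x, (bumpN n x * φ x) • f₀ x) atTop (𝓝 (∫ x, φ x • f₀ x)) := by
    refine tendsto_integral_of_dominated_convergence (fun x => ‖φ x • f₀ x‖) (fun n => ?_)
      (MemLp.integrable_smul_of_schwartz (Lp.memLp f₀) φ).norm (fun n => ?_) ?_
    · exact ((contDiff_bumpN n).continuous.mul φ.continuous).aestronglyMeasurable.smul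
        (Lp.aestronglyMeasurable f₀)
    · refine Eventually.of_forall fun x => ?_
      rw [mul_smul, norm_smul]
      exact mul_le_of_le_one_left (norm_nonneg _) (norm_bumpN_le n x)
    · refine Eventually.of_forall fun x => tendsto_const_nhds.congr' ?_
      filter_upwards [hev x] with n hn
      rw [(bumpN_eventuallyEq hn).eq_of_nhds, one_mul]
  have lj : ∀ j, Tendsto (fun n : ℕ => ∫ x, pd j (fun y => bumpN n y * φ y) x • L j (f x)) atTop
      (𝓝 (∫ x, pd j φ x • L j (f x))) := by
    intro j
    refine tendsto_integral_of_dominated_convergence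
      (fun x => C * ‖φ x • L j (f x)‖ + ‖pd j φ x • L j (f x)‖) (fun n => ?_)
      (((MemLp.integrable_smul_of_schwartz (memLp_clm (L j) f) φ).norm.const_mul C).add
        (MemLp.integrable_smul_of_schwartz (memLp_clm (L j) f)
          (∂_{EuclideanSpace.single j (1 : ℝ)} φ)).norm) (fun n => ?_) ?_
    · exact (contDiff_pd (ht n).1 j).continuous.aestronglyMeasurable.smul
        (memLp_clm (L j) f).1
    · refine Eventually.of_forall fun x => ?_
      rw [pd_mul (hdb n x) (hd x), add_smul, mul_smul, mul_smul]
      refine (norm_add_le _ _).trans (add_le_add ?_ ?_)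
      · rw [norm_smul]
        exact mul_le_mul_of_nonneg_right (hC n j x) (norm_nonneg _)
      · rw [norm_smul]
        exact mul_le_of_le_one_left (norm_nonneg _) (norm_bumpN_le n x)
    · refine Eventually.of_forall fun x => tendsto_const_nhds.congr' ?_
      filter_upwards [hev x] with n hn
      have e1 : pd j (bumpN n) x = 0 := by
        rw [pd, (bumpN_eventuallyEq hn).fderiv_eq]
        simp
      rw [pd_mul (hdb n x) (hd x), e1, (bumpN_eventuallyEq hn).eq_of_nhds, zero_mul, one_mul,
        zero_add]
  have hl := (tendsto_finsetSum Finset.univ fun j _ => lj j).add l0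
  have h0 : ∀ n : ℕ, (∑ j, ∫ x, pd j (fun y => bumpN n y * φ y) x • L j (f x))
      + ∫ x, (bumpN n x * φ x) • f₀ x = 0 := fun n => h _ (ht n)
  exact tendsto_nhds_unique hl (tendsto_const_nhds.congr fun n => (h0 n).symm)

/-- The symbol of a weak equation. -/
theorem WeakEq.fourier (h : WeakEq L f f₀) :
    ∀ᵐ ξ : R3, ∑ j, (-(2 * Real.pi * Complex.I) * ξ j) • L j (FT f ξ) + FT f₀ ξ = 0 := by
  have hloc : ∀ j, LocallyIntegrable fun ξ : R3 =>
      (-(2 * Real.pi * Complex.I) * ξ j) • L j (FT f ξ) := by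
    intro j
    rw [locallyIntegrable_iff]
    intro K hK
    refine IntegrableOn.continuousOn_smul ?_ (Continuous.continuousOn (by fun_prop)) hK
    exact ((memLp_clm (L j) (FT f)).locallyIntegrable (by norm_num)).integrableOn_isCompact hK
  have hloc0 : LocallyIntegrable (FT f₀) := (Lp.memLp (FT f₀)).locallyIntegrable (by norm_num)
  refine ae_eq_zero_of_integral_contDiff_smul_eq_zero
    ((locallyIntegrable_finsetSum _ fun j _ => hloc j).add hloc0) fun g hg hgc => ?_
  have hg' : ContDiff ℝ ∞ fun x => (g x : ℂ) := Complex.ofRealCLM.contDiff.comp hg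
  have hgc' : HasCompactSupport fun x => (g x : ℂ) := hgc.comp_left Complex.ofReal_zero
  let ψ : 𝓢(R3, ℂ) := hgc'.toSchwartzMap hg'
  have hψ : ∀ x, ψ x = (g x : ℂ) := fun x => rfl
  -- Chosen so that the `j`-th derivative of `𝓕 ψ` is the Fourier transform of `ψj j`.
  let ψj : Fin 3 → 𝓢(R3, ℂ) := fun j =>
    -(2 * Real.pi * Complex.I) • smulLeftCLM ℂ (inner ℝ · (EuclideanSpace.single j (1 : ℝ))) ψ
  have hψj : ∀ j ξ, ψj j ξ = -(2 * Real.pi * Complex.I) * ξ j * g ξ := by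
    intro j ξ
    have ht : (fun x : R3 => (inner ℝ x (EuclideanSpace.single j (1 : ℝ)) : ℝ)).HasTemperateGrowth := by
      fun_prop
    simp only [ψj, smul_apply, smulLeftCLM_apply_apply ht, hψ]
    simp [EuclideanSpace.inner_single_right]
    ring
  have e0 := h.schwartz (𝓕 ψ)
  have ej : ∀ j, ∫ x, pd j (𝓕 ψ : 𝓢(R3, ℂ)) x • L j (f x) = ∫ ξ, ψj j ξ • L j (FT f ξ) := by
    intro j
    simp_rw [pd_schwartz, lineDerivOp_fourier_eq]
    have h1 : ∀ (η : 𝓢(R3, ℂ)) (v : L2R), ∫ x, η x • L j (v x) = L j (∫ x, η x • v x) := by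
      intro η v
      rw [← ContinuousLinearMap.integral_comp_comm _
        (MemLp.integrable_smul_of_schwartz (Lp.memLp v) η)]
      simp
    rw [h1, h1, integral_schwartz_smul_FT]
  simp_rw [ej] at e0
  rw [integral_schwartz_smul_FT, ← integral_finsetSum _ fun j _ =>
    MemLp.integrable_smul_of_schwartz (memLp_clm (L j) (FT f)) (ψj j), ← integral_add
    (integrable_finsetSum _ fun j _ => MemLp.integrable_smul_of_schwartz (memLp_clm (L j) (FT f))
      (ψj j)) (MemLp.integrable_smul_of_schwartz (Lp.memLp (FT f₀)) ψ)] at e0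
  rw [← e0]
  refine integral_congr_ae (Eventually.of_forall fun ξ => ?_)
  simp only [hψj, hψ, smul_add, Finset.smul_sum, Complex.coe_smul]
  congr 1
  refine Finset.sum_congr rfl fun j _ => ?_
  rw [← Complex.coe_smul, smul_smul, mul_comm]

end WeakEquations

/-! ### Divergence and curl of square integrable fields -/

section WholeSpace

lemma Test.memLp {E : Type*} [NormedAddCommGroup E] [NormedSpace ℝ E] {f : R3 → E} (hf : Test f) :
    MemLp f 2 :=
  hf.1.continuous.memLp_of_hasCompactSupport hf.2

lemma Test.pd {f : R3 → ℂ} (hf : Test f) (j : Fin 3) : Test (pd j f) := by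
  refine ⟨contDiff_pd hf.1 j, (hf.2.fderiv (𝕜 := ℝ)).mono fun x hx => ?_⟩
  contrapose! hx
  simp only [Function.mem_support, not_not] at hx ⊢
  rw [PeriodicMaxwell.pd, hx]
  rfl

lemma Test.sub {f g : R3 → ℂ} (hf : Test f) (hg : Test g) : Test fun y => f y - g y :=
  ⟨hf.1.sub hg.1, hf.2.sub hg.2⟩

lemma Test.apply {F : R3 → C3} (hF : Test F) (i : Fin 3) : Test fun y => F y i :=
  ⟨(contDiff_piLp _ |>.mp hF.1) i, hF.2.comp_left (g := fun v : C3 => v i) rfl⟩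

lemma Test.toLp {f : Fin 3 → R3 → ℂ} (hf : ∀ i, Test (f i)) :
    Test (E := C3) fun y => WithLp.toLp 2 fun i => f i y := by
  refine ⟨(PiLp.contDiff_toLp (𝕜 := ℝ) (p := 2) (n := ∞)).comp (contDiff_pi.mpr fun i => (hf i).1),
    ?_⟩
  have h : HasCompactSupport fun y => (f 0 y, f 1 y, f 2 y) := by
    refine HasCompactSupport.of_support_subset_isCompact
      (((hf 0).2.isCompact.union (hf 1).2.isCompact).union (hf 2).2.isCompact) fun y hy => ?_
    by_contra hn
    simp only [Set.mem_union, not_or] at hn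
    refine hy ?_
    simp [image_eq_zero_of_notMem_tsupport hn.1.1, image_eq_zero_of_notMem_tsupport hn.1.2,
      image_eq_zero_of_notMem_tsupport hn.2]
  refine h.mono fun y hy => ?_
  contrapose! hy
  simp only [Function.mem_support, not_not, Prod.mk_eq_zero] at hy ⊢
  ext i
  fin_cases i
  exacts [hy.1, hy.2.1, hy.2.2]

lemma Test.curl {F : R3 → C3} (hF : Test F) : Test (PeriodicMaxwell.curl F) := by
  have : PeriodicMaxwell.curl F = fun y => WithLp.toLp 2 fun i =>
      PeriodicMaxwell.pd (i + 1) (fun y => F y (i + 2)) y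
        - PeriodicMaxwell.pd (i + 2) (fun y => F y (i + 1)) y := by
    funext y; ext i; exact curl_apply F y i
  rw [this]
  exact Test.toLp fun i => ((hF.apply _).pd _).sub ((hF.apply _).pd _)

lemma pd_conj {f : R3 → ℂ} (hf : ContDiff ℝ ∞ f) (j : Fin 3) (x : R3) :
    pd j (fun y => starRingEnd ℂ (f y)) x = starRingEnd ℂ (pd j f x) := by
  have h := (Complex.conjCLE.toContinuousLinearMap.hasFDerivAt).comp x
    (hf.differentiable (by simp) x).hasFDerivAt
  have e : (fun y => starRingEnd ℂ (f y)) = Complex.conjCLE.toContinuousLinearMap ∘ f := rfl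
  rw [pd, e, h.fderiv]
  rfl

lemma Test.conj {f : R3 → ℂ} (hf : Test f) : Test fun y => starRingEnd ℂ (f y) :=
  ⟨Complex.conjCLE.contDiff.comp hf.1, hf.2.comp_left (map_zero _)⟩

lemma integral_pd_mul_conj {f g : R3 → ℂ} (hf : Test f) (hg : Test g) (j : Fin 3) :
    ∫ x, pd j f x * starRingEnd ℂ (g x) = - ∫ x, f x * starRingEnd ℂ (pd j g x) := by
  have hg' := hg.conj
  have h := integral_mul_fderiv_eq_neg_fderiv_mul_of_integrable (μ := (volume : Measure R3))
    (f := f) (g := fun x => starRingEnd ℂ (g x)) (v := EuclideanSpace.single j (1 : ℝ))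
    ((hf.pd j).memLp.integrable_mul hg'.memLp) (hf.memLp.integrable_mul (hg'.pd j).memLp)
    (hf.memLp.integrable_mul hg'.memLp) (fun x _ => hf.1.differentiable (by simp) x)
    (fun x _ => hg'.1.differentiable (by simp) x)
  have e : ∀ x, starRingEnd ℂ (pd j g x)
      = fderiv ℝ (fun x => starRingEnd ℂ (g x)) x (EuclideanSpace.single j 1) :=
    fun x => (pd_conj hg.1 j x).symm
  simp_rw [e, h, neg_neg]
  rfl

lemma integral_cdot_curl {F G : R3 → C3} (hF : Test F) (hG : Test G) :
    ∫ x, cdot (curl F x) (G x) = ∫ x, cdot (F x) (curl G x) := by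
  have hi : ∀ {f g : R3 → ℂ}, Test f → Test g → Integrable fun x => f x * starRingEnd ℂ (g x) :=
    fun hf hg => hf.memLp.integrable_mul hg.conj.memLp
  simp only [cdot, curl_apply]
  simp only [sub_mul, map_sub, mul_sub]
  rw [integral_finsetSum, integral_finsetSum]
  rotate_left
  · exact fun i _ => (hi (hF.apply _) ((hG.apply _).pd _)).sub (hi (hF.apply _) ((hG.apply _).pd _))
  · exact fun i _ => (hi ((hF.apply _).pd _) (hG.apply _)).sub (hi ((hF.apply _).pd _) (hG.apply _))
  have h1 : ∀ i : Fin 3, ∫ x, (pd (i + 1) (fun y => F y (i + 2)) x * starRingEnd ℂ (G x i)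
      - pd (i + 2) (fun y => F y (i + 1)) x * starRingEnd ℂ (G x i))
      = (∫ x, F x (i + 1) * starRingEnd ℂ (pd (i + 2) (fun y => G y i) x))
        - ∫ x, F x (i + 2) * starRingEnd ℂ (pd (i + 1) (fun y => G y i) x) := fun i => by
    rw [integral_sub (hi ((hF.apply _).pd _) (hG.apply _)) (hi ((hF.apply _).pd _) (hG.apply _)),
      integral_pd_mul_conj (hF.apply _) (hG.apply _), integral_pd_mul_conj (hF.apply _) (hG.apply _)]
    ring
  have h2 : ∀ i : Fin 3, ∫ x, (F x i * starRingEnd ℂ (pd (i + 1) (fun y => G y (i + 2)) x)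
      - F x i * starRingEnd ℂ (pd (i + 2) (fun y => G y (i + 1)) x))
      = (∫ x, F x i * starRingEnd ℂ (pd (i + 1) (fun y => G y (i + 2)) x))
        - ∫ x, F x i * starRingEnd ℂ (pd (i + 2) (fun y => G y (i + 1)) x) := fun i =>
    integral_sub (hi (hF.apply _) ((hG.apply _).pd _)) (hi (hF.apply _) ((hG.apply _).pd _))
  simp only [h1, h2, Fin.sum_univ_three]
  simp only [Fin.isValue, Fin.reduceAdd, zero_add]
  ring

lemma enorm_integral_cdot_le {f g : R3 → C3} {ν : Measure R3} (hf : MemLp f 2 ν)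
    (hg : MemLp g 2 ν) : ‖∫ x, cdot (f x) (g x) ∂ν‖ₑ ≤ eLpNorm f 2 ν * eLpNorm g 2 ν := by
  rw [integral_cdot_eq_inner hf hg, ← Lp.enorm_toLp hf, ← Lp.enorm_toLp hg, ← ofReal_norm,
    ← ofReal_norm, ← ofReal_norm, ← ENNReal.ofReal_mul (norm_nonneg _), mul_comm]
  exact ENNReal.ofReal_le_ofReal (norm_inner_le_norm _ _)

lemma MemLp.integrable_cdot {f g : R3 → C3} {ν : Measure R3} (hf : MemLp f 2 ν)
    (hg : MemLp g 2 ν) : Integrable (fun x => cdot (f x) (g x)) ν := by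
  refine (L2.integrable_inner (𝕜 := ℂ) (hg.toLp g) (hf.toLp f)).congr ?_
  filter_upwards [hf.coeFn_toLp, hg.coeFn_toLp] with y h1 h2
  rw [h1, h2, cdot_eq_inner]

lemma cdot_sub_left (a b c : C3) : cdot (a - b) c = cdot a c - cdot b c := by
  simp [cdot_eq_inner]

lemma integral_cdot_sub_left {f f' g : R3 → C3} {ν : Measure R3} (hf : MemLp f 2 ν)
    (hf' : MemLp f' 2 ν) (hg : MemLp g 2 ν) : ∫ x, cdot (f x - f' x) (g x) ∂ν
      = ∫ x, cdot (f x) (g x) ∂ν - ∫ x, cdot (f' x) (g x) ∂ν := by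
  simp only [cdot_sub_left]
  exact integral_sub (MemLp.integrable_cdot hf hg) (MemLp.integrable_cdot hf' hg)

/-- The defining relation of a curl in the sense of distributions. -/
lemma MemHCurl.integral_eq {S : R3 → RMat} {C : ℝ} (hS : IsBddMat (fun x => cm (S x)) C)
    {u v : R3 → C3} (h : MemHCurl Test S volume u v) {G : R3 → C3} (hG : Test G) :
    ∫ x, cdot (v x) (G x) = ∫ x, cdot (app (cm (S x)) (u x)) (curl G x) := by
  obtain ⟨hu, hv, h⟩ := h
  refine eq_of_forall_enorm_sub_le
    (K := eLpNorm G 2 volume + ENNReal.ofReal C * eLpNorm (curl G) 2 volume)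
    (ENNReal.add_ne_top.mpr ⟨hG.memLp.2.ne, ENNReal.mul_ne_top ENNReal.ofReal_ne_top
      hG.curl.memLp.2.ne⟩) fun δ hδ => ?_
  obtain ⟨f, hf, h1, h2⟩ := h δ hδ
  have e1 := integral_cdot_sub_left hv hf.curl.memLp hG.memLp
  have e2 := integral_cdot_sub_left (hS.memLp hu) hf.memLp hG.curl.memLp
  have e : (∫ x, cdot (v x) (G x)) - ∫ x, cdot (app (cm (S x)) (u x)) (curl G x)
      = (∫ x, cdot (v x - curl (fun z => app (cm (S z)) (f z)) x) (G x))
        - ∫ x, cdot (app (cm (S x)) (u x) - app (cm (S x)) (f x)) (curl G x) := by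
    rw [e1, e2, integral_cdot_curl hf hG]
    ring
  rw [e, add_mul]
  refine enorm_sub_le.trans (add_le_add ?_ ?_)
  · refine (enorm_integral_cdot_le (hv.sub hf.curl.memLp) hG.memLp).trans ?_
    rw [mul_comm]
    exact mul_le_mul' le_rfl h2
  · refine (enorm_integral_cdot_le ((hS.memLp hu).sub hf.memLp) hG.curl.memLp).trans ?_
    have h3 : eLpNorm ((fun x => app (cm (S x)) (u x)) - fun x => app (cm (S x)) (f x)) 2 volume
        ≤ ENNReal.ofReal C * ENNReal.ofReal δ := by
      refine le_trans (le_of_eq ?_) ((hS.eLpNorm_le (fun x => u x - f x)).trans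
        (mul_le_mul' le_rfl h1))
      simp_rw [app_sub]
      rfl
    refine (mul_le_mul' h3 le_rfl).trans (le_of_eq ?_)
    ring

/-- The map `v ↦ ik × v`. -/
def crIL (k : R3) : C3 →L[ℂ] C3 :=
  LinearMap.toContinuousLinearMap ⟨⟨crI k, crI_add k⟩, fun c v => crI_smul k c v⟩

lemma crIL_apply (k : R3) (v : C3) : crIL k v = crI k v := rfl

lemma integral_apply {G : R3 → C3} (hG : Integrable G) (i : Fin 3) :
    (∫ x, G x) i = ∫ x, G x i :=
  ((EuclideanSpace.proj i : C3 →L[ℂ] ℂ).integral_comp_comm hG).symm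

lemma Test.integrable_smul {φ : R3 → ℂ} (hφ : Test φ) {g : R3 → C3} (hg : MemLp g 2) :
    Integrable fun x => φ x • g x :=
  memLp_one_iff_integrable.mp (hg.smul hφ.memLp)

lemma weakEq_of_apply {L : Fin 3 → C3 →L[ℂ] C3} {f f₀ : L2R}
    (h : ∀ φ, Test φ → ∀ i, ∫ x, ((∑ j, pd j φ x * L j (f x) i) + φ x * f₀ x i) = 0) :
    WeakEq L f f₀ := by
  intro φ hφ
  have hi := fun j => (hφ.pd j).integrable_smul (memLp_clm (L j) f)
  have hi0 := hφ.integrable_smul (Lp.memLp f₀)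
  rw [← integral_finsetSum _ fun j _ => hi j,
    ← integral_add (integrable_finsetSum _ fun j _ => hi j) hi0]
  ext i
  refine (integral_apply ((integrable_finsetSum _ fun j _ => hi j).add hi0) i).trans ?_
  refine Eq.trans ?_ (h φ hφ i)
  refine integral_congr_ae (Eventually.of_forall fun x => ?_)
  simp [WithLp.ofLp_sum, Finset.sum_apply]

lemma pd_smul_single {φ : R3 → ℂ} (hφ : ContDiff ℝ ∞ φ) (i k l : Fin 3) (x : R3) :
    pd k (fun y => (starRingEnd ℂ (φ y) • EuclideanSpace.single i (1 : ℂ) : C3) l) x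
      = if l = i then starRingEnd ℂ (pd k φ x) else 0 := by
  split_ifs with h
  · subst h
    rw [← pd_conj hφ]
    simp
  · simp [h, pd]

lemma crI_eq_sum (k : R3) (v : C3) :
    crI k v = ∑ j, (k j : ℂ) • crI (EuclideanSpace.single j 1) v := by
  ext i
  simp only [crI_apply, Fin.sum_univ_three]
  fin_cases i <;> simp <;> ring

/-- A weak curl equation on the Fourier side. -/
lemma fourier_of_weak_curl {f f₀ : L2R}
    (h : ∀ G : R3 → C3, Test G → (∫ x, cdot (f x) (curl G x)) + ∫ x, cdot (f₀ x) (G x) = 0) :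
    ∀ᵐ ξ : R3, crI ((2 * Real.pi) • ξ) (FT f ξ) + FT f₀ ξ = 0 := by
  have hw : WeakEq (fun j => Complex.I • crIL (EuclideanSpace.single j 1)) f f₀ := by
    refine weakEq_of_apply fun φ hφ i => ?_
    -- The conjugate undoes the conjugation in `cdot`, so that this test field picks out the `i`-th
    -- component of the equation.
    have hG : Test fun x => (starRingEnd ℂ (φ x) • EuclideanSpace.single i (1 : ℂ) : C3) :=
      ⟨hφ.conj.1.smul contDiff_const, hφ.conj.2.smul_right⟩
    have h1 := h _ hG
    rw [← integral_add (MemLp.integrable_cdot (Lp.memLp f) hG.curl.memLp)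
      (MemLp.integrable_cdot (Lp.memLp f₀) hG.memLp)] at h1
    refine Eq.trans (integral_congr_ae (Eventually.of_forall fun x => ?_)) h1
    have hc : ∀ k, curl (fun x => (starRingEnd ℂ (φ x) • EuclideanSpace.single i (1 : ℂ) : C3)) x k
        = (if k + 2 = i then starRingEnd ℂ (pd (k + 1) φ x) else 0)
          - if k + 1 = i then starRingEnd ℂ (pd (k + 2) φ x) else 0 := fun k => by
      rw [curl_apply, pd_smul_single hφ.1, pd_smul_single hφ.1]
    simp only [cdot, hc, smul_apply, crIL_apply, crI_apply, Fin.sum_univ_three, PiLp.smul_apply]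
    fin_cases i <;> simp <;> ring_nf <;> simp only [Complex.I_sq] <;> ring
  filter_upwards [hw.fourier] with ξ hξ
  rw [← hξ, crI_eq_sum]
  congr 1
  refine Finset.sum_congr rfl fun j _ => ?_
  rw [smul_apply, crIL_apply, smul_smul]
  congr 1
  simp only [PiLp.smul_apply, smul_eq_mul]
  push_cast
  linear_combination (2 * Real.pi * ξ j : ℂ) * Complex.I_mul_I

/-- A weak divergence equation on the Fourier side. -/
lemma fourier_of_divFree {g : L2R} (h : DivFree volume g) :
    ∀ᵐ ξ : R3, inner ℂ (cv ξ) (FT g ξ) = 0 := by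
  -- The scalar divergence equation is stored in the first component of a vector equation.
  have hw : WeakEq (fun j => (EuclideanSpace.proj j : C3 →L[ℂ] ℂ).smulRight
      (EuclideanSpace.single 0 (1 : ℂ))) g 0 := by
    refine weakEq_of_apply fun φ hφ i => ?_
    have h1 := h _ hφ.conj
    have h2 : ∫ x, (∑ j, pd j φ x * g x j) * (EuclideanSpace.single 0 (1 : ℂ) : C3) i = 0 := by
      rw [integral_mul_const]
      refine mul_eq_zero_of_left (Eq.trans (integral_congr_ae (Eventually.of_forall fun x => ?_)) h1) _
      simp only [cdot, grad, pd_conj hφ.1, Complex.conj_conj]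
      exact Finset.sum_congr rfl fun j _ => mul_comm _ _
    refine Eq.trans (integral_congr_ae ?_) h2
    filter_upwards [Lp.coeFn_zero C3 2 (volume : Measure R3)] with x hx
    rw [hx, Finset.sum_mul]
    simp
  filter_upwards [hw.fourier, (Lp.coeFn_zero C3 2 (volume : Measure R3))] with ξ hξ h0
  rw [map_zero, h0] at hξ
  have h1 := congrArg (fun v : C3 => v 0) hξ
  simp only [Fin.sum_univ_three] at h1
  simp at h1
  have h2 : (-(2 * Real.pi * Complex.I) : ℂ) ≠ 0 := by
    simp [Real.pi_ne_zero]
  rw [inner_C3]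
  simp only [cv_apply, Complex.conj_ofReal]
  refine mul_left_cancel₀ h2 ?_
  linear_combination h1

end WholeSpace

/-! ### The Maxwell problem in the whole space -/

section Maxwell

variable {S : R3 → RMat} {C C' : ℝ}

lemma pd_add {f g : R3 → ℂ} {x : R3} (hf : DifferentiableAt ℝ f x) (hg : DifferentiableAt ℝ g x)
    (j : Fin 3) : pd j (fun y => f y + g y) x = pd j f x + pd j g x := by
  simp only [pd]
  rw [fderiv_fun_add hf hg, add_apply]

lemma curl_add {F G : R3 → C3} (hF : Test F) (hG : Test G) (x : R3) :
    curl (fun y => F y + G y) x = curl F x + curl G x := by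
  have hd : ∀ {H : R3 → C3}, Test H → ∀ i, DifferentiableAt ℝ (fun y => H y i) x :=
    fun hH i => (hH.apply i).1.differentiable (by simp) x
  ext i
  simp only [PiLp.add_apply, curl_apply]
  rw [pd_add (hd hF _) (hd hG _), pd_add (hd hF _) (hd hG _)]
  ring

lemma curl_smul {F : R3 → C3} (hF : Test F) (c : ℂ) (x : R3) :
    curl (fun y => c • F y) x = c • curl F x := by
  have hd : ∀ i, DifferentiableAt ℝ (fun y => F y i) x :=
    fun i => (hF.apply i).1.differentiable (by simp) x
  have hp : ∀ k i, pd k (fun y => c * F y i) x = c * pd k (fun y => F y i) x := fun k i => by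
    rw [pd_mul (differentiableAt_const c) (hd i)]
    simp [pd]
  ext i
  simp only [PiLp.smul_apply, curl_apply, smul_eq_mul, hp]
  ring

/-- The pairs `(S⁻¹ F, curl F)` with a test field `F`. -/
def curlPairs (S : R3 → RMat) : Submodule ℂ (WithLp 2 (L2R × L2R)) where
  carrier := {p | ∃ F, Test F ∧ (p.fst =ᵐ[volume] fun x => app (cm (S x)⁻¹) (F x)) ∧
    p.snd =ᵐ[volume] curl F}
  add_mem' := by
    rintro p q ⟨F, hF, h1, h2⟩ ⟨G, hG, h3, h4⟩
    refine ⟨fun x => F x + G x, ⟨hF.1.add hG.1, hF.2.add hG.2⟩, ?_, ?_⟩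
    · filter_upwards [Lp.coeFn_add p.fst q.fst, h1, h3] with x e1 e2 e3
      rw [app_add, ← e2, ← e3]
      exact e1
    · filter_upwards [Lp.coeFn_add p.snd q.snd, h2, h4] with x e1 e2 e3
      rw [curl_add hF hG, ← e2, ← e3]
      exact e1
  zero_mem' := by
    refine ⟨0, ⟨contDiff_const, HasCompactSupport.zero⟩, ?_, ?_⟩
    · filter_upwards [Lp.coeFn_zero C3 2 (volume : Measure R3)] with x hx
      refine hx.trans ?_
      simpa using (app_smul (cm (S x)⁻¹) 0 0).symm
    · filter_upwards [Lp.coeFn_zero C3 2 (volume : Measure R3)] with x hx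
      refine hx.trans ?_
      ext i
      simp [curl_apply, pd]
  smul_mem' := by
    rintro c p ⟨F, hF, h1, h2⟩
    refine ⟨fun x => c • F x, ⟨hF.1.const_smul c, hF.2.mono fun x hx => ?_⟩, ?_, ?_⟩
    · contrapose! hx
      simp only [Function.mem_support, not_not] at hx ⊢
      rw [hx, smul_zero]
    · filter_upwards [Lp.coeFn_smul c p.fst, h1] with x e1 e2
      rw [app_smul, ← e2]
      exact e1
    · filter_upwards [Lp.coeFn_smul c p.snd, h2] with x e1 e2
      rw [curl_smul hF, ← e2]
      exact e1

lemma eLpNorm_sub_eq_enorm {E : Type*} [NormedAddCommGroup E] {ν : Measure R3} {p q : Lp E 2 ν}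
    {f g : R3 → E} (hf : p =ᵐ[ν] f) (hg : q =ᵐ[ν] g) :
    eLpNorm (fun x => f x - g x) 2 ν = ‖p - q‖ₑ := by
  rw [Lp.enorm_def]
  refine eLpNorm_congr_ae ?_
  filter_upwards [Lp.coeFn_sub p q, hf, hg] with x h1 h2 h3
  rw [h1, Pi.sub_apply, h2, h3]

lemma norm_fst_le (p : WithLp 2 (L2R × L2R)) : ‖p.fst‖ ≤ ‖p‖ := by
  have := WithLp.prod_norm_sq_eq_of_L2 p
  exact le_of_sq_le_sq (by linarith [sq_nonneg ‖p.snd‖]) (norm_nonneg _)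

lemma norm_snd_le (p : WithLp 2 (L2R × L2R)) : ‖p.snd‖ ≤ ‖p‖ := by
  have := WithLp.prod_norm_sq_eq_of_L2 p
  exact le_of_sq_le_sq (by linarith [sq_nonneg ‖p.fst‖]) (norm_nonneg _)

lemma norm_le_add (p : WithLp 2 (L2R × L2R)) : ‖p‖ ≤ ‖p.fst‖ + ‖p.snd‖ := by
  have := WithLp.prod_norm_sq_eq_of_L2 p
  refine le_of_sq_le_sq ?_ (by positivity)
  nlinarith [mul_nonneg (norm_nonneg p.fst) (norm_nonneg p.snd)]

lemma memHCurl_of_mem_closure (hS : ∀ x, (S x).det ≠ 0) {p : WithLp 2 (L2R × L2R)}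
    (hp : p ∈ (curlPairs S).topologicalClosure) : MemHCurl Test S volume p.fst p.snd := by
  refine ⟨Lp.memLp _, Lp.memLp _, fun δ hδ => ?_⟩
  obtain ⟨q, ⟨F, hF, h1, h2⟩, hq⟩ := Metric.mem_closure_iff.mp hp δ hδ
  rw [dist_eq_norm] at hq
  refine ⟨fun x => app (cm (S x)⁻¹) (F x), ?_, ?_, ?_⟩
  · simp_rw [app_cm_inv (hS _)]
    exact hF
  · rw [eLpNorm_sub_eq_enorm (EventuallyEq.refl _ _) h1, ← ofReal_norm]
    exact ENNReal.ofReal_le_ofReal ((norm_fst_le (p - q)).trans hq.le)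
  · simp_rw [app_cm_inv (hS _)]
    rw [eLpNorm_sub_eq_enorm (EventuallyEq.refl _ _) h2, ← ofReal_norm]
    exact ENNReal.ofReal_le_ofReal ((norm_snd_le (p - q)).trans hq.le)

lemma mem_closure_of_memHCurl (hS : ∀ x, (S x).det ≠ 0)
    (hS' : IsBddMat (fun x => cm (S x)⁻¹) C') {u v : R3 → C3} (h : MemHCurl Test S volume u v) :
    WithLp.toLp 2 (h.1.toLp u, h.2.1.toLp v) ∈ (curlPairs S).topologicalClosure := by
  refine Metric.mem_closure_iff.mpr fun δ hδ => ?_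
  obtain ⟨φ, hF, h1, h2⟩ := h.2.2 (δ / 3) (by positivity)
  have hφ : ∀ x, φ x = app (cm (S x)⁻¹) (app (cm (S x)) (φ x)) := fun x =>
    (app_inv_cm (hS x) _).symm
  have hm : MemLp φ 2 := by
    have := hS'.memLp hF.memLp
    simp_rw [← hφ] at this
    exact this
  refine ⟨WithLp.toLp 2 (hm.toLp φ, hF.curl.memLp.toLp _), ⟨_, hF, ?_, hF.curl.memLp.coeFn_toLp⟩, ?_⟩
  · filter_upwards [hm.coeFn_toLp] with x hx
    rw [← hφ]
    exact hx
  · rw [dist_eq_norm]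
    rw [eLpNorm_sub_eq_enorm h.1.coeFn_toLp hm.coeFn_toLp, ← ofReal_norm,
      ENNReal.ofReal_le_ofReal_iff (by positivity)] at h1
    rw [eLpNorm_sub_eq_enorm h.2.1.coeFn_toLp hF.curl.memLp.coeFn_toLp, ← ofReal_norm,
      ENNReal.ofReal_le_ofReal_iff (by positivity)] at h2
    refine (norm_le_add _).trans_lt ?_
    refine (add_le_add h1 h2).trans_lt (by linarith)

/-- Solvability of the Maxwell problem. -/
theorem exists_maxwell (hS : ∀ x, (S x).det ≠ 0) (hS' : IsBddMat (fun x => cm (S x)⁻¹) C')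
    {M : R3 → CMat} {c a : ℝ} (hM : IsBddMat M c) (ha : 0 < a)
    (hlow : ∀ y v, a * ‖v‖ ^ 2 ≤ (inner ℂ v (app (M y) v)).re) {f : R3 → C3} (hf : MemLp f 2) :
    ∃ D B, MemHCurl Test S volume D B ∧ ∀ φ w, MemHCurl Test S volume φ w →
      (∫ x, cdot (app (M x) (B x)) (w x)) + ∫ x, cdot (D x) (φ x) = - ∫ x, cdot (f x) (φ x) := by
  let e := WithLp.prodContinuousLinearEquiv 2 ℂ L2R L2R
  let T : WithLp 2 (L2R × L2R) →L[ℂ] WithLp 2 (L2R × L2R) :=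
    (e.symm : L2R × L2R →L[ℂ] WithLp 2 (L2R × L2R)).comp
      (((ContinuousLinearMap.id ℂ L2R).prodMap (mulOp hM volume)).comp
        (e : WithLp 2 (L2R × L2R) →L[ℂ] L2R × L2R))
  have hT : ∀ p q, inner ℂ p (T q) = inner ℂ p.fst q.fst + inner ℂ p.snd (mulOp hM volume q.snd) :=
    fun p q => WithLp.prod_inner_apply p (T q)
  -- The pair of field and curl is the unknown, and `T = id ⊕ M` is coercive on the whole product;
  -- restricting to the closure of `curlPairs` gives the weak equation.
  have hT' : ∀ p, min 1 a * ‖p‖ ^ 2 ≤ (inner ℂ p (T p)).re := by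
    intro p
    rw [hT, Complex.add_re, WithLp.prod_norm_sq_eq_of_L2, mul_add]
    refine add_le_add ?_ ((mul_le_mul_of_nonneg_right (min_le_right _ _) (by positivity)).trans
      (mulOp_coercive hM hlow _))
    have h1 : (inner ℂ p.fst p.fst).re = ‖p.fst‖ ^ 2 := by
      rw [inner_self_eq_norm_sq_to_K]
      norm_cast
    rw [h1]
    exact mul_le_of_le_one_left (by positivity) (min_le_left _ _)
  obtain ⟨p, hp, h⟩ := exists_mem_forall_inner_eq_zero T (lt_min one_pos ha) hT'
    (curlPairs S).topologicalClosure (curlPairs S).isClosed_topologicalClosure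
    (-(WithLp.toLp 2 (hf.toLp f, 0)))
  refine ⟨p.fst, p.snd, memHCurl_of_mem_closure hS hp, fun φ w hw => ?_⟩
  have h1 := h _ (mem_closure_of_memHCurl hS hS' hw)
  rw [sub_neg_eq_add, inner_add_right, hT, WithLp.prod_inner_apply] at h1
  simp only [inner_zero_right, add_zero] at h1
  rw [integral_cdot_eq_inner (hM.memLp (Lp.memLp _)) hw.2.1, integral_cdot_eq_inner (Lp.memLp _) hw.1,
    integral_cdot_eq_inner hf hw.1, ← mulOp_toLp hM (Lp.memLp p.snd), Lp.toLp_coeFn, Lp.toLp_coeFn,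
    add_comm]
  exact eq_neg_of_add_eq_zero_left h1

lemma memHCurl_of_test (hS : ∀ x, (S x).det ≠ 0) (hS' : IsBddMat (fun x => cm (S x)⁻¹) C')
    {G : R3 → C3} (hG : Test G) :
    MemHCurl Test S volume (fun x => app (cm (S x)⁻¹) (G x)) (curl G) := by
  refine ⟨hS'.memLp hG.memLp, hG.curl.memLp, fun δ _ =>
    ⟨fun y => app (cm (S y)⁻¹) (G y), ?_, by simp, ?_⟩⟩
  · simp_rw [app_cm_inv (hS _)]
    exact hG
  · simp_rw [app_cm_inv (hS _)]
    simp

lemma MemHCurl.fourier (hS : IsBddMat (fun x => cm (S x)) C) {u v : R3 → C3}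
    (h : MemHCurl Test S volume u v) : ∀ᵐ ξ : R3,
      FT (h.2.1.toLp v) ξ = crI ((2 * Real.pi) • ξ) (FT ((hS.memLp h.1).toLp _) ξ) := by
  have h1 := fourier_of_weak_curl (f := (hS.memLp h.1).toLp _) (f₀ := -h.2.1.toLp v) fun G hG => by
    have h2 := h.integral_eq hS hG
    rw [integral_cdot_eq_inner h.2.1 hG.memLp, integral_cdot_eq_inner (hS.memLp h.1) hG.curl.memLp]
      at h2
    rw [integral_cdot_eq_inner (Lp.memLp _) hG.memLp, integral_cdot_eq_inner (Lp.memLp _)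
      hG.curl.memLp, Lp.toLp_coeFn, Lp.toLp_coeFn, inner_neg_right, h2, add_neg_cancel]
  filter_upwards [h1, Lp.coeFn_neg (FT (h.2.1.toLp v))] with ξ h2 h3
  rw [map_neg, h3, Pi.neg_apply] at h2
  exact (add_neg_eq_zero.mp h2).symm

variable {A At : R3 → RMat} {α β a b ε : ℝ}

/-- The Maxwell equation on the Fourier side. -/
lemma fourier_maxwell (hA : IsRootCoeff A C C' α β) (hs : IsCoeff At a b) {g D B : R3 → C3}
    (hg : MemLp g 2) (h : MemHCurl Test (fun x => msqrt (A (ε⁻¹ • x))) volume D B)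
    (heq : ∀ φ w : R3 → C3, MemHCurl Test (fun x => msqrt (A (ε⁻¹ • x))) volume φ w →
      (∫ x, cdot (app (cm (At (ε⁻¹ • x))) (B x)) (w x)) + ∫ x, cdot (D x) (φ x)
        = - ∫ x, cdot (app (cm (msqrt (A (ε⁻¹ • x)))) (g x)) (φ x)) :
    ∀ᵐ ξ : R3, crI ((2 * Real.pi) • ξ) (FT (mulOp (hs.bdd.rescale ε) volume (h.2.1.toLp B)) ξ)
      + FT (mulOp (hA.inv.bdd.rescale ε) volume (((hA.root.rescale ε).memLp h.1).toLp _)) ξ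
      = -FT (hg.toLp g) ξ := by
  have hdet : ∀ x, (msqrt (A (ε⁻¹ • x))).det ≠ 0 := fun x => det_msqrt_ne_zero (hA.posDef _)
  have hS' := hA.root_inv.rescale ε
  have hm := (hA.inv.bdd.rescale ε).memLp ((hA.root.rescale ε).memLp h.1)
  have h1 := fourier_of_weak_curl
    (f := mulOp (hs.bdd.rescale ε) volume (h.2.1.toLp B))
    (f₀ := mulOp (hA.inv.bdd.rescale ε) volume (((hA.root.rescale ε).memLp h.1).toLp _)
      + hg.toLp g) fun G hG => by
    -- The test pair `(A^{-1/2} G, curl G)` turns the equation for `D` into `curl (At B) + A⁻¹ u =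
    -- -g` with `u = A^{1/2} D`.
    have h2 := heq _ _ (memHCurl_of_test hdet hS' hG)
    have e1 : ∀ x, cdot (D x) (app (cm (msqrt (A (ε⁻¹ • x)))⁻¹) (G x))
        = cdot (app (cm (A (ε⁻¹ • x))⁻¹) (app (cm (msqrt (A (ε⁻¹ • x)))) (D x))) (G x) := fun x => by
      rw [cm_inv_eq (hA.posDef _), app_mul, app_inv_cm (hdet x), cdot_eq_inner, cdot_eq_inner,
        inner_app_symm (msqrt_inv_isSymm _)]
    have e2 : ∀ x, cdot (app (cm (msqrt (A (ε⁻¹ • x)))) (g x))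
        (app (cm (msqrt (A (ε⁻¹ • x)))⁻¹) (G x)) = cdot (g x) (G x) := fun x => by
      rw [cdot_eq_inner, cdot_eq_inner, inner_app_symm (msqrt_inv_isSymm _), app_inv_cm (hdet x)]
    simp_rw [e1, e2] at h2
    rw [integral_cdot_eq_inner ((hs.bdd.rescale ε).memLp h.2.1) hG.curl.memLp,
      integral_cdot_eq_inner hm hG.memLp, integral_cdot_eq_inner hg hG.memLp] at h2
    rw [integral_cdot_eq_inner (Lp.memLp _) hG.curl.memLp, integral_cdot_eq_inner (Lp.memLp _)
      hG.memLp, Lp.toLp_coeFn, Lp.toLp_coeFn, inner_add_right, mulOp_toLp (hs.bdd.rescale ε) h.2.1,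
      mulOp_toLp (hA.inv.bdd.rescale ε) ((hA.root.rescale ε).memLp h.1), ← add_assoc, h2,
      neg_add_cancel]
  filter_upwards [h1, Lp.coeFn_add (FT (mulOp (hA.inv.bdd.rescale ε) volume
    (((hA.root.rescale ε).memLp h.1).toLp _))) (FT (hg.toLp g))] with ξ h2 h3
  rw [map_add, h3, Pi.add_apply, ← add_assoc] at h2
  exact eq_neg_of_add_eq_zero_left h2

end Maxwell

/-! ### The Fourier transform as a local limit -/

section LocalLimit

open FourierTransform

/-- The Fourier transform of `g` in the normalisation of `IsFourier`. -/
def fourierNorm (g : L2R) (θ : R3) : C3 := twoPiFactor • FT g ((2 * Real.pi)⁻¹ • θ)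

lemma setIntegral_ball_pw (g : R3 → C3) (r : ℝ) (θ : R3) :
    ∫ x in Metric.ball (0 : R3) r, starRingEnd ℂ (pw θ x) • g x
      = 𝓕 (cutoff g r) ((2 * Real.pi)⁻¹ • θ) := by
  rw [fourier_eq_integral_pw, smul_inv_smul₀ (by positivity),
    ← integral_indicator Metric.isOpen_ball.measurableSet]
  congr 1
  funext x
  by_cases hx : x ∈ Metric.ball (0 : R3) r
  · simp only [cutoff, Set.indicator_of_mem hx]
  · simp only [cutoff, Set.indicator_of_notMem hx, smul_zero]

lemma ae_comp_smul {c : ℝ} (hc : 0 < c) {P : R3 → Prop} (h : ∀ᵐ ξ, P ξ) : ∀ᵐ θ : R3, P (c • θ) := by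
  have h2 : ∀ᵐ x ∂((volume : Measure R3).map (fun x => c • x)), P x := by
    rw [map_smul_volume hc]
    exact Measure.ae_smul_measure h _
  exact ((measurableEmbedding_smul hc).ae_map_iff).mp h2

lemma aestronglyMeasurable_comp_smul {E : Type*} [TopologicalSpace E] {c : ℝ} (hc : 0 < c)
    {F : R3 → E} (hF : AEStronglyMeasurable F volume) :
    AEStronglyMeasurable (fun θ => F (c • θ)) volume := by
  have h2 : AEStronglyMeasurable F ((volume : Measure R3).map (fun x => c • x)) := by
    rw [map_smul_volume hc]
    exact hF.smul_measure _
  exact h2.comp_aemeasurable (measurableEmbedding_smul hc).measurable.aemeasurable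

lemma aestronglyMeasurable_fourierNorm (g : L2R) :
    AEStronglyMeasurable (fourierNorm g) volume :=
  (aestronglyMeasurable_comp_smul (by positivity) (Lp.aestronglyMeasurable (FT g))).const_smul
    twoPiFactor

/-- The ball integrals are the Fourier transforms of cutoffs of `g`, which converge in `L²`. By
Plancherel the convergence even holds on the whole space; the constant `K` collects the
normalisation and the Jacobian of `θ ↦ (2π)⁻¹ θ`. -/
lemma isFourier_fourierNorm {g : R3 → C3} (hg : MemLp g 2) :
    IsFourier volume g (fourierNorm (hg.toLp g)) := by
  refine ⟨aestronglyMeasurable_fourierNorm _, fun ρ _ => ?_⟩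
  have hc : 0 < (2 * Real.pi)⁻¹ := by positivity
  let K : ℝ≥0∞ := ‖twoPiFactor‖ₑ ^ 2 * ENNReal.ofReal (((2 * Real.pi)⁻¹) ^ 3)⁻¹
  have hK : K ≠ ⊤ := ENNReal.mul_ne_top (by simp) ENNReal.ofReal_ne_top
  have hlim : Tendsto (fun r => ‖hg.toLp g - (memLp_cutoff hg r).toLp‖ₑ ^ 2) atTop (𝓝 0) := by
    have h1 := (tendsto_toLp_cutoff (hg.toLp g)).const_sub (hg.toLp g)
    rw [sub_self] at h1
    have h2 := ENNReal.Tendsto.pow (n := 2) h1.enorm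
    rw [enorm_zero, zero_pow two_ne_zero] at h2
    refine h2.congr fun r => ?_
    congr 3
    refine (MemLp.toLp_eq_toLp_iff _ _).mpr ?_
    filter_upwards [hg.coeFn_toLp] with x hx
    simp only [cutoff, Set.indicator, hx]
  refine tendsto_zero_of_sq ?_
  have hz : Tendsto (fun r => K * ‖hg.toLp g - (memLp_cutoff hg r).toLp‖ₑ ^ 2) atTop (𝓝 0) := by
    have h3 := ENNReal.Tendsto.const_mul hlim (Or.inr hK)
    rwa [mul_zero] at h3
  refine tendsto_of_tendsto_of_tendsto_of_le_of_le tendsto_const_nhds hz (fun _ => bot_le) fun r => ?_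
  dsimp only
  refine (pow_le_pow_left' (eLpNorm_mono_measure _ Measure.restrict_le_self) 2).trans ?_
  rw [← lintegral_enorm_sq_eq]
  have e : ∀ᵐ θ : R3, ‖fourierNorm (hg.toLp g) θ - twoPiFactor •
      ∫ x in Metric.ball (0 : R3) r, starRingEnd ℂ (pw θ x) • g x‖ₑ ^ 2
      = ‖twoPiFactor‖ₑ ^ 2 *
        ‖FT (hg.toLp g - (memLp_cutoff hg r).toLp) ((2 * Real.pi)⁻¹ • θ)‖ₑ ^ 2 := by
    have h1 := FT_toLp_ae_eq (integrable_cutoff hg r) (memLp_cutoff hg r)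
    filter_upwards [ae_comp_smul hc h1,
      ae_comp_smul hc (FT_sub_ae (hg.toLp g) (memLp_cutoff hg r).toLp)] with θ h2 h3
    rw [setIntegral_ball_pw, ← h2, h3, fourierNorm, ← smul_sub, enorm_smul, mul_pow]
  rw [lintegral_congr_ae e, lintegral_const_mul' _ _ (by simp),
    lintegral_smul hc fun ξ => ‖FT (hg.toLp g - (memLp_cutoff hg r).toLp) ξ‖ₑ ^ 2,
    lintegral_enorm_sq_eq, ← Lp.enorm_def, LinearIsometryEquiv.enorm_map, ← mul_assoc]

lemma IsFourier.ae_eq {g ghat ghat' : R3 → C3} (hg : MemLp g 2) (h : IsFourier volume g ghat)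
    (h' : IsFourier volume g ghat') : ghat =ᵐ[volume] ghat' := by
  have hball : ∀ k : ℕ, ∀ᵐ θ, θ ∈ Metric.ball (0 : R3) (k + 1) → ghat θ = ghat' θ := by
    intro k
    rw [← ae_restrict_iff' Metric.isOpen_ball.measurableSet]
    have hk : (0 : ℝ) < k + 1 := by positivity
    have hm : ∀ r, AEStronglyMeasurable (fun θ : R3 => twoPiFactor •
        ∫ x in Metric.ball (0 : R3) r, starRingEnd ℂ (pw θ x) • g x)
        (volume.restrict (Metric.ball (0 : R3) (k + 1))) := by
      intro r
      simp_rw [setIntegral_ball_pw]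
      have hc : Continuous (𝓕 (cutoff g r)) :=
        VectorFourier.fourierIntegral_continuous Real.continuous_fourierChar
          (innerSL ℝ).continuous₂ (integrable_cutoff hg r)
      exact ((hc.comp (continuous_const_smul _)).const_smul twoPiFactor).aestronglyMeasurable
    have h0 : eLpNorm (fun θ => ghat θ - ghat' θ) 2
        (volume.restrict (Metric.ball (0 : R3) (k + 1))) = 0 := by
      have hlim := (h.2 _ hk).add (h'.2 _ hk)
      rw [add_zero] at hlim
      refine le_antisymm (ge_of_tendsto' hlim fun r => ?_) bot_le
      have := eLpNorm_sub_le (h.1.restrict.sub (hm r)) (h'.1.restrict.sub (hm r)) (p := 2)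
        (by norm_num)
      refine le_trans (le_of_eq ?_) this
      congr 1
      funext θ
      simp only [Pi.sub_apply]
      abel
    rw [show (fun θ => ghat θ - ghat' θ) = ghat - ghat' from rfl,
      eLpNorm_eq_zero_iff (h.1.restrict.sub h'.1.restrict) two_ne_zero] at h0
    filter_upwards [h0] with θ hθ
    exact sub_eq_zero.mp hθ
  filter_upwards [ae_all_iff.mpr hball] with θ hθ
  obtain ⟨k, hk⟩ := exists_nat_gt ‖θ‖
  exact hθ k (by rw [mem_ball_zero_iff]; linarith)

end LocalLimit

/-! ### The leading-order term in the whole space -/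

/-- The orthogonal projection onto `ℂ ξ`. -/
def parProj (ξ : R3) : CMat := Matrix.of fun i j => (((‖ξ‖ ^ 2)⁻¹ * (ξ i * ξ j) : ℝ) : ℂ)

lemma app_parProj (ξ : R3) (v : C3) :
    app (parProj ξ) v = ((((‖ξ‖ ^ 2)⁻¹ : ℝ) : ℂ) * inner ℂ (cv ξ) v) • cv ξ := by
  ext i
  simp only [app_apply, parProj, Matrix.of_apply, PiLp.smul_apply, smul_eq_mul, inner_C3, cv_apply,
    Fin.sum_univ_three, Complex.conj_ofReal]
  push_cast
  ring

lemma par_app_parProj (ξ : R3) (v : C3) : Par ξ (app (parProj ξ) v) :=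
  ⟨_, app_parProj ξ v⟩

/-- At `ξ = 0` the convention `0⁻¹ = 0` makes the projection zero, in agreement with `Par 0 v`
meaning `v = 0`. -/
lemma Par.app_parProj {ξ : R3} {v : C3} (h : Par ξ v) : app (parProj ξ) v = v := by
  obtain ⟨s, rfl⟩ := h
  rcases eq_or_ne ξ 0 with rfl | hξ
  · rw [PeriodicMaxwell.app_parProj, cv_zero, smul_zero, smul_zero]
  · have : (‖ξ‖ : ℂ) ≠ 0 := by simpa using hξ
    rw [PeriodicMaxwell.app_parProj, inner_smul_right, inner_self_eq_norm_sq_to_K, norm_cv]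
    congr 1
    push_cast
    simp only [Complex.coe_algebraMap]
    field_simp

lemma inner_sub_app_parProj (ξ : R3) (v : C3) : inner ℂ (cv ξ) (v - app (parProj ξ) v) = 0 := by
  rcases eq_or_ne ξ 0 with rfl | hξ
  · simp
  · have : (‖ξ‖ : ℂ) ≠ 0 := by simpa using hξ
    rw [app_parProj, inner_sub_right, inner_smul_right, inner_self_eq_norm_sq_to_K, norm_cv]
    push_cast
    simp only [Complex.coe_algebraMap]
    field_simp
    rw [sub_self, mul_zero]

lemma isBddMat_parProj : IsBddMat parProj 1 := by
  refine ⟨fun i j => ?_, zero_le_one, fun ξ v => ?_⟩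
  · unfold parProj
    simp only [Matrix.of_apply]
    fun_prop
  · rw [one_mul]
    rcases eq_or_ne ξ 0 with rfl | hξ
    · simp [app_parProj]
    · have h0 : ‖ξ‖ ≠ 0 := norm_ne_zero_iff.mpr hξ
      have h1 := norm_inner_le_norm (𝕜 := ℂ) (cv ξ) v
      rw [norm_cv] at h1
      rw [app_parProj, norm_smul, norm_mul, norm_cv, Complex.norm_real, Real.norm_eq_abs,
        abs_of_nonneg (by positivity)]
      calc _ ≤ (‖ξ‖ ^ 2)⁻¹ * (‖ξ‖ * ‖v‖) * ‖ξ‖ := by gcongr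
        _ = ‖v‖ := by field_simp

/-- The closed subspace of gradient fields. -/
def gradFields : Submodule ℂ L2R :=
  LinearMap.ker (((mulOp isBddMat_parProj volume).comp (FT.toContinuousLinearEquiv : L2R →L[ℂ] L2R)
    - (FT.toContinuousLinearEquiv : L2R →L[ℂ] L2R) : L2R →L[ℂ] L2R) : L2R →ₗ[ℂ] L2R)

lemma isClosed_gradFields : IsClosed (gradFields : Set L2R) :=
  ContinuousLinearMap.isClosed_ker _

lemma mem_gradFields' {f : L2R} :
    f ∈ gradFields ↔ mulOp isBddMat_parProj volume (FT f) = FT f := by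
  rw [gradFields, LinearMap.mem_ker]
  exact sub_eq_zero

lemma mem_gradFields {f : L2R} : f ∈ gradFields ↔ ∀ᵐ ξ, Par ξ (FT f ξ) := by
  rw [mem_gradFields', Lp.ext_iff]
  constructor
  · intro h
    filter_upwards [h, coeFn_mulOp isBddMat_parProj (FT f)] with ξ h1 h2
    rw [← h1, h2]
    exact par_app_parProj ξ _
  · intro h
    filter_upwards [h, coeFn_mulOp isBddMat_parProj (FT f)] with ξ h1 h2
    rw [h2, h1.app_parProj]

/-- The longitudinal part of `FT h` is the transform of an admissible `k`. Testing with it shows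
that this part has norm zero. -/
lemma ae_inner_cv_of_orthogonal {h : L2R} (hh : ∀ k ∈ gradFields, inner ℂ k h = 0) :
    ∀ᵐ ξ : R3, inner ℂ (cv ξ) (FT h ξ) = 0 := by
  set p := mulOp isBddMat_parProj volume (FT h) with hp
  have hpm : ∀ᵐ ξ, p ξ = app (parProj ξ) (FT h ξ) := coeFn_mulOp isBddMat_parProj (FT h)
  have hk : FT.symm p ∈ gradFields := by
    rw [mem_gradFields, LinearIsometryEquiv.apply_symm_apply]
    filter_upwards [hpm] with ξ h1
    rw [h1]
    exact par_app_parProj ξ _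
  have h1 := hh _ hk
  rw [← FT.inner_map_map, LinearIsometryEquiv.apply_symm_apply] at h1
  have h2 : inner ℂ p p = inner ℂ p (FT h) := by
    rw [← sub_eq_zero, ← inner_sub_right, L2.inner_def]
    refine integral_eq_zero_of_ae ?_
    filter_upwards [hpm, Lp.coeFn_sub p (FT h)] with ξ h3 h4
    rw [h4, Pi.sub_apply, Pi.zero_apply, h3, ← neg_sub (FT h ξ), inner_neg_right,
      (par_app_parProj ξ _).inner_eq (inner_sub_app_parProj ξ _), neg_zero]
  rw [h1, inner_self_eq_zero] at h2
  filter_upwards [hpm, Lp.coeFn_zero C3 2 (volume : Measure R3)] with ξ h3 h4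
  have h5 := inner_sub_app_parProj ξ (FT h ξ)
  rwa [← h3, h2, h4, Pi.zero_apply, sub_zero] at h5

section LeadingTerm

variable {A At : R3 → RMat} {C C' α β a b ε : ℝ} {Ψ : R3 → Fin 3 → R3 → ℂ}
  {P : R3 → Fin 3 → R3 → C3} {N R : Fin 3 → R3 → C3}

lemma add_dual_eq (hε : 0 < ε) (τ : R3) (n : Fin 3 → ℤ) :
    (2 * Real.pi) • τ + dual n = ε • ((2 * Real.pi) • fib ε τ n) := by
  rw [fib, smul_comm ε, smul_inv_smul₀ hε.ne', smul_add]
  congr 1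

lemma Par.smul_left {k : R3} {v : C3} {r : ℝ} (hr : r ≠ 0) (h : Par k v) : Par (r • k) v := by
  obtain ⟨s, rfl⟩ := h
  refine ⟨s * (r : ℂ)⁻¹, ?_⟩
  have : (r : ℂ) ≠ 0 := by exact_mod_cast hr
  rw [cv_smul, smul_smul, inv_mul_cancel_right₀ this]

lemma inner_cv_smul_left {k : R3} {v : C3} (r : ℝ) (h : inner ℂ (cv k) v = 0) :
    inner ℂ (cv (r • k)) v = 0 := by
  rw [cv_smul, inner_smul_left, h, mul_zero]

/-- `W` is the leading-order field with Fourier transform `(θ × Ã^hom θ × + Â^hom)⁻¹ ĝ` up to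
signs, and `X` is its correction by a gradient, making `A⁻¹ X` divergence-free. -/
structure IsLeading (hA : IsRootCoeff A C C' α β) (At : R3 → RMat) (Ψ : R3 → Fin 3 → R3 → ℂ)
    (P : R3 → Fin 3 → R3 → C3) (R : Fin 3 → R3 → C3) (ε : ℝ) (g X W : L2R) : Prop where
  four : ∀ᵐ ξ : R3, FT W ξ = app (homMat A At Ψ P R ε ((2 * Real.pi) • ξ))⁻¹ (FT g ξ)
  sub_mem : X - W ∈ gradFields
  perp : ∀ k ∈ gradFields, inner ℂ k (mulOp (hA.inv.bdd.rescale ε) volume X) = 0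

/-- `W` is a bounded measurable Fourier multiplier applied to `g`; the gradient correction comes
from Lax–Milgram on `gradFields` with the form of `A⁻¹(·/ε)`. -/
lemma exists_isLeading (hgrad : ∀ φ : R3 → ℂ, PerTest φ → ∀ j, ∫ y in Q, pd j φ y = 0)
    (hA : IsRootCoeff A C C' α β) (hs : IsCoeff At a b) (h : IsCellFamily volume A Ψ P)
    (h' : IsMagneticCell volume A At N R) (ε : ℝ) (g : L2R) :
    ∃ X W, IsLeading hA At Ψ P R ε g X W := by
  have hM := isBddMat_homMat_inv hgrad hA hs h h' ε
  let W : L2R := FT.symm (mulOp hM volume (FT g))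
  set m := mulOp (hA.inv.bdd.rescale ε) volume with hm
  obtain ⟨x, hx, hxk⟩ := exists_mem_forall_inner_eq_zero m hA.inv.pos
    (mulOp_coercive (hA.inv.bdd.rescale ε) fun y v => hA.inv.lower _ v) gradFields
    isClosed_gradFields (-(m W))
  refine ⟨x + W, W, ?_, by rwa [add_sub_cancel_right], fun k hk => ?_⟩
  · simp only [W, LinearIsometryEquiv.apply_symm_apply]
    exact coeFn_mulOp hM (FT g)
  · have := hxk k hk
    rwa [sub_neg_eq_add, ← map_add] at this

/-- The fibres of the solution and of its approximation. -/
lemma ae_isFibre (hgrad : ∀ φ : R3 → ℂ, PerTest φ → ∀ j, ∫ y in Q, pd j φ y = 0)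
    (hA : IsRootCoeff A C C' α β) (hs : IsCoeff At a b) (h : IsCellFamily volume A Ψ P)
    (h' : IsMagneticCell volume A At N R) (hε : 0 < ε) {u B g X W : L2R}
    (hcurl : ∀ᵐ ξ : R3, FT B ξ = crI ((2 * Real.pi) • ξ) (FT u ξ))
    (heq : ∀ᵐ ξ : R3, crI ((2 * Real.pi) • ξ) (FT (mulOp (hs.bdd.rescale ε) volume B) ξ)
      + FT (mulOp (hA.inv.bdd.rescale ε) volume u) ξ = -FT g ξ)
    (hdiv : ∀ᵐ ξ : R3, inner ℂ (cv ξ) (FT g ξ) = 0)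
    (hX : IsLeading hA At Ψ P R ε g X W) :
    ∀ᵐ τ, ∃ u' B' g' X' W' : L2Q, IsFibre (mulOp hA.inv.bdd volQ) (mulOp hs.bdd volQ) ε
      ((2 * Real.pi) • τ) u' B' g' X' W' ∧ ‖u' + X'‖ₑ ^ 2 = fibSq ε (FT (u + X)) τ ∧
      ‖g'‖ₑ ^ 2 = fibSq ε (FT g) τ := by
  have hpar := mem_gradFields.mp hX.sub_mem
  have hperp := ae_inner_cv_of_orthogonal hX.perp
  filter_upwards [ae_fib hε hcurl, ae_fib hε heq, ae_fib hε hdiv, ae_fib hε hX.four,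
    ae_fib hε hpar, ae_fib hε hperp, ae_fib hε (FT_sub_ae X W),
    ae_fib hε (Lp.coeFn_add (FT u) (FT X)),
    ae_exists_fibre_mulOp hA.inv.bdd hA.inv.per_cm hε u,
    ae_exists_fibre_mulOp hA.inv.bdd hA.inv.per_cm hε X,
    ae_exists_fibre_mulOp hs.bdd hs.per_cm hε B,
    ae_fibSq_ne_top hε (FT g), ae_fibSq_ne_top hε (FT W)]
    with τ hcurl heq hdiv hW hpar hperp hXW hadd hu hX hB hg hW'
  obtain ⟨u', hu', hmu⟩ := hu
  obtain ⟨X', hX', hmX⟩ := hX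
  obtain ⟨B', hB', hsB⟩ := hB
  obtain ⟨g', hg'⟩ := exists_fibre hg
  obtain ⟨W', hW'⟩ := exists_fibre hW'
  -- The true frequency is `2πξ = ε⁻¹ (κ + 2πn)`. Multiplying the curl by `ε` moves this scale into
  -- the weight `ε⁻²` of the fibre equation.
  refine ⟨u', (ε : ℂ) • B', g', X', W', ⟨fun n => ?_, fun n => ?_, fun n => ?_, fun n => ?_,
    fun n => ?_, fun n => ?_⟩, ?_, enorm_sq_sub_eq hg'⟩
  · rw [map_smul, hB', hu', hcurl, add_dual_eq hε, crI_smul_left ε]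
  · rw [map_smul, map_smul, hsB, hmu, hg', ← heq, add_dual_eq hε, crI_smul_left ε, crI_smul, smul_smul,
      smul_smul]
    congr 1
    have : (ε : ℂ) ≠ 0 := by exact_mod_cast hε.ne'
    rw [show ((ε⁻¹ ^ 2 : ℝ) : ℂ) * ε * ε = 1 by push_cast; field_simp, one_smul]
  · rw [hg', add_dual_eq hε]
    exact inner_cv_smul_left _ (inner_cv_smul_left _ (hdiv n))
  · rw [map_sub, hX', hW', ← hXW, add_dual_eq hε]
    exact ((hpar n).smul_left (by positivity)).smul_left hε.ne'
  · rw [hmX, add_dual_eq hε]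
    exact inner_cv_smul_left _ (inner_cv_smul_left _ (hperp n))
  · rw [hW', hg', hW]
    exact exists_isMode hgrad hA hs h h' hε (add_dual_eq hε τ n) _
  · refine enorm_sq_sub_eq fun n => ?_
    rw [map_add, hu', hX', map_add, hadd]
    rfl

/-- Plancherel turns `fibre_estimate` into an estimate on the space. The constant precedes the
choice of cell solutions, since it only involves coercivity constants. -/
theorem leading_estimate (hgrad : ∀ φ : R3 → ℂ, PerTest φ → ∀ j, ∫ y in Q, pd j φ y = 0)
    (hA : IsRootCoeff A C C' α β) (hs : IsCoeff At a b) : ∃ K : ℝ, 0 < K ∧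
    ∀ Ψ P, IsCellFamily volume A Ψ P → ∀ N R, IsMagneticCell volume A At N R →
    ∀ ε : ℝ, 0 < ε → ∀ u B g X W : L2R,
    (∀ᵐ ξ : R3, FT B ξ = crI ((2 * Real.pi) • ξ) (FT u ξ)) →
    (∀ᵐ ξ : R3, crI ((2 * Real.pi) • ξ) (FT (mulOp (hs.bdd.rescale ε) volume B) ξ)
      + FT (mulOp (hA.inv.bdd.rescale ε) volume u) ξ = -FT g ξ) →
    (∀ᵐ ξ : R3, inner ℂ (cv ξ) (FT g ξ) = 0) → IsLeading hA At Ψ P R ε g X W →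
    ‖u + X‖ₑ ≤ ENNReal.ofReal (K * ε) * ‖g‖ₑ := by
  obtain ⟨K, hK, hest⟩ := fibre_estimate hA.inv.pos hA.inv.bdd.nonneg hs.pos hs.bdd.nonneg
  refine ⟨K, hK, fun Ψ P h N R h' ε hε u B g X W h1 h2 h3 h4 => ?_⟩
  rw [← LinearIsometryEquiv.enorm_map FT (u + X), ← LinearIsometryEquiv.enorm_map FT g, Lp.enorm_def,
    Lp.enorm_def]
  refine eLpNorm_le_of_fibre hε (Lp.aestronglyMeasurable _) (Lp.aestronglyMeasurable _)
    ENNReal.ofReal_ne_top ?_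
  filter_upwards [ae_isFibre hgrad hA hs h h' hε h1 h2 h3 h4] with τ hτ hκ
  obtain ⟨u', B', g', X', W', hf, e1, e2⟩ := hτ
  rw [← e1, ← e2, ← mul_pow]
  have h5 := hest _ _ hA.inv.isCoerc hs.isCoerc ε hε _ hκ u' B' g' X' W' hf
  refine pow_le_pow_left' ?_ 2
  rw [← ofReal_norm, ← ofReal_norm, ← ENNReal.ofReal_mul (by positivity)]
  exact ENNReal.ofReal_le_ofReal h5

end LeadingTerm

/-! ### Oscillating fields tested against smooth fields -/

section FieldIntegral

variable {ε : ℝ}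

lemma cdot_smul_left (c : ℂ) (a b : C3) : cdot (c • a) b = c * cdot a b := by
  rw [cdot_eq_inner, cdot_eq_inner, inner_smul_right]

lemma cdot_smul_right (c : ℂ) (a b : C3) : cdot a (c • b) = starRingEnd ℂ c * cdot a b := by
  rw [cdot_eq_inner, cdot_eq_inner, inner_smul_left]

lemma locallyIntegrable_of_ball {G : R3 → C3}
    (h : ∀ r : ℝ, IntegrableOn G (Metric.ball (0 : R3) r)) : LocallyIntegrable G := fun x =>
  ⟨_, Metric.isOpen_ball.mem_nhds (show x ∈ Metric.ball (0 : R3) (‖x‖ + 1) by simp), h _⟩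

lemma Periodic.integrableOn_ball {G : R3 → C3} (hper : Periodic G) (hG : Integrable G volQ) (r : ℝ) :
    IntegrableOn G (Metric.ball (0 : R3) r) := by
  -- Applied to a nonzero constant field on the ball, this says that the cells outside `S` miss the
  -- ball.
  obtain ⟨S, hS⟩ := exists_covers zero_lt_one r
  have h1 := hS ((Metric.ball (0 : R3) r).indicator fun _ => EuclideanSpace.single 0 (1 : ℂ))
    (cutoff_eq_zero _ r)
  have hk : ∀ k, IntegrableOn G ((fun x => x + latt k) '' Q) := by
    intro k
    have hm := measurePreserving_add_right (volume : Measure R3) (latt k)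
    rw [hm.integrableOn_image (MeasurableEquiv.addRight (latt k)).measurableEmbedding]
    refine hG.congr (Eventually.of_forall fun y => ?_)
    exact (hper k y).symm
  refine (integrableOn_finset_iUnion.mpr fun k (_ : k ∈ S) => hk k).mono_set fun x hx => ?_
  simp only [Set.mem_iUnion]
  let n : Fin 3 → ℤ := fun i => ⌊x i⌋
  have hxn : x = (x - latt n) + latt n := (sub_add_cancel _ _).symm
  have hQ : x - latt n ∈ Q := fun i => by
    simp only [PiLp.sub_apply, latt_apply, n]
    exact ⟨Int.fract_nonneg (x i), Int.fract_lt_one (x i)⟩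
  refine ⟨n, ?_, x - latt n, hQ, hxn.symm⟩
  by_contra hn
  have h2 := h1 n hn _ hQ
  rw [← hxn, one_smul, Set.indicator_of_mem hx] at h2
  simpa using congrArg (fun v : C3 => v 0) h2

lemma Periodic.locallyIntegrable {G : R3 → C3} (hper : Periodic G) (hG : Integrable G volQ)
    (hε : 0 < ε) (c : ℂ) (θ : R3) :
    LocallyIntegrable fun x => (c * pw θ x) • G (ε⁻¹ • x) := by
  refine locallyIntegrable_of_ball fun r => ?_
  have h1 : IntegrableOn (fun x => G (ε⁻¹ • x)) (Metric.ball (0 : R3) r) := by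
    have h2 := (integrable_indicator_iff Metric.isOpen_ball.measurableSet).mpr
      (hper.integrableOn_ball hG (r / ε))
    have h3 := h2.comp_smul (R := ε⁻¹) (inv_ne_zero hε.ne')
    rw [← integrable_indicator_iff Metric.isOpen_ball.measurableSet]
    refine h3.congr (Eventually.of_forall fun x => ?_)
    have : ε⁻¹ • x ∈ Metric.ball (0 : R3) (r / ε) ↔ x ∈ Metric.ball (0 : R3) r := by
      rw [mem_ball_zero_iff, mem_ball_zero_iff, norm_smul, Real.norm_eq_abs,
        abs_of_pos (inv_pos.mpr hε), lt_div_iff₀ hε, mul_comm, ← mul_assoc,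
        mul_inv_cancel₀ hε.ne', one_mul]
    dsimp only
    by_cases hx : x ∈ Metric.ball (0 : R3) r
    · rw [Set.indicator_of_mem hx, Set.indicator_of_mem (this.mpr hx)]
    · rw [Set.indicator_of_notMem hx, Set.indicator_of_notMem (mt this.mp hx)]
  refine h1.bdd_smul (φ := fun x => c * pw θ x) ‖c‖
    ((continuous_const.mul (continuous_pw θ)).aestronglyMeasurable)
    (Eventually.of_forall fun x => ?_)
  rw [norm_mul, norm_pw, mul_one]

lemma integrable_cdot_test {G φ : R3 → C3} (hG : LocallyIntegrable G) (hφ : Test φ) :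
    Integrable fun x => cdot (G x) (φ x) := by
  refine integrable_finsetSum _ fun i _ => ?_
  have h1 : LocallyIntegrable fun x => G x i := fun x => by
    obtain ⟨s, hs, hi⟩ := hG x
    exact ⟨s, hs, (EuclideanSpace.proj i : C3 →L[ℂ] ℂ).integrable_comp hi⟩
  have h2 := (hφ.apply i).conj
  refine (h1.integrable_smul_left_of_hasCompactSupport h2.1.continuous h2.2).congr
    (Eventually.of_forall fun x => ?_)
  simp [mul_comm]

lemma Test.exists_covers {φ : R3 → C3} (hφ : Test φ) (hε : 0 < ε) :
    ∃ r : ℝ, (∀ x, r ≤ ‖x‖ → φ x = 0) ∧ ∃ S, Covers ε S φ := by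
  obtain ⟨r, hr⟩ := hφ.2.isCompact.isBounded.subset_ball (0 : R3)
  have h0 : ∀ x, r ≤ ‖x‖ → φ x = 0 := fun x hx => by
    by_contra hn
    have := hr (subset_tsupport _ hn)
    rw [mem_ball_zero_iff] at this
    linarith
  obtain ⟨S, hS⟩ := PeriodicMaxwell.exists_covers hε r
  exact ⟨r, h0, S, hS φ h0⟩

lemma cdot_sum_right {ι : Type*} (S : Finset ι) (a : C3) (v : ι → C3) :
    cdot a (∑ k ∈ S, v k) = ∑ k ∈ S, cdot a (v k) := by
  simp only [cdot_eq_inner, sum_inner]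

/-- Pairing with an oscillating field is pairing with the Zak transform in the unit cell. -/
lemma integral_cdot_zak (hε : 0 < ε) {G φ : R3 → C3} (hper : Periodic G) (hG : MemLp G 2 volQ)
    (hφ : Test φ) {S : Finset (Fin 3 → ℤ)} (hS : Covers ε S φ) {θ τ : R3}
    (hτ : ε • θ = (2 * Real.pi) • τ) :
    ∫ x, cdot (pw θ x • G (ε⁻¹ • x)) (φ x) = ∫ y in Q, cdot (G y) (zak ε S τ φ y) := by
  have hi : Integrable fun x => cdot (pw θ x • G (ε⁻¹ • x)) (φ x) := by
    have h1 := hper.locallyIntegrable (hG.integrable (by norm_num)) hε 1 θ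
    simp only [one_mul] at h1
    exact integrable_cdot_test h1 hφ
  let H : R3 → ℂ := fun y => cdot (pw θ (ε • y) • G y) (φ (ε • y))
  have hHe : ∀ y, H y = (fun x => cdot (pw θ x • G (ε⁻¹ • x)) (φ x)) (ε • y) := fun y => by
    simp only [H, inv_smul_smul₀ hε.ne']
  have hH : Integrable H := by
    rw [funext hHe]
    exact hi.comp_smul hε.ne'
  have hterm : ∀ (k : Fin 3 → ℤ) (y : R3), H (y + latt k) = cdot (G y)
      (starRingEnd ℂ (pw ((2 * Real.pi) • τ) (y + latt k)) • φ (ε • (y + latt k))) := by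
    intro k y
    simp only [H]
    rw [cdot_smul_left, cdot_smul_right, Complex.conj_conj, hper, ← hτ]
    congr 1
    simp only [pw, inner_smul_left, inner_smul_right]
    simp
  have hsum : HasSum (fun k : Fin 3 → ℤ => ∫ y in Q, H (y + latt k)) (∫ y, H y) := by
    have e := periodicMeasure_volume.eq_sum
    have h1 := hH
    rw [e] at h1
    have h2 := hasSum_integral_measure h1
    rw [← e] at h2
    refine h2.congr_fun ?_
    intro k
    exact ((MeasurableEquiv.addRight (latt k)).measurableEmbedding.integral_map H).symm
  have h0 : ∀ k ∉ S, ∫ y in Q, H (y + latt k) = 0 := by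
    intro k hk
    refine setIntegral_eq_zero_of_forall_eq_zero fun y hy => ?_
    simp only [H]
    rw [hS k hk y hy, cdot_eq_inner, inner_zero_left]
  have hfin := (hasSum_sum_of_ne_finset_zero h0).unique hsum
  have hR : ∫ y in Q, cdot (G y) (zak ε S τ φ y)
      = ((ε ^ 3 : ℝ) : ℂ) * ∑ k ∈ S, ∫ y in Q, H (y + latt k) := by
    simp only [zak, cdot_sum_right]
    rw [integral_finsetSum, Finset.mul_sum]
    · refine Finset.sum_congr rfl fun k _ => ?_
      rw [← integral_const_mul]
      congr 1
      funext y
      rw [cdot_smul_right, hterm, Complex.conj_ofReal]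
    · exact fun k _ => MemLp.integrable_cdot hG (memLp_zak_term hε hφ.memLp τ k)
  rw [hR, hfin, funext hHe, Measure.integral_comp_smul volume _ ε]
  simp only [finrank_euclideanSpace, Fintype.card_fin]
  rw [abs_of_pos (by positivity), Complex.real_smul, ← mul_assoc, ← Complex.ofReal_mul,
    mul_inv_cancel₀ (by positivity), Complex.ofReal_one, one_mul]

end FieldIntegral

/-! ### The leading-order term as a superposition of oscillating fields -/

section Superposition

open FourierTransform

variable {A At : R3 → RMat} {C C' α β a b ε : ℝ} {Ψ : R3 → Fin 3 → R3 → ℂ}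
  {P : R3 → Fin 3 → R3 → C3} {N R : Fin 3 → R3 → C3}

/-- `⟨m q, Y⟩ = ⟨q, m Y⟩` vanishes because `q` is a gradient and, with `h0`, `m Y` is
divergence-free in all modes. The divergence-free field `z - m q` then does not see the gradient
part of `Y`, and only the mean `w` survives. -/
lemma IsElCorr.inner_of_decomp {m : L2Q →L[ℂ] L2Q}
    (hsymm : ∀ f g, inner ℂ (m f) g = inner ℂ f (m g)) {κ : R3} {w : C3} {Y z q : L2Q}
    (hY : IsElCorr m κ w Y) (hq : ∀ n, Par (κ + dual n) (cf n q))
    (hz : ∀ n, inner ℂ (cv (κ + dual n)) (cf n (z - m q)) = 0)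
    (h0 : inner ℂ (cv κ) (cf 0 (m Y)) = 0) :
    inner ℂ z Y = inner ℂ (cf 0 (z - m q)) w := by
  have e1 : inner ℂ (m q) Y = 0 := by
    rw [hsymm]
    refine inner_eq_zero_of_cf fun n => (hq n).inner_eq ?_
    rcases eq_or_ne n 0 with rfl | hn
    · rwa [dual_zero, add_zero]
    · exact hY.perp n hn
  have e2 : inner ℂ (z - m q) (Y - ev 0 w) = 0 := by
    refine inner_eq_zero_of_cf fun n => ?_
    rw [map_sub _ Y, cf_ev]
    rcases eq_or_ne n 0 with rfl | hn
    · rw [if_pos rfl, hY.mean, sub_self, inner_zero_right]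
    · rw [if_neg hn, sub_zero]
      exact (hY.par n hn).inner_eq' (hz n)
  rw [inner_sub_right, inner_ev_right, sub_eq_zero] at e2
  rw [← e2, inner_sub_left, e1, sub_zero]

lemma periodic_corr (h : IsCellFamily volume A Ψ P) (κ : R3) : Periodic (corr Ψ P κ) := by
  intro n x
  ext i j
  simp only [corr, Matrix.of_apply, gradK, (h κ j).1 n x, (h κ j).2.1 n x]

/-- The cell profile of the leading-order term. -/
def cellField (A : R3 → RMat) (Ψ : R3 → Fin 3 → R3 → ℂ) (P : R3 → Fin 3 → R3 → C3) (κ : R3)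
    (w : C3) (y : R3) : C3 :=
  app (cm (msqrt (A y))⁻¹) (app (corr Ψ P κ y) w)

lemma periodic_cellField (hA : IsRootCoeff A C C' α β) (h : IsCellFamily volume A Ψ P) (κ : R3)
    (w : C3) : Periodic (cellField A Ψ P κ w) := fun n x => by
  rw [cellField, cellField, hA.per, periodic_corr h κ n x]

lemma memLp_cellField (hA : IsRootCoeff A C C' α β) (h : IsCellFamily volume A Ψ P) (κ : R3)
    (w : C3) : MemLp (cellField A Ψ P κ w) 2 volQ :=
  hA.root_inv.memLp (memLp_app_corr h κ w)

lemma homIntegrand_eq (hgrad : ∀ φ : R3 → ℂ, PerTest φ → ∀ j, ∫ y in Q, pd j φ y = 0)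
    (hA : IsRootCoeff A C C' α β) (hs : IsCoeff At a b) (h : IsCellFamily volume A Ψ P)
    (h' : IsMagneticCell volume A At N R) (ε : ℝ) (ghat : R3 → C3) (θ x : R3) :
    homIntegrand volume A At Ψ P R ε ghat θ x = ((twoPiFactor : ℂ) * pw θ x) •
      cellField A Ψ P (ε • θ) (app (homMat A At Ψ P R ε θ)⁻¹ (ghat θ)) (ε⁻¹ • x) := by
  rw [homIntegrand, mul_assoc _ (AhatHom volume A Ψ P (ε • θ))⁻¹,
    inv_mul_inv_symb ε θ (isUnit_det_symb hgrad hA hs h h' ε θ).1, mul_assoc, app_mul, app_mul]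
  rfl

lemma cdot_app_root_inv (A : R3 → RMat) (y : R3) (v w : C3) :
    cdot (app (cm (msqrt (A y))⁻¹) v) w = cdot v (app (cm (msqrt (A y))⁻¹) w) := by
  rw [cdot_eq_inner, cdot_eq_inner, inner_app_symm (msqrt_inv_isSymm _)]

lemma integral_cdot_cellField (hA : IsRootCoeff A C C' α β) (h : IsCellFamily volume A Ψ P)
    (hε : 0 < ε) {φ : R3 → C3}
    (hφ : Test φ) {S : Finset (Fin 3 → ℤ)} (hS : Covers ε S φ) {θ τ : R3}
    (hτ : ε • θ = (2 * Real.pi) • τ) (w : C3) :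
    ∫ x, cdot (pw θ x • cellField A Ψ P (ε • θ) w (ε⁻¹ • x)) (φ x)
      = inner ℂ ((memLp_zak hε ((hA.root_inv.rescale ε).memLp hφ.memLp) S τ).toLp)
        (elCorr h (ε • θ) w) := by
  rw [integral_cdot_zak hε (periodic_cellField hA h _ w) (memLp_cellField hA h _ w) hφ hS hτ, elCorr,
    ← integral_cdot_eq_inner]
  refine integral_congr_ae (Eventually.of_forall fun y => ?_)
  dsimp only
  rw [cellField, cdot_app_root_inv, app_zak (M := fun y => cm (msqrt (A y))⁻¹)
    (fun n x => congrArg (fun B => cm (msqrt B)⁻¹) (hA.per n x)) hε]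

/-- In the homogenised equation the curl term is orthogonal to `θ`, so transversality of `γ` passes
to `Â w`. This supplies the missing zeroth-mode condition `h0` of `IsElCorr.inner_of_decomp`. -/
lemma inner_cv_elCorr_homMat (hgrad : ∀ φ : R3 → ℂ, PerTest φ → ∀ j, ∫ y in Q, pd j φ y = 0)
    (hA : IsRootCoeff A C C' α β) (hs : IsCoeff At a b) (h : IsCellFamily volume A Ψ P)
    (h' : IsMagneticCell volume A At N R) (ε : ℝ) {θ : R3} {γ : C3}
    (hγ : inner ℂ (cv θ) γ = 0) :
    inner ℂ (cv (ε • θ)) (cf 0 (mulOp hA.inv.bdd volQ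
      (elCorr h (ε • θ) (app (homMat A At Ψ P R ε θ)⁻¹ γ)))) = 0 := by
  refine inner_cv_smul_left _ ?_
  rw [← app_AhatHom hA.inv h]
  have e1 : app (homMat A At Ψ P R ε θ) (app (homMat A At Ψ P R ε θ)⁻¹ γ) = γ := app_mul_inv
    (isUnit_det_of_lower hA.inv.pos (homMat_lower hgrad hA hs h h' ε θ)) _
  rw [app_homMat] at e1
  rwa [← e1, inner_add_right, inner_cv_crI, zero_add] at hγ

/-- The global splitting `f = M q + (divergence-free)` induces the corresponding splitting of the
Zak transform in almost every fibre, so one `q` serves all quasimomenta. -/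
lemma ae_zak_decomp {M : R3 → CMat} {c : ℝ} (hM : IsBddMat M c) (hper : Periodic M) (hε : 0 < ε)
    {f : R3 → C3} (hf : MemLp f 2 volume) {r : ℝ} (hr : ∀ x, r ≤ ‖x‖ → f x = 0) {S : Finset (Fin 3 → ℤ)}
    (hS : Covers ε S f) {q : L2R} (hq : q ∈ gradFields)
    (hq' : ∀ k ∈ gradFields, inner ℂ k (hf.toLp - mulOp (hM.rescale ε) volume q) = 0) :
    ∀ᵐ τ : R3, ∃ q' : L2Q, (∀ n, Par ((2 * Real.pi) • τ + dual n) (cf n q')) ∧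
      (∀ n, inner ℂ (cv ((2 * Real.pi) • τ + dual n))
        (cf n ((memLp_zak hε hf S τ).toLp - mulOp hM volQ q')) = 0) ∧
      cf 0 ((memLp_zak hε hf S τ).toLp - mulOp hM volQ q')
        = FT (hf.toLp - mulOp (hM.rescale ε) volume q) (fib ε τ 0) := by
  have hfi := integrable_of_memLp_of_eq_zero hf hr
  filter_upwards [ae_fib hε (FT_toLp_ae_eq hfi hf), ae_fib hε (mem_gradFields.mp hq),
    ae_fib hε (ae_inner_cv_of_orthogonal hq'),
    ae_fib hε (FT_sub_ae hf.toLp (mulOp (hM.rescale ε) volume q)),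
    ae_exists_fibre_mulOp hM hper hε q] with τ h1 h2 h3 h4 h5
  obtain ⟨q', h5, h6⟩ := h5
  have hz : ∀ n, cf n ((memLp_zak hε hf S τ).toLp - mulOp hM volQ q')
      = FT (hf.toLp - mulOp (hM.rescale ε) volume q) (fib ε τ n) := fun n => by
    rw [map_sub, cf_toLp, fc_zak hε hf hfi hS, h6, h4, h1]
  refine ⟨q', fun n => ?_, fun n => ?_, hz 0⟩
  · rw [h5, add_dual_eq hε]
    exact ((h2 n).smul_left (by positivity)).smul_left hε.ne'
  · rw [hz, add_dual_eq hε]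
    exact inner_cv_smul_left _ (inner_cv_smul_left _ (h3 n))

/-- The pairing of the leading-order integrand with a test field. -/
lemma ae_integral_homIntegrand (hgrad : ∀ φ : R3 → ℂ, PerTest φ → ∀ j, ∫ y in Q, pd j φ y = 0)
    (hA : IsRootCoeff A C C' α β) (hs : IsCoeff At a b) (h : IsCellFamily volume A Ψ P)
    (h' : IsMagneticCell volume A At N R) (hε : 0 < ε) {g W q : L2R} {ghat : R3 → C3}
    (hghat : ghat =ᵐ[volume] fourierNorm g)
    (hW : ∀ᵐ ξ : R3, FT W ξ = app (homMat A At Ψ P R ε ((2 * Real.pi) • ξ))⁻¹ (FT g ξ))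
    (hdiv : ∀ᵐ ξ : R3, inner ℂ (cv ξ) (FT g ξ) = 0) {φ : R3 → C3} (hφ : Test φ)
    (hq : q ∈ gradFields) (hq' : ∀ k ∈ gradFields,
      inner ℂ k (((hA.root_inv.rescale ε).memLp hφ.memLp).toLp
        - mulOp (hA.inv.bdd.rescale ε) volume q) = 0) :
    ∀ᵐ θ : R3, ∫ x, cdot (homIntegrand volume A At Ψ P R ε ghat θ x) (φ x)
      = ((twoPiFactor ^ 2 : ℝ) : ℂ) *
        inner ℂ (FT (((hA.root_inv.rescale ε).memLp hφ.memLp).toLp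
        - mulOp (hA.inv.bdd.rescale ε) volume q) ((2 * Real.pi)⁻¹ • θ))
          (FT W ((2 * Real.pi)⁻¹ • θ)) := by
  obtain ⟨r, hr, S, hS⟩ := hφ.exists_covers hε
  have hf := (hA.root_inv.rescale ε).memLp hφ.memLp
  have hr' : ∀ x, r ≤ ‖x‖ → app (cm (msqrt (A (ε⁻¹ • x)))⁻¹) (φ x) = 0 := fun x hx => by
    rw [hr x hx]
    simpa using app_smul (cm (msqrt (A (ε⁻¹ • x)))⁻¹) 0 0
  have hS' : Covers ε S fun x => app (cm (msqrt (A (ε⁻¹ • x)))⁻¹) (φ x) := fun k hk y hy => by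
    dsimp only
    rw [hS k hk y hy]
    simpa using app_smul (cm (msqrt (A (ε⁻¹ • (ε • (y + latt k)))))⁻¹) 0 0
  have hp : 0 < (2 * Real.pi)⁻¹ := by positivity
  have hdec := ae_zak_decomp hA.inv.bdd hA.inv.per_cm hε hf hr' hS' hq hq'
  filter_upwards [ae_comp_smul (mul_pos hp hε) hdec, ae_comp_smul hp hW, ae_comp_smul hp hdiv, hghat]
    with θ hτ hWθ hdivθ hgθ
  obtain ⟨q', h1, h2, h3⟩ := hτ
  -- With this choice `ε θ = 2π τ` and `θ = 2π · fib ε τ 0`. Each `θ` is thus the zeroth mode of its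
  -- own fibre, with no reduction to a fundamental cell.
  set τ : R3 := ((2 * Real.pi)⁻¹ * ε) • θ with hτdef
  set ξ : R3 := (2 * Real.pi)⁻¹ • θ with hξ
  have hθξ : (2 * Real.pi) • ξ = θ := smul_inv_smul₀ (by positivity) θ
  have hτθ : ε • θ = (2 * Real.pi) • τ := by
    rw [hτdef, mul_smul (2 * Real.pi)⁻¹, smul_inv_smul₀ (by positivity)]
  have hfib0 : fib ε τ 0 = ξ := by
    rw [fib, hτdef, show latt 0 = 0 from by ext i; simp [latt_apply], add_zero, mul_comm, mul_smul ε,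
      inv_smul_smul₀ hε.ne']
  rw [hθξ] at hWθ
  set w : C3 := app (homMat A At Ψ P R ε θ)⁻¹ (FT g ξ) with hw
  have hgw : app (homMat A At Ψ P R ε θ)⁻¹ (ghat θ) = (twoPiFactor : ℂ) • w := by
    rw [hgθ, fourierNorm, ← Complex.coe_smul, app_smul]
  have hY := isElCorr_elCorr hgrad hA.inv h (ε • θ) w
  have hperp0 := inner_cv_elCorr_homMat hgrad hA hs h h' ε
    (show inner ℂ (cv θ) (FT g ξ) = 0 by
      rw [← hθξ]
      exact inner_cv_smul_left _ hdivθ)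
  rw [← hτθ] at h1 h2
  have key := hY.inner_of_decomp (fun f g => hA.inv.inner_mulOp f g) h1 h2 hperp0
  have e : ∀ x, cdot (homIntegrand volume A At Ψ P R ε ghat θ x) (φ x)
      = ((twoPiFactor ^ 2 : ℝ) : ℂ) *
        cdot (pw θ x • cellField A Ψ P (ε • θ) w (ε⁻¹ • x)) (φ x) := fun x => by
    rw [homIntegrand_eq hgrad hA hs h h', hgw, cellField, app_smul, app_smul, ← cellField,
      cdot_smul_left, cdot_smul_left, cdot_smul_left]
    push_cast
    ring
  simp_rw [e]
  rw [integral_const_mul, integral_cdot_cellField hA h hε hφ hS hτθ, key, h3, hfib0, hWθ]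

lemma twoPiFactor_sq : twoPiFactor ^ 2 * (2 * Real.pi) ^ 3 = 1 := by
  rw [twoPiFactor, ← Real.rpow_natCast, ← Real.rpow_mul (by positivity), ← Real.rpow_natCast,
    ← Real.rpow_add (by positivity)]
  norm_num

/-- The pairing with a test field is reduced, on the space and in almost every fibre, to the pairing
of the divergence-free part of `A^{-1/2} φ` with `W`; Plancherel identifies the two. Absolute
convergence holds because the integrand is a product of two `L²` functions of `θ`. -/
theorem isFieldIntegral (hgrad : ∀ φ : R3 → ℂ, PerTest φ → ∀ j, ∫ y in Q, pd j φ y = 0)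
    (hA : IsRootCoeff A C C' α β) (hs : IsCoeff At a b) (h : IsCellFamily volume A Ψ P)
    (h' : IsMagneticCell volume A At N R) (hε : 0 < ε) {g X W : L2R} {ghat : R3 → C3}
    (hghat : ghat =ᵐ[volume] fourierNorm g) (hX : IsLeading hA At Ψ P R ε g X W)
    (hdiv : ∀ᵐ ξ : R3, inner ℂ (cv ξ) (FT g ξ) = 0) :
    IsFieldIntegral volume (homIntegrand volume A At Ψ P R ε ghat)
      fun x => app (cm (msqrt (A (ε⁻¹ • x)))⁻¹) (X x) := by
  have hU := (hA.root_inv.rescale ε).memLp (Lp.memLp X)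
  refine ⟨fun θ => ?_, hU.locallyIntegrable (by norm_num), fun φ hφ => ?_⟩
  · simp_rw [funext (homIntegrand_eq hgrad hA hs h h' ε ghat θ)]
    exact (periodic_cellField hA h _ _).locallyIntegrable
      ((memLp_cellField hA h _ _).integrable (by norm_num)) hε _ _
  have hf := (hA.root_inv.rescale ε).memLp hφ.memLp
  set m := mulOp (hA.inv.bdd.rescale ε) volume with hm
  obtain ⟨q, hq, hqk⟩ := exists_mem_forall_inner_eq_zero m hA.inv.pos
    (mulOp_coercive (hA.inv.bdd.rescale ε) fun y v => hA.inv.lower _ v) gradFields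
    isClosed_gradFields hf.toLp
  have hq' : ∀ k ∈ gradFields, inner ℂ k (hf.toLp - m q) = 0 := fun k hk => by
    rw [← neg_sub, inner_neg_right, hqk k hk, neg_zero]
  have hae := ae_integral_homIntegrand hgrad hA hs h h' hε hghat hX.four hdiv hφ hq hq'
  have hi := L2.integrable_inner (𝕜 := ℂ) (FT (hf.toLp - m q)) (FT W)
  have hi' := (hi.comp_smul (R := (2 * Real.pi)⁻¹) (by positivity)).const_mul
    ((twoPiFactor ^ 2 : ℝ) : ℂ)
  refine ⟨hi'.congr (hae.mono fun θ hθ => hθ.symm), ?_⟩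
  rw [integral_congr_ae hae, integral_const_mul, Measure.integral_comp_smul volume
    (fun ξ => inner ℂ (FT (hf.toLp - m q) ξ) (FT W ξ)) (2 * Real.pi)⁻¹, ← L2.inner_def,
    FT.inner_map_map]
  simp only [finrank_euclideanSpace, Fintype.card_fin]
  rw [inv_pow, inv_inv, abs_of_pos (by positivity), Complex.real_smul, ← mul_assoc,
    ← Complex.ofReal_mul, twoPiFactor_sq, Complex.ofReal_one, one_mul]
  simp_rw [cdot_app_root_inv (fun x => A (ε⁻¹ • x))]
  rw [integral_cdot_eq_inner (Lp.memLp X) hf, Lp.toLp_coeFn]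
  -- By symmetry of `A⁻¹` this is the pairing of the gradient `q` with the divergence-free field
  -- `A⁻¹ X`.
  have e1 : inner ℂ (m q) X = 0 := by
    rw [hm, mulOp_symm (hA.inv.bdd.rescale ε) fun y => inner_app_symm (hA.inv.symm _)]
    exact hX.perp q hq
  have e2 : inner ℂ (hf.toLp - m q) (X - W) = 0 := by
    rw [← inner_conj_symm, hq' _ hX.sub_mem, map_zero]
  rw [inner_sub_right, inner_sub_left, e1, sub_zero, sub_eq_zero] at e2
  exact e2

end Superposition

end PeriodicMaxwell

end

/-! ### Assembly of the main theorem. -/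

theorem mainTheorem4
    (μ : Measure R3) (hμper : PeriodicMeasure μ) (hμQ : μ Q = 1)
    (hμgrad : ∀ φ : R3 → ℂ, PerTest φ → ∀ j, ∫ y in Q, pd j φ y ∂μ = 0)
    (A : R3 → RMat) (hAper : Periodic A) (hApos : ∀ y, (A y).PosDef)
    (hAreg : ∀ i j, ContDiff ℝ 1 fun y => A y i j)
    (At : R3 → RMat) (hAtper : Periodic At) (hAtsymm : ∀ y, (At y).IsSymm)
    (hAtmeas : ∀ i j, Measurable fun y => At y i j)
    (a b : ℝ) (ha : 0 < a)
    (hAtlow : ∀ (y : R3) (v : Fin 3 → ℝ), a * (v ⬝ᵥ v) ≤ v ⬝ᵥ (At y *ᵥ v))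
    (hAtup : ∀ (y : R3) (v : Fin 3 → ℝ), v ⬝ᵥ (At y *ᵥ v) ≤ b * (v ⬝ᵥ v)) :
    -- the cell problems are solvable
    (∃ Ψ P, IsCellFamily μ A Ψ P) ∧ (∃ N R, IsMagneticCell μ A At N R) ∧
    -- the constant depends on the measure and the coefficients only
    ∃ C : ℝ, 0 < C ∧ ∀ Ψ P, IsCellFamily μ A Ψ P → ∀ N R, IsMagneticCell μ A At N R →
      ∀ ε : ℝ, 0 < ε →
        -- the inverse matrices in the symbol are genuine inverses
        (∀ θ, IsUnit (AhatHom μ A Ψ P (ε • θ)).det ∧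
          IsUnit (symb μ A At Ψ P R ε θ + 1).det) ∧
        ∀ g : R3 → C3, MemLp g 2 (scaled μ ε) → DivFree (scaled μ ε) g →
          (∃ D B, IsMaxwellSolution μ A At ε g D B) ∧
          (∃ ghat, IsFourier (scaled μ ε) g ghat) ∧
          ∀ D B, IsMaxwellSolution μ A At ε g D B →
            ∀ ghat, IsFourier (scaled μ ε) g ghat →
              ∃ U : R3 → C3, MemLp U 2 (scaled μ ε) ∧
                IsFieldIntegral (scaled μ ε) (homIntegrand μ A At Ψ P R ε ghat) U ∧
                eLpNorm (fun x => D x + U x) 2 (scaled μ ε)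
                  ≤ ENNReal.ofReal (C * ε) * eLpNorm g 2 (scaled μ ε) := by
  obtain rfl : μ = volume := eq_volume_of_integral_pd hμper hμQ hμgrad
  obtain ⟨C₁, C₂, α, β, hA⟩ := exists_isRootCoeff hAper hApos hAreg
  obtain ⟨c, hs⟩ := exists_isCoeff hAtper hAtsymm hAtmeas ha hAtlow hAtup
  obtain ⟨K, hK, hest⟩ := leading_estimate hμgrad hA hs
  have hC₂ := hA.root_inv.nonneg
  -- `C₂` bounds `A^{-1/2}`, through which the bound for `u + X` becomes one for `D + U = A^{-1/2}
  -- (u + X)`; the added `1` keeps the constant positive.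
  refine ⟨?_, exists_isMagneticCell hμgrad hA hs, (C₂ + 1) * K, by positivity,
    fun Ψ P h N R h' ε hε => ⟨isUnit_det_symb hμgrad hA hs h h' ε, ?_⟩⟩
  · choose Ψ P h using fun κ (j : Fin 3) =>
      exists_isCellSolution hμgrad hA.inv κ (EuclideanSpace.single j 1)
    exact ⟨Ψ, P, h⟩
  simp only [IsMaxwellSolution, MemHCurlWhole, scaled_volume hε]
  intro g hg hdiv
  have hS := hA.root.rescale ε
  have hS' := hA.root_inv.rescale ε
  have hdet : ∀ x, (msqrt (A (ε⁻¹ • x))).det ≠ 0 := fun x => det_msqrt_ne_zero (hApos _)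
  have hdivF : ∀ᵐ ξ : R3, inner ℂ (cv ξ) (FT (hg.toLp g) ξ) = 0 := by
    refine fourier_of_divFree fun φ hφ => ?_
    rw [← hdiv φ hφ]
    refine integral_congr_ae ?_
    filter_upwards [hg.coeFn_toLp] with x hx
    rw [hx]
  refine ⟨exists_maxwell hdet hS' (hs.bdd.rescale ε) ha (fun y v => hs.lower _ v) (hS.memLp hg),
    ⟨_, isFourier_fourierNorm hg⟩, fun D B hDB ghat hghat => ?_⟩
  obtain ⟨hD, heq⟩ := hDB
  obtain ⟨X, W, hX⟩ := exists_isLeading hμgrad hA hs h h' ε (hg.toLp g)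
  have hbound := hest Ψ P h N R h' ε hε _ _ _ X W (hD.fourier hS)
    (fourier_maxwell hA hs hg hD heq) hdivF hX
  refine ⟨fun x => app (cm (msqrt (A (ε⁻¹ • x)))⁻¹) (X x), hS'.memLp (Lp.memLp X),
    isFieldIntegral hμgrad hA hs h h' hε (hghat.ae_eq hg (isFourier_fourierNorm hg)) hX hdivF, ?_⟩
  set u := (hS.memLp hD.1).toLp with hu
  have e : (fun x => D x + app (cm (msqrt (A (ε⁻¹ • x)))⁻¹) (X x)) =ᵐ[volume]
      fun x => app (cm (msqrt (A (ε⁻¹ • x)))⁻¹) ((u + X) x) := by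
    filter_upwards [Lp.coeFn_add u X, (hS.memLp hD.1).coeFn_toLp] with x h1 h2
    rw [h1, Pi.add_apply, h2, app_add, app_inv_cm (hdet x)]
  rw [eLpNorm_congr_ae e]
  refine (hS'.eLpNorm_le _).trans ?_
  rw [← Lp.enorm_def, mul_assoc, ENNReal.ofReal_mul (by positivity), mul_assoc, ← Lp.enorm_toLp hg]
  exact mul_le_mul' (ENNReal.ofReal_le_ofReal (by linarith)) hbound
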